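/- **Setting.** All algebras are complex, associative and unital. *The group.* Let $G$ be a compact matrix quantum group, represented by the Hopf $*$-algebra $\mathcal A$ of polynomial functions on $G$, with coproduct $\phi(a)=a^{(1)}\otimes a^{(2)}$, counit $\epsilon$ and antipode $\kappa$; thus $\phi,\epsilon$ are $*$-homomorphisms and $\mathcal A$ is generated as an algebra by the entries of a finite unitary matrix $u$ with $\phi(u_{ij})=\sum_k u_{ik}\otimes u_{kj}$. *The horizontal forms.* Let $\mathfrak{hor}_P=\bigoplus_{n\ge 0}\mathfrak{hor}_P^n$ be a graded $*$-algebra (the antilinear involution preserves degrees and $(\varphi\psi)^*=(-1)^{\partial\varphi\,\partial\psi}\psi^*\varphi^*$). Let $F^\star:\mathfrak{hor}_P\to\mathfrak{hor}_P\otimes\mathcal A$, $F^\star(\varphi)=\sum_k\varphi_k\otimes c_k$, be a grade-preserving $*$-homomorphism with $(\mathrm{id}\otimes\phi)F^\star=(F^\star\otimes\mathrm{id})F^\star$ and $(\mathrm{id}\otimes\epsilon)F^\star=\mathrm{id}$. The algebra of the bundle $P$ is $\mathcal B=\mathfrak{hor}_P^0$. The action is free: each $a\in\mathcal A$ can be written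 as $1\otimes a=\sum_i (q_i\otimes 1)F^\star(b_i)$ with finitely many $q_i,b_i\in\mathcal B$. Let $\Omega_M=\{w\in\mathfrak{hor}_P: F^\star(w)=w\otimes 1\}$ be equipped with a hermitian linear map $d_M:\Omega_M\to\Omega_M$ of degree $1$ that satisfies the graded Leibniz rule and $d_M^2=0$. *Preconnections.* Let $\pi(P)$ be the set of linear maps $D:\mathfrak{hor}_P\to\mathfrak{hor}_P$ which raise degrees by $1$, satisfy $D(\varphi\psi)=D(\varphi)\psi+(-1)^{\partial\varphi}\varphi D(\psi)$, $D(\varphi^*)=D(\varphi)^*$ and $F^\star D=(D\otimes\mathrm{id})F^\star$, and coincide with $d_M$ on $\Omega_M$. Let $\overrightarrow{\pi}(P)$ be the real vector space of the maps $E$ with the same properties, except that $E=0$ on $\Omega_M$. Assume $\pi(P)\neq\emptyset$. **Statement.** For each $E\in\overrightarrow{\pi}(P)$ there is a unique linear map $\chi^\natural_E:\mathcal A\to\mathfrak{hor}_P$ with $$E(\varphi)=-(-1)^{\partial\varphi}\sum_k\varphi_k\,\chi^\natural_E(c_k)\qquad(\varphi\in\mathfrak{hor}_P\text{ homogeneous}),$$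 and for each $D\in\pi(P)$ there is a unique linear map $\varrho^\natural_D:\mathcal A\to\mathfrak{hor}_P$ with $D^2(\varphi)=-\sum_k\varphi_k\,\varrho^\natural_D(c_k)$ for all $\varphi\in\mathfrak{hor}_P$. Let $$\widehat{\mathcal R}=\{a\in\ker\epsilon:\ \varrho^\natural_D(a)=0\ \ \forall D\in\pi(P),\ \ \chi^\natural_E(a)=0\ \ \forall E\in\overrightarrow{\pi}(P)\}.$$ This is a right ideal of $\mathcal A$ with $\kappa(\widehat{\mathcal R})^*\subseteq\widehat{\mathcal R}$. Let $\Psi_{inv}=\ker\epsilon/\widehat{\mathcal R}$, let $\pi(a)$ be the class of $a-\epsilon(a)1$ for $a\in\mathcal A$, and put $\pi(b)\circ a=\pi(ba)-\epsilon(b)\pi(a)$ and $\pi(a)^*=-\pi(\kappa(a)^*)$. Let $\Psi_{inv}^\wedge$ be the graded algebra generated by $\Psi_{inv}$ (in degree $1$) with the relations $\pi(a^{(1)})\pi(a^{(2)})=0$ for $a\in\widehat{\mathcal R}$. The right action $\circ$ extends to it by $1\circ a=\epsilon(a)1$ and $(\vartheta\eta)\circ a=(\vartheta\circ a^{(1)})(\eta\circ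 a^{(2)})$, and $*$ extends to it by $(\vartheta\eta)^*=(-1)^{\partial\vartheta\,\partial\eta}\eta^*\vartheta^*$. Let $d\pi(a)=-\pi(a^{(1)})\pi(a^{(2)})$. Define linear maps $\chi_E,\varrho_D:\Psi_{inv}\to\mathfrak{hor}_P$ by $\chi_E\pi=\chi^\natural_E$ and $\varrho_D\pi=\varrho^\natural_D$. Let $\mathfrak{vh}_P=\mathfrak{hor}_P\otimes\Psi_{inv}^\wedge$ with the total grading and $$(\psi\otimes\eta)(\varphi\otimes\vartheta)=(-1)^{\partial\eta\,\partial\varphi}\sum_k\psi\varphi_k\otimes(\eta\circ c_k)\vartheta,\qquad (\varphi\otimes\vartheta)^*=\sum_k\varphi_k^*\otimes(\vartheta^*\circ c_k^*).$$ For each $D\in\pi(P)$ there is a unique linear map $\partial_D:\mathfrak{vh}_P\to\mathfrak{vh}_P$ which satisfies the graded Leibniz rule and $$\partial_D(\varphi)=D(\varphi)+(-1)^{\partial\varphi}\sum_k\varphi_k\,\pi(c_k)\ \ (\varphi\in\mathfrak{hor}_P\text{ homogeneous}),\qquad \partial_D(\vartheta)=\varrho_D(\vartheta)+d(\vartheta)\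 \ (\vartheta\in\Psi_{inv}),$$ and $(\mathfrak{vh}_P,\partial_D)$ is a graded-differential $*$-algebra: $\mathfrak{vh}_P$ is a graded algebra with a degree-preserving involution satisfying $(xy)^*=(-1)^{\partial x\,\partial y}y^*x^*$, and $\partial_D$ has degree $1$, $\partial_D^2=0$ and $\partial_D(x^*)=\partial_D(x)^*$. Moreover: (i) For each $E\in\overrightarrow{\pi}(P)$ there is a unique homomorphism of unital algebras $h_E:\mathfrak{vh}_P\to\mathfrak{vh}_P$ with $h_E(\varphi)=\varphi$ for $\varphi\in\mathfrak{hor}_P$ and $h_E(\vartheta)=\vartheta-\chi_E(\vartheta)$ for $\vartheta\in\Psi_{inv}$. (ii) The maps $h_E$ are hermitian and bijective. (iii) $h_Eh_W=h_{E+W}$ for all $E,W\in\overrightarrow{\pi}(P)$. (iv) $h_E$ is an isomorphism between the differential structures $(\mathfrak{vh}_P,\partial_D)$ and $(\mathfrak{vh}_P,\partial_{D+E})$, for all $E\in\overrightarrow{\pi}(P)$ and $D\in\pi(P)$: it preserves degrees and $h_E\,\partial_D=\partial_{D+E}\,h_E$. Consequently the algebras $(\mathfrak{vh}_P,\partial_D)$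 glue to a graded-differential $*$-algebra $\Omega_P$: let $\Omega_P$ be the algebra of the families $(x_D)_{D\in\pi(P)}$ of elements of $\mathfrak{vh}_P$ with $x_{D+E}=h_E(x_D)$ for all $D\in\pi(P)$, $E\in\overrightarrow{\pi}(P)$, with componentwise operations. Then for each $D$ the homomorphism $\Omega_P\to\mathfrak{vh}_P$, $x\mapsto x_D$, is bijective; $\Omega_P$ is closed under $(x_D)\mapsto(\partial_Dx_D)$ and $(x_D)\mapsto(x_D^*)$; and if one component $x_D$ of $x\in\Omega_P$ is homogeneous of degree $n$, then so are all the others. -/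

import Mathlib

open scoped TensorProduct
open Coalgebra HopfAlgebra

namespace QuantumBundle

set_option linter.unusedSectionVars false

noncomputable section

section Hopf

variable {A : Type*} [Ring A] [HopfAlgebra ℂ A]

theorem sum_antipode_comul (b : A) :
    LinearMap.mul' ℂ (A ⊗[ℂ] A)
      (TensorProduct.map ((TensorProduct.mk ℂ A A).flip 1 ∘ₗ antipode ℂ)
        (comul (R := ℂ) (A := A)) (comul b)) = 1 ⊗ₜ[ℂ] b := by
  let Ξ : A ⊗[ℂ] (A ⊗[ℂ] A) →ₗ[ℂ] A ⊗[ℂ] A :=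
    (LinearMap.mul' ℂ A ∘ₗ (antipode ℂ).rTensor A).rTensor A ∘ₗ
      (TensorProduct.assoc ℂ A A A).symm.toLinearMap
  have h1 : ∀ t : A ⊗[ℂ] A, LinearMap.mul' ℂ (A ⊗[ℂ] A)
      (TensorProduct.map ((TensorProduct.mk ℂ A A).flip 1 ∘ₗ antipode ℂ)
        (comul (R := ℂ) (A := A)) t) = Ξ ((comul (R := ℂ) (A := A)).lTensor A t) := by
    intro t
    induction t with
    | zero => simp
    | add x y hx hy => simp only [map_add, hx, hy]
    | tmul x y =>
      simp only [TensorProduct.map_tmul, LinearMap.lTensor_tmul, LinearMap.mul'_apply]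
      generalize comul (R := ℂ) y = z
      induction z with
      | zero => simp
      | add u v hu hv => simp only [mul_add, map_add, hu, hv, TensorProduct.tmul_add]
      | tmul u v => simp [Ξ]
  rw [h1, ← coassoc_apply]
  simp only [Ξ, LinearMap.comp_apply, LinearEquiv.coe_coe, LinearEquiv.symm_apply_apply]
  rw [← LinearMap.comp_apply, ← LinearMap.rTensor_comp, LinearMap.comp_assoc,
    HopfAlgebra.mul_antipode_rTensor_comul, LinearMap.rTensor_comp, LinearMap.comp_apply,
    rTensor_counit_comul]
  simp

/-- The antipode is anti-comultiplicative. -/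
theorem comul_antipode (a : A) :
    comul (R := ℂ) (antipode ℂ a) =
      TensorProduct.map (antipode ℂ) (antipode ℂ) (TensorProduct.comm ℂ A A (comul a)) := by
  let G : A →ₗ[ℂ] A ⊗[ℂ] A := TensorProduct.map (antipode ℂ) (antipode ℂ) ∘ₗ
    (TensorProduct.comm ℂ A A).toLinearMap ∘ₗ comul
  have hr := LinearMap.comul_right_inv (R := ℂ) (C := A)
  have hl : WithConv.toConv G * WithConv.toConv (comul (R := ℂ) (A := A)) = 1 := by
    ext a
    rw [LinearMap.convMul_apply, LinearMap.convOne_apply]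
    let Ψ : A ⊗[ℂ] (A ⊗[ℂ] A) →ₗ[ℂ] A ⊗[ℂ] A :=
      LinearMap.mul' ℂ (A ⊗[ℂ] A) ∘ₗ TensorProduct.map
        (TensorProduct.mk ℂ A A 1 ∘ₗ antipode ℂ)
        (LinearMap.mul' ℂ (A ⊗[ℂ] A) ∘ₗ
          TensorProduct.map ((TensorProduct.mk ℂ A A).flip 1 ∘ₗ antipode ℂ)
            (comul (R := ℂ) (A := A)))
    have h1 : ∀ t : A ⊗[ℂ] A, LinearMap.mul' ℂ (A ⊗[ℂ] A)
        (TensorProduct.map G (comul (R := ℂ) (A := A)) t) =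
          Ψ (TensorProduct.assoc ℂ A A A ((comul (R := ℂ) (A := A)).rTensor A t)) := by
      intro t
      induction t with
      | zero => simp
      | add x y hx hy => simp only [map_add, hx, hy]
      | tmul x y =>
        simp only [TensorProduct.map_tmul, LinearMap.rTensor_tmul, LinearMap.mul'_apply, G,
          LinearMap.comp_apply]
        generalize comul (R := ℂ) x = z
        induction z with
        | zero => simp
        | add u v hu hv => simp only [add_mul, map_add, hu, hv, TensorProduct.add_tmul]
        | tmul u v => simp [Ψ, ← mul_assoc]
    have h2 : ∀ t : A ⊗[ℂ] A, Ψ ((comul (R := ℂ) (A := A)).lTensor A t) =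
        1 ⊗ₜ LinearMap.mul' ℂ A ((antipode ℂ).rTensor A t) := by
      intro t
      induction t with
      | zero => simp
      | add x y hx hy => simp only [map_add, hx, hy, TensorProduct.tmul_add]
      | tmul x y => simp [Ψ, sum_antipode_comul]
    change LinearMap.mul' ℂ (A ⊗[ℂ] A)
        (TensorProduct.map G (comul (R := ℂ) (A := A)) (comul a)) = _
    rw [h1, coassoc_apply, h2, HopfAlgebra.mul_antipode_rTensor_comul_apply,
      Algebra.TensorProduct.algebraMap_apply, Algebra.algebraMap_eq_smul_one,
      TensorProduct.tmul_smul, TensorProduct.smul_tmul']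
  have := left_inv_eq_right_inv hl hr
  exact (LinearMap.congr_fun (WithConv.toConv_injective this) a).symm

end Hopf
/-- Hopf *-algebras: the coproduct and the counit are *-homomorphisms. -/
class HopfStar (A : Type*) [Ring A] [HopfAlgebra ℂ A] [StarRing A] [StarModule ℂ A] : Prop where
  comul_star : ∀ a : A, comul (R := ℂ) (star a) = star (comul (R := ℂ) a)
  counit_star : ∀ a : A, counit (R := ℂ) (star a) = star (counit (R := ℂ) a)

/-- The Hopf *-algebra of polynomial functions on a compact matrix quantum group: it is
generated, as an algebra, by the matrix elements of a finite-dimensional unitary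
corepresentation `u`. -/
class CompactMatrixQuantumGroup (A : Type*) [Ring A] [HopfAlgebra ℂ A] [StarRing A]
    [StarModule ℂ A] : Prop extends HopfStar A where
  exists_unitary_generators : ∃ (n : ℕ) (u : Matrix (Fin n) (Fin n) A),
    u.conjTranspose * u = 1 ∧ u * u.conjTranspose = 1 ∧
    (∀ i j, comul (R := ℂ) (u i j) = ∑ k, u i k ⊗ₜ[ℂ] u k j) ∧
    Algebra.adjoin ℂ (Set.range fun p : Fin n × Fin n => u p.1 p.2) = ⊤

/-- The right ideals of `A` inside `ker ε` which are stable under `a ↦ κ(a)^*`: those which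
correspond to left-covariant first-order *-calculi on the quantum group. -/
structure CalculusIdeal (A : Type*) [Ring A] [HopfAlgebra ℂ A] [StarRing A] where
  carrier : Submodule ℂ A
  counit_eq_zero : ∀ a ∈ carrier, counit (R := ℂ) a = 0
  mul_mem : ∀ a ∈ carrier, ∀ b : A, a * b ∈ carrier
  star_antipode_mem : ∀ a ∈ carrier, star (antipode ℂ a) ∈ carrier

section Quad

variable {A : Type*} [Ring A] [HopfAlgebra ℂ A]

/-- The element `π(a⁽¹⁾) π(a⁽²⁾)`, for a linear map `p` in the role of `π`. -/
def quad {X : Type*} [Semiring X] [Algebra ℂ X] (p : A →ₗ[ℂ] X) : A →ₗ[ℂ] X :=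
  LinearMap.mul' ℂ X ∘ₗ TensorProduct.map p p ∘ₗ comul

theorem quad_apply {X : Type*} [Semiring X] [Algebra ℂ X] (p : A →ₗ[ℂ] X) (a : A) :
    quad p a = ∑ i ∈ (ℛ ℂ a).index, p ((ℛ ℂ a).left i) * p ((ℛ ℂ a).right i) := by
  simp only [quad, LinearMap.comp_apply]
  conv_lhs => rw [← (ℛ ℂ a).eq]
  simp

theorem quad_comp {X Y : Type*} [Semiring X] [Algebra ℂ X] [Semiring Y] [Algebra ℂ Y]
    (f : X →ₐ[ℂ] Y) (p : A →ₗ[ℂ] X) (a : A) : f (quad p a) = quad (f.toLinearMap.comp p) a := by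
  simp [quad_apply]

end Quad

section Envelope

variable {A : Type*} [Ring A] [HopfAlgebra ℂ A] [StarRing A]
variable (R : CalculusIdeal A)

/-- The space `Ψ_inv` of left-invariant one-forms of the first-order calculus determined by the
right ideal `R ⊆ ker ε`. It is `ker ε / R`, written as the quotient of `A = ker ε ⊕ ℂ1`
by `R ⊕ ℂ1`. -/
abbrev InvForms : Type _ := A ⧸ (R.carrier ⊔ Submodule.span ℂ {(1 : A)})

/-- The canonical projection `π : A → Ψ_inv`. -/
def proj : A →ₗ[ℂ] InvForms R := (R.carrier ⊔ Submodule.span ℂ {(1 : A)}).mkQ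

variable {R} in
theorem proj_eq_zero {a : A} (ha : a ∈ R.carrier) : proj R a = 0 :=
  (Submodule.Quotient.mk_eq_zero _).2 (Submodule.mem_sup_left ha)

theorem proj_one : proj R (1 : A) = 0 :=
  (Submodule.Quotient.mk_eq_zero _).2
    (Submodule.mem_sup_right (Submodule.mem_span_singleton_self _))

theorem proj_surjective : Function.Surjective (proj R) := Submodule.mkQ_surjective _

theorem invForms_le_ker {X : Type*} [AddCommGroup X] [Module ℂ X] {σ : ℂ →+* ℂ}
    (f : A →ₛₗ[σ] X) (hR : ∀ a ∈ R.carrier, f a = 0) (h1 : f 1 = 0) :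
    R.carrier ⊔ Submodule.span ℂ {(1 : A)} ≤ LinearMap.ker f := by
  refine sup_le (fun a ha => hR a ha) ?_
  rw [Submodule.span_le]
  rintro _ rfl
  exact h1

/-- The right `A`-module structure on `Ψ_inv`, given by
`π(b) ∘ a = π((b - ε(b)1) a) = π(ba) - ε(b) π(a)`. -/
def invAct : InvForms R →ₗ[ℂ] A →ₗ[ℂ] InvForms R :=
  (R.carrier ⊔ Submodule.span ℂ {(1 : A)}).liftQ
    ((LinearMap.mul ℂ A).compr₂ (proj R) - (LinearMap.toSpanSingleton ℂ _ (proj R)).comp counit)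
    (invForms_le_ker R _
      (fun a ha => by
        ext b
        simp [proj_eq_zero (R.mul_mem a ha b), R.counit_eq_zero a ha])
      (by ext b; simp))

theorem invAct_proj (b a : A) :
    invAct R (proj R b) a = proj R (b * a) - counit (R := ℂ) b • proj R a := rfl

/-- The involution on `Ψ_inv`, given by `π(a)^* = -π(κ(a)^*)`. -/
def invStar [StarModule ℂ A] : InvForms R →ₛₗ[starRingEnd ℂ] InvForms R :=
  (R.carrier ⊔ Submodule.span ℂ {(1 : A)}).liftQ
    (-((proj R).comp (((starLinearEquiv ℂ (A := A)).toLinearMap).comp (antipode ℂ (A := A)))))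
    (invForms_le_ker R _
      (fun a ha => by simp [proj_eq_zero (R.star_antipode_mem a ha)])
      (by simp [proj_one]))

theorem invStar_proj [StarModule ℂ A] (a : A) :
    invStar R (proj R a) = - proj R (star (antipode ℂ a)) := rfl

/-- The quadratic relations `π(a⁽¹⁾) ⊗ π(a⁽²⁾) = 0`, `a ∈ R`, of the universal envelope. -/
inductive EnvRel : TensorAlgebra ℂ (InvForms R) → TensorAlgebra ℂ (InvForms R) → Prop
  | quad (a : A) (ha : a ∈ R.carrier) :
      EnvRel (quad ((TensorAlgebra.ι ℂ).comp (proj R)) a) 0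

/-- The left-invariant part `Ψ_inv^∧` of the universal differential envelope: the algebra
generated by `Ψ_inv` with the quadratic relations `π(a⁽¹⁾) π(a⁽²⁾) = 0`, `a ∈ R`. -/
def InvEnvelope : Type _ := RingQuot (EnvRel R)

instance : Ring (InvEnvelope R) := inferInstanceAs (Ring (RingQuot (EnvRel R)))

instance : Algebra ℂ (InvEnvelope R) := inferInstanceAs (Algebra ℂ (RingQuot (EnvRel R)))

/-- The quotient map from the tensor algebra. -/
def envMk : TensorAlgebra ℂ (InvForms R) →ₐ[ℂ] InvEnvelope R :=
  RingQuot.mkAlgHom ℂ (EnvRel R)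

variable {R} in
theorem envMk_quad {a : A} (ha : a ∈ R.carrier) :
    envMk R (quad ((TensorAlgebra.ι ℂ).comp (proj R)) a) = 0 :=
  (RingQuot.mkAlgHom_rel ℂ (EnvRel.quad a ha)).trans (map_zero (envMk R))

/-- The inclusion `Ψ_inv → Ψ_inv^∧`. -/
def incl : InvForms R →ₗ[ℂ] InvEnvelope R :=
  (envMk R).toLinearMap.comp (TensorAlgebra.ι ℂ)

/-- `π` as a map into `Ψ_inv^∧`. -/
def envProj : A →ₗ[ℂ] InvEnvelope R := (incl R).comp (proj R)

variable {R} in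
theorem quad_envProj {a : A} (ha : a ∈ R.carrier) : quad (envProj R) a = 0 := by
  have := envMk_quad ha
  rw [quad_comp] at this
  exact this

theorem envProj_one : envProj R (1 : A) = 0 := by simp [envProj, proj_one]

variable {R} in
theorem envProj_eq_zero {a : A} (ha : a ∈ R.carrier) : envProj R a = 0 := by
  simp [envProj, proj_eq_zero ha]

variable {R} in
/-- The universal property of `Ψ_inv^∧`. -/
def envLift {X : Type*} [Semiring X] [Algebra ℂ X] (f : InvForms R →ₗ[ℂ] X)
    (hf : ∀ a ∈ R.carrier, quad (f.comp (proj R)) a = 0) : InvEnvelope R →ₐ[ℂ] X :=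
  RingQuot.liftAlgHom ℂ ⟨TensorAlgebra.lift ℂ f, by
    rintro _ _ ⟨a, ha⟩
    rw [quad_comp, map_zero, ← hf a ha, ← LinearMap.comp_assoc, TensorAlgebra.ι_comp_lift]⟩

variable {R} in
theorem envLift_incl {X : Type*} [Semiring X] [Algebra ℂ X] (f : InvForms R →ₗ[ℂ] X)
    (hf : ∀ a ∈ R.carrier, quad (f.comp (proj R)) a = 0) (θ : InvForms R) :
    envLift f hf (incl R θ) = f θ :=
  (RingQuot.liftAlgHom_mkAlgHom_apply ℂ (TensorAlgebra.lift ℂ f) _ _).trans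
    (TensorAlgebra.lift_ι_apply f θ)

variable {R} in
theorem env_induction {C : InvEnvelope R → Prop} (h0 : ∀ r, C (algebraMap ℂ _ r))
    (h1 : ∀ θ, C (incl R θ)) (hm : ∀ x y, C x → C y → C (x * y))
    (ha : ∀ x y, C x → C y → C (x + y)) (x : InvEnvelope R) : C x := by
  obtain ⟨x, rfl⟩ : ∃ y, envMk R y = x := RingQuot.mkAlgHom_surjective ℂ (EnvRel R) x
  induction x using TensorAlgebra.induction with
  | algebraMap r => simpa using h0 r
  | ι θ => exact h1 θ
  | mul x y hx hy => simpa using hm _ _ hx hy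
  | add x y hx hy => simpa using ha _ _ hx hy

variable {R} in
theorem env_hom_ext {X : Type*} [Semiring X] [Algebra ℂ X] {f g : InvEnvelope R →ₐ[ℂ] X}
    (h : ∀ θ, f (incl R θ) = g (incl R θ)) : f = g := by
  apply RingQuot.ringQuot_ext'
  apply TensorAlgebra.hom_ext
  exact LinearMap.ext h

/-- The grading of `Ψ_inv^∧`. -/
def envDeg (n : ℕ) : Submodule ℂ (InvEnvelope R) := (LinearMap.range (incl R)) ^ n

/-- The parity automorphism of `Ψ_inv^∧`, equal to `(-1)^n` in degree `n`. -/
def envParity : InvEnvelope R →ₐ[ℂ] InvEnvelope R :=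
  envLift (-(incl R)) (fun a ha => by
    have := quad_envProj ha
    rw [quad_apply] at this ⊢
    simpa [envProj] using this)

theorem envParity_incl (θ : InvForms R) : envParity R (incl R θ) = - incl R θ :=
  envLift_incl _ _ θ


theorem envActHom_aux (a : A) (ha : a ∈ R.carrier) :
    quad (((WithConv.linearEquiv ℂ (A →ₗ[ℂ] InvEnvelope R)).symm.toLinearMap ∘ₗ
      (invAct R).compr₂ (incl R)) ∘ₗ proj R) a = 0 := by
  ext c
  have key : ∀ b d : A, incl R (invAct R (proj R b) d) =
      envProj R (b * d) - counit (R := ℂ) b • envProj R d := by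
    intro b d
    simp [invAct_proj, envProj]
  have T1 : ∑ i ∈ (ℛ ℂ a).index, ∑ j ∈ (ℛ ℂ c).index,
      envProj R ((ℛ ℂ a).left i * (ℛ ℂ c).left j) *
        envProj R ((ℛ ℂ a).right i * (ℛ ℂ c).right j) = 0 := by
    have := quad_envProj (R.mul_mem a ha c)
    rw [quad, LinearMap.comp_apply, LinearMap.comp_apply, Bialgebra.comul_mul] at this
    nth_rewrite 1 [← (ℛ ℂ a).eq, ← (ℛ ℂ c).eq] at this
    simpa [Finset.sum_mul_sum] using this
  have T2 : ∀ j, ∑ i ∈ (ℛ ℂ a).index, counit (R := ℂ) ((ℛ ℂ a).left i) •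
        envProj R ((ℛ ℂ a).right i * (ℛ ℂ c).right j) = 0 := by
    intro j
    have := envProj_eq_zero (R.mul_mem a ha ((ℛ ℂ c).right j))
    nth_rewrite 1 [← sum_counit_smul (ℛ ℂ a)] at this
    simpa [Finset.sum_mul] using this
  have T3 : ∀ j, ∑ i ∈ (ℛ ℂ a).index, counit (R := ℂ) ((ℛ ℂ a).right i) •
        envProj R ((ℛ ℂ a).left i * (ℛ ℂ c).left j) = 0 := by
    intro j
    have := envProj_eq_zero (R.mul_mem a ha ((ℛ ℂ c).left j))
    have h2 := congr(TensorProduct.rid ℂ A $(sum_tmul_counit_eq (ℛ ℂ a)))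
    simp only [map_sum, TensorProduct.rid_tmul, one_smul] at h2
    nth_rewrite 1 [← h2] at this
    simpa [Finset.sum_mul] using this
  have T4 : ∑ i ∈ (ℛ ℂ a).index, counit (R := ℂ) ((ℛ ℂ a).left i) *
      counit (R := ℂ) ((ℛ ℂ a).right i) = 0 := by
    have := R.counit_eq_zero a ha
    nth_rewrite 1 [← sum_counit_smul (ℛ ℂ a)] at this
    simpa using this
  have T5 : ∑ j ∈ (ℛ ℂ c).index, envProj R ((ℛ ℂ c).left j) *
      ∑ i ∈ (ℛ ℂ a).index, counit (R := ℂ) ((ℛ ℂ a).left i) •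
        envProj R ((ℛ ℂ a).right i * (ℛ ℂ c).right j) = 0 := by simp [T2]
  have T6 : ∑ j ∈ (ℛ ℂ c).index,
      (∑ i ∈ (ℛ ℂ a).index, counit (R := ℂ) ((ℛ ℂ a).right i) •
        envProj R ((ℛ ℂ a).left i * (ℛ ℂ c).left j)) * envProj R ((ℛ ℂ c).right j) = 0 := by
    simp [T3]
  simp only [Finset.mul_sum, Finset.sum_mul] at T5 T6
  rw [Finset.sum_comm] at T5 T6
  have T7 : ∑ i ∈ (ℛ ℂ a).index, ∑ j ∈ (ℛ ℂ c).index,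
      (counit (R := ℂ) ((ℛ ℂ a).left i) * counit (R := ℂ) ((ℛ ℂ a).right i)) •
        (envProj R ((ℛ ℂ c).left j) * envProj R ((ℛ ℂ c).right j)) = 0 := by
    simp only [← Finset.smul_sum, ← Finset.sum_smul, T4, zero_smul]
  have expand : ∀ i j,
      (envProj R ((ℛ ℂ a).left i * (ℛ ℂ c).left j) -
        counit (R := ℂ) ((ℛ ℂ a).left i) • envProj R ((ℛ ℂ c).left j)) *
      (envProj R ((ℛ ℂ a).right i * (ℛ ℂ c).right j) -
        counit (R := ℂ) ((ℛ ℂ a).right i) • envProj R ((ℛ ℂ c).right j)) =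
      envProj R ((ℛ ℂ a).left i * (ℛ ℂ c).left j) *
        envProj R ((ℛ ℂ a).right i * (ℛ ℂ c).right j) -
      envProj R ((ℛ ℂ c).left j) * counit (R := ℂ) ((ℛ ℂ a).left i) •
        envProj R ((ℛ ℂ a).right i * (ℛ ℂ c).right j) -
      (counit (R := ℂ) ((ℛ ℂ a).right i) • envProj R ((ℛ ℂ a).left i * (ℛ ℂ c).left j)) *
        envProj R ((ℛ ℂ c).right j) +
      (counit (R := ℂ) ((ℛ ℂ a).left i) * counit (R := ℂ) ((ℛ ℂ a).right i)) •
        (envProj R ((ℛ ℂ c).left j) * envProj R ((ℛ ℂ c).right j)) := by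
    intro i j
    simp only [sub_mul, mul_sub, smul_mul_assoc, mul_smul_comm, smul_smul, smul_sub]
    rw [mul_comm (counit (R := ℂ) ((ℛ ℂ a).right i))]
    abel
  have total : ∑ i ∈ (ℛ ℂ a).index, ∑ j ∈ (ℛ ℂ c).index,
      (incl R (invAct R (proj R ((ℛ ℂ a).left i)) ((ℛ ℂ c).left j))) *
      (incl R (invAct R (proj R ((ℛ ℂ a).right i)) ((ℛ ℂ c).right j))) = 0 := by
    simp only [key, expand, Finset.sum_add_distrib, Finset.sum_sub_distrib]
    rw [T1, T5, T6, T7]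
    simp
  rw [quad_apply]
  simp only [WithConv.ofConv_sum, LinearMap.sum_apply, (ℛ ℂ c).convMul_apply]
  exact total

/-- The right `A`-module structure on `Ψ_inv^∧`: the extension of `invAct` which satisfies
`1 ∘ a = ε(a) 1` and `(ϑη) ∘ a = (ϑ ∘ a⁽¹⁾)(η ∘ a⁽²⁾)`; that is, an algebra homomorphism into the
convolution algebra of linear maps `A → Ψ_inv^∧`. -/
def envActHom : InvEnvelope R →ₐ[ℂ] WithConv (A →ₗ[ℂ] InvEnvelope R) :=
  envLift ((WithConv.linearEquiv ℂ _).symm.toLinearMap ∘ₗ (invAct R).compr₂ (incl R))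
    (envActHom_aux R)

/-- The action `ϑ, a ↦ ϑ ∘ a` of `A` on `Ψ_inv^∧`. -/
def envAct : InvEnvelope R →ₗ[ℂ] A →ₗ[ℂ] InvEnvelope R :=
  (WithConv.linearEquiv ℂ _).toLinearMap ∘ₗ (envActHom R).toLinearMap

theorem envAct_algebraMap (r : ℂ) (a : A) :
    envAct R (algebraMap ℂ _ r) a = r • algebraMap ℂ _ (counit (R := ℂ) a) := by
  simp [envAct]

theorem envAct_one (a : A) :
    envAct R 1 a = algebraMap ℂ _ (counit (R := ℂ) a) := by
  simpa using envAct_algebraMap R 1 a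

theorem envAct_incl (θ : InvForms R) (a : A) :
    envAct R (incl R θ) a = incl R (invAct R θ a) := by
  simp [envAct, envActHom, envLift_incl]

theorem envAct_mul (x y : InvEnvelope R) (a : A) :
    envAct R (x * y) a = LinearMap.mul' ℂ _
      (TensorProduct.map (envAct R x) (envAct R y) (comul a)) := by
  simp [envAct]

theorem invAct_mul (θ : InvForms R) (a b : A) :
    invAct R θ (a * b) = invAct R (invAct R θ a) b := by
  obtain ⟨c, rfl⟩ := proj_surjective R θ
  simp only [invAct_proj, map_sub, map_smul, LinearMap.sub_apply, LinearMap.smul_apply, mul_assoc,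
    Bialgebra.counit_mul, smul_sub, smul_smul]
  abel

theorem invAct_one (θ : InvForms R) : invAct R θ 1 = θ := by
  obtain ⟨c, rfl⟩ := proj_surjective R θ
  simp [invAct_proj, proj_one]

theorem envAct_apply_one (x : InvEnvelope R) : envAct R x 1 = x := by
  induction x using env_induction with
  | h0 r => rw [envAct_algebraMap]; simp [Algebra.algebraMap_eq_smul_one]
  | h1 θ => rw [envAct_incl, invAct_one]
  | hm x y hx hy => simp [envAct_mul, Algebra.TensorProduct.one_def, hx, hy]
  | ha x y hx hy => simp [hx, hy]

theorem envAct_apply_mul (x : InvEnvelope R) (a b : A) :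
    envAct R x (a * b) = envAct R (envAct R x a) b := by
  induction x using env_induction generalizing a b with
  | h0 r =>
    simp only [envAct_algebraMap, map_smul, LinearMap.smul_apply, Bialgebra.counit_mul, map_mul]
    simp [Algebra.algebraMap_eq_smul_one, smul_smul, mul_comm]
  | h1 θ => rw [envAct_incl, invAct_mul, envAct_incl, envAct_incl]
  | hm x y hx hy =>
    rw [envAct_mul, envAct_mul, Bialgebra.comul_mul]
    generalize comul (R := ℂ) a = s
    induction s with
    | zero => simp
    | add u v hu hv => simp only [add_mul, map_add, hu, hv, LinearMap.add_apply]
    | tmul u v =>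
      simp only [TensorProduct.map_tmul, LinearMap.mul'_apply, envAct_mul]
      generalize comul (R := ℂ) b = t
      induction t with
      | zero => simp
      | add u v hu hv => simp only [mul_add, map_add, hu, hv]
      | tmul u v => simp [hx, hy]
  | ha x y hx hy => simp [hx, hy]

theorem envParity_act (x : InvEnvelope R) (a : A) :
    envParity R (envAct R x a) = envAct R (envParity R x) a := by
  induction x using env_induction generalizing a with
  | h0 r => simp [envAct_algebraMap]
  | h1 θ => simp [envAct_incl, envParity_incl]
  | hm x y hx hy =>
    rw [envAct_mul, map_mul, envAct_mul]
    generalize comul (R := ℂ) a = t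
    induction t with
    | zero => simp
    | add u v hu hv => simp only [map_add, hu, hv]
    | tmul u v => simp [hx, hy]
  | ha x y hx hy => simp [hx, hy]

theorem envParity_of_mem {n : ℕ} {x : InvEnvelope R} (hx : x ∈ envDeg R n) :
    envParity R x = (-1 : ℂ) ^ n • x := by
  induction n generalizing x with
  | zero =>
    rw [envDeg, pow_zero, Submodule.mem_one] at hx
    obtain ⟨c, rfl⟩ := hx
    simp
  | succ n ih =>
    rw [envDeg, pow_succ'] at hx
    induction hx using Submodule.mul_induction_on' with
    | mem_mul_mem a ha b hb =>
      obtain ⟨θ, rfl⟩ := ha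
      rw [map_mul, envParity_incl, ih hb, pow_succ]
      simp
    | add a _ b _ ha hb => rw [map_add, ha, hb, smul_add]

/-- The restriction to `Ψ_inv` of the differential `d` of `Ψ_inv^∧`:
`d π(a) = -π(a⁽¹⁾) π(a⁽²⁾)`. -/
def dInv : InvForms R →ₗ[ℂ] InvEnvelope R :=
  (R.carrier ⊔ Submodule.span ℂ {(1 : A)}).liftQ (-quad (envProj R))
    (invForms_le_ker R _ (fun a ha => by simp [quad_envProj ha])
      (by simp [quad, Algebra.TensorProduct.one_def, envProj_one]))

end Envelope

section ConjEnd

/-- The ring of complex-linear endomorphisms of `M`, with the complex-conjugate scalar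
multiplication. -/
def ConjEnd (M : Type*) [AddCommGroup M] [Module ℂ M] : Type _ := Module.End ℂ M

variable {M : Type*} [AddCommGroup M] [Module ℂ M]

instance : Ring (ConjEnd M) := inferInstanceAs (Ring (Module.End ℂ M))

instance : Algebra ℂ (ConjEnd M) :=
  RingHom.toAlgebra' (R := ℂ) (S := ConjEnd M)
    ((algebraMap ℂ (Module.End ℂ M)).comp (starRingEnd ℂ))
    (fun c x => Algebra.commutes (A := Module.End ℂ M) (starRingEnd ℂ c) x)

/-- The evaluation of an element of `ConjEnd M`. -/
def ConjEnd.eval (f : ConjEnd M) (x : M) : M := DFunLike.coe (F := Module.End ℂ M) f x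

theorem ConjEnd.smul_eval (c : ℂ) (f : ConjEnd M) (x : M) :
    (c • f).eval x = (starRingEnd ℂ) c • f.eval x := rfl

theorem ConjEnd.ext {f g : ConjEnd M} (h : ∀ x, f.eval x = g.eval x) : f = g :=
  LinearMap.ext h

theorem ConjEnd.one_eval (x : M) : (1 : ConjEnd M).eval x = x := rfl

theorem ConjEnd.add_eval (f g : ConjEnd M) (x : M) : (f + g).eval x = f.eval x + g.eval x := rfl

theorem ConjEnd.mul_eval (f g : ConjEnd M) (x : M) : (f * g).eval x = f.eval (g.eval x) := rfl

theorem ConjEnd.zero_eval (x : M) : (0 : ConjEnd M).eval x = 0 := rfl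

theorem ConjEnd.sum_eval {ι : Type*} (s : Finset ι) (f : ι → ConjEnd M) (x : M) :
    (∑ i ∈ s, f i).eval x = ∑ i ∈ s, (f i).eval x :=
  LinearMap.sum_apply (M := M) (M₂ := M) (σ₁₂ := RingHom.id ℂ) s f x

end ConjEnd

section EnvStar

variable {A : Type*} [Ring A] [HopfAlgebra ℂ A] [StarRing A] [StarModule ℂ A] [HopfStar A]
variable (R : CalculusIdeal A)

theorem quad_star_antipode {X : Type*} [Semiring X] [Algebra ℂ X] (p : A →ₗ[ℂ] X) (a : A) :
    quad p (star (antipode ℂ a)) = ∑ i ∈ (ℛ ℂ a).index,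
      p (star (antipode ℂ ((ℛ ℂ a).right i))) * p (star (antipode ℂ ((ℛ ℂ a).left i))) := by
  rw [quad, LinearMap.comp_apply, LinearMap.comp_apply, HopfStar.comul_star, comul_antipode]
  conv_lhs => rw [← (ℛ ℂ a).eq]
  simp only [map_sum, TensorProduct.comm_tmul, TensorProduct.map_tmul, star_sum,
    TensorProduct.star_tmul, LinearMap.mul'_apply]

/-- `ϑ ↦ (x ↦ (-1)^{∂x} x ϑ^*)`, for `ϑ ∈ Ψ_inv`. -/
def envStarGen : InvForms R →ₗ[ℂ] ConjEnd (InvEnvelope R) where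
  toFun θ := (LinearMap.mulRight ℂ (incl R (invStar R θ)) ∘ₗ (envParity R).toLinearMap :
    Module.End ℂ (InvEnvelope R))
  map_add' θ η := by
    refine ConjEnd.ext fun x => ?_
    change envParity R x * incl R (invStar R (θ + η)) =
      envParity R x * incl R (invStar R θ) + envParity R x * incl R (invStar R η)
    rw [map_add, map_add, mul_add]
  map_smul' c θ := by
    refine ConjEnd.ext fun x => ?_
    change envParity R x * incl R (invStar R (c • θ)) =
      (starRingEnd ℂ c) • (envParity R x * incl R (invStar R θ))
    rw [map_smulₛₗ, map_smul, mul_smul_comm]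

theorem envStarGen_eval (θ : InvForms R) (x : InvEnvelope R) :
    (envStarGen R θ).eval x = envParity R x * incl R (invStar R θ) := rfl

theorem envParity_envParity (x : InvEnvelope R) : envParity R (envParity R x) = x := by
  have : (envParity R).comp (envParity R) = AlgHom.id ℂ _ :=
    env_hom_ext fun θ => by simp [envParity_incl]
  exact congr($this x)

/-- The algebra homomorphism extending `envStarGen`. -/
def envStarHom : InvEnvelope R →ₐ[ℂ] ConjEnd (InvEnvelope R) :=
  envLift (envStarGen R) (fun a ha => by
    have h0 := quad_envProj (R.star_antipode_mem a ha)
    rw [quad_star_antipode] at h0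
    rw [quad_apply]
    have key : ∀ x : InvEnvelope R, ∑ i ∈ (ℛ ℂ a).index,
        envParity R (envParity R x * incl R (invStar R (proj R ((ℛ ℂ a).right i)))) *
          incl R (invStar R (proj R ((ℛ ℂ a).left i))) = 0 := by
      intro x
      have h1 : -(x * ∑ i ∈ (ℛ ℂ a).index, envProj R (star (antipode ℂ ((ℛ ℂ a).right i))) *
        envProj R (star (antipode ℂ ((ℛ ℂ a).left i)))) = 0 := by rw [h0]; simp
      rw [← h1, Finset.mul_sum, ← Finset.sum_neg_distrib]
      refine Finset.sum_congr rfl fun i _ => ?_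
      rw [map_mul, envParity_envParity, envParity_incl, invStar_proj, invStar_proj]
      simp [envProj, mul_assoc]
    refine ConjEnd.ext fun x => ?_
    rw [ConjEnd.sum_eval, ConjEnd.zero_eval]
    simpa only [ConjEnd.mul_eval, LinearMap.comp_apply, envStarGen_eval] using key x)

/-- The involution of `Ψ_inv^∧`: the conjugate-linear extension of the involution of `Ψ_inv` with
`1^* = 1` and `(ϑ w)^* = (-1)^{∂w} w^* ϑ^*` for `ϑ ∈ Ψ_inv`, in other words the extension which is
graded-antimultiplicative. -/
def envStar : InvEnvelope R →ₛₗ[starRingEnd ℂ] InvEnvelope R where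
  toFun w := (envStarHom R w).eval 1
  map_add' x y := by rw [map_add, ConjEnd.add_eval]
  map_smul' c x := by rw [map_smul, ConjEnd.smul_eval]

theorem envStar_one : envStar R 1 = 1 := by
  change (envStarHom R 1).eval 1 = 1
  rw [map_one, ConjEnd.one_eval]

theorem envStar_incl_mul (θ : InvForms R) (w : InvEnvelope R) :
    envStar R (incl R θ * w) = envParity R (envStar R w) * incl R (invStar R θ) := by
  change (envStarHom R (incl R θ * w)).eval 1 = _
  rw [map_mul, ConjEnd.mul_eval, envStarHom, envLift_incl, envStarGen_eval]
  rfl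

theorem envStar_incl (θ : InvForms R) : envStar R (incl R θ) = incl R (invStar R θ) := by
  simpa [envStar_one] using envStar_incl_mul R θ 1

theorem envStar_mem {n : ℕ} {x : InvEnvelope R} (hx : x ∈ envDeg R n) :
    envStar R x ∈ envDeg R n := by
  induction n generalizing x with
  | zero =>
    rw [envDeg, pow_zero, Submodule.mem_one] at hx
    obtain ⟨c, rfl⟩ := hx
    rw [Algebra.algebraMap_eq_smul_one, map_smulₛₗ, envStar_one, envDeg, pow_zero]
    exact Submodule.smul_mem _ _ (Submodule.mem_one.2 ⟨1, map_one _⟩)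
  | succ n ih =>
    rw [envDeg, pow_succ'] at hx
    induction hx using Submodule.mul_induction_on' with
    | mem_mul_mem a ha b hb =>
      obtain ⟨θ, rfl⟩ := ha
      rw [envStar_incl_mul, envParity_of_mem R (ih hb), envDeg, pow_succ]
      exact Submodule.mul_mem_mul (Submodule.smul_mem _ _ (ih hb)) ⟨_, rfl⟩
    | add a _ b _ ha hb => rw [map_add]; exact Submodule.add_mem _ ha hb

/-- The involution of `Ψ_inv^∧` is graded-antimultiplicative. -/
theorem envStar_mul {m n : ℕ} {x y : InvEnvelope R} (hx : x ∈ envDeg R m) (hy : y ∈ envDeg R n) :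
    envStar R (x * y) = (-1 : ℂ) ^ (m * n) • (envStar R y * envStar R x) := by
  induction m generalizing x with
  | zero =>
    rw [envDeg, pow_zero, Submodule.mem_one] at hx
    obtain ⟨c, rfl⟩ := hx
    simp [Algebra.algebraMap_eq_smul_one, envStar_one]
  | succ m ih =>
    rw [envDeg, pow_succ'] at hx
    induction hx using Submodule.mul_induction_on' with
    | mem_mul_mem a ha b hb =>
      obtain ⟨θ, rfl⟩ := ha
      rw [mul_assoc, envStar_incl_mul, ih hb, envStar_incl_mul, map_smul, map_mul,
        envParity_of_mem R (envStar_mem R hy), add_mul, one_mul, pow_add]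
      simp [smul_smul, mul_assoc]
    | add a _ b _ ha hb => rw [add_mul, map_add, ha, hb, map_add, mul_add, smul_add]

end EnvStar

section Bundle

variable {A : Type*} [Ring A] [HopfAlgebra ℂ A] [StarRing A] [StarModule ℂ A]
variable {H : Type*} [Ring H] [Algebra ℂ H] [StarAddMonoid H] [StarModule ℂ H]

/-- The subalgebra of elements which are invariant under a coaction `F`. -/
def invariants (F : H →ₐ[ℂ] H ⊗[ℂ] A) : Subalgebra ℂ H :=
  AlgHom.equalizer F Algebra.TensorProduct.includeLeft

variable (A) in
/-- A quantum principal bundle with its horizontal forms and a calculus on the base: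
* `H = ⊕ 𝓗 k` is a graded *-algebra (the involution is graded-antimultiplicative) and
  `F : H → H ⊗ A` is a grade-preserving *-homomorphism which is a coaction of `A`;
* the degree zero part `𝓗 0`, with the restriction of `F`, is the quantum principal bundle;
  its base is the *-algebra of `F`-invariant elements of degree zero, and the action is free;
* `dM` makes the graded *-algebra `Ω_M` of `F`-invariant elements of `H` a graded-differential
  *-algebra. -/
structure HorizontalForms (𝓗 : ℕ → Submodule ℂ H) [GradedAlgebra 𝓗] where
  F : H →ₐ[ℂ] H ⊗[ℂ] A
  star_mem : ∀ n, ∀ φ ∈ 𝓗 n, star φ ∈ 𝓗 n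
  star_mul : ∀ m n, ∀ φ ∈ 𝓗 m, ∀ ψ ∈ 𝓗 n,
    star (φ * ψ) = (-1 : ℂ) ^ (m * n) • (star ψ * star φ)
  F_star : ∀ φ, F (star φ) = star (F φ)
  F_mem : ∀ n, ∀ φ ∈ 𝓗 n, F φ ∈ LinearMap.range ((𝓗 n).subtype.rTensor A)
  coassoc : ∀ φ, (comul (R := ℂ) (A := A)).lTensor H (F φ) =
    TensorProduct.assoc ℂ H A A (F.toLinearMap.rTensor A (F φ))
  counit_F : ∀ φ, (counit (R := ℂ) (A := A)).lTensor H (F φ) = φ ⊗ₜ[ℂ] 1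
  free : ∀ a : A, ∃ (n : ℕ) (q b : Fin n → H), (∀ i, q i ∈ 𝓗 0) ∧ (∀ i, b i ∈ 𝓗 0) ∧
    ∑ i, (q i ⊗ₜ[ℂ] (1 : A)) * F (b i) = 1 ⊗ₜ[ℂ] a
  dM : invariants F →ₗ[ℂ] invariants F
  dM_mem : ∀ n, ∀ x : invariants F, (x : H) ∈ 𝓗 n → (dM x : H) ∈ 𝓗 (n + 1)
  dM_mul : ∀ n, ∀ x y : invariants F, (x : H) ∈ 𝓗 n →
    dM (x * y) = dM x * y + (-1 : ℂ) ^ n • (x * dM y)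
  dM_dM : ∀ x, dM (dM x) = 0
  dM_star : ∀ x y : invariants F, (y : H) = star (x : H) → (dM y : H) = star (dM x : H)

namespace HorizontalForms

variable {𝓗 : ℕ → Submodule ℂ H} [GradedAlgebra 𝓗] (S : HorizontalForms A 𝓗)

/-- Hermitian first-order right-covariant antiderivations on the horizontal forms. -/
structure IsAntiderivation (D : H →ₗ[ℂ] H) : Prop where
  map_mem : ∀ n, ∀ φ ∈ 𝓗 n, D φ ∈ 𝓗 (n + 1)
  covariant : ∀ φ, S.F (D φ) = D.rTensor A (S.F φ)
  leibniz : ∀ n, ∀ φ ∈ 𝓗 n, ∀ ψ, D (φ * ψ) = D φ * ψ + (-1 : ℂ) ^ n • (φ * D ψ)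
  map_star : ∀ φ, D (star φ) = star (D φ)

/-- The set `π(P)` of preconnections. -/
def preconnections : Set (H →ₗ[ℂ] H) :=
  {D | S.IsAntiderivation D ∧ ∀ x : invariants S.F, D x = S.dM x}

/-- The real vector space of hermitian first-order right-covariant antiderivations which vanish
on `Ω_M`; it is the vector space of the real affine space of preconnections. -/
def differences : Submodule ℝ (H →ₗ[ℂ] H) where
  carrier := {E | S.IsAntiderivation E ∧ ∀ x : invariants S.F, E x = 0}
  zero_mem' := ⟨⟨fun n φ _ => by simp, fun φ => by simp, fun n φ _ ψ => by simp,
    fun φ => by simp⟩, fun x => by simp⟩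
  add_mem' := by
    rintro E W ⟨hE, hE0⟩ ⟨hW, hW0⟩
    refine ⟨⟨fun n φ hφ => ?_, fun φ => ?_, fun n φ hφ ψ => ?_, fun φ => ?_⟩, fun x => ?_⟩
    · exact Submodule.add_mem _ (hE.map_mem n φ hφ) (hW.map_mem n φ hφ)
    · simp [hE.covariant, hW.covariant, LinearMap.rTensor_add]
    · simp only [LinearMap.add_apply, hE.leibniz n φ hφ, hW.leibniz n φ hφ, add_mul, mul_add,
        smul_add]
      abel
    · simp [hE.map_star, hW.map_star]
    · simp [hE0, hW0]
  smul_mem' := by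
    rintro c E ⟨hE, hE0⟩
    have hc : (c • E : H →ₗ[ℂ] H) = (c : ℂ) • E := rfl
    rw [hc]
    refine ⟨⟨fun n φ hφ => ?_, fun φ => ?_, fun n φ hφ ψ => ?_, fun φ => ?_⟩, fun x => ?_⟩
    · exact Submodule.smul_mem _ _ (hE.map_mem n φ hφ)
    · rw [LinearMap.smul_apply, map_smul, hE.covariant, LinearMap.rTensor_smul,
        LinearMap.smul_apply]
    · simp only [LinearMap.smul_apply, hE.leibniz n φ hφ, smul_add, smul_mul_assoc, mul_smul_comm,
        smul_comm (c : ℂ)]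
    · simp [hE.map_star, star_smul]
    · simp [hE0]

/-- The translation `D ↦ D + E` of preconnections. -/
instance : VAdd S.differences S.preconnections where
  vadd E D := ⟨D.1 + E.1, by
    obtain ⟨D, hD, hD0⟩ := D
    obtain ⟨E, hE, hE0⟩ := E
    refine ⟨⟨fun n φ hφ => ?_, fun φ => ?_, fun n φ hφ ψ => ?_, fun φ => ?_⟩, fun x => ?_⟩
    · exact Submodule.add_mem _ (hD.map_mem n φ hφ) (hE.map_mem n φ hφ)
    · simp [hD.covariant, hE.covariant, LinearMap.rTensor_add]
    · simp only [LinearMap.add_apply, hD.leibniz n φ hφ, hE.leibniz n φ hφ, add_mul, mul_add,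
        smul_add]
      abel
    · simp [hD.map_star, hE.map_star]
    · simp [hD0, hE0]⟩

theorem coe_vadd (E : S.differences) (D : S.preconnections) :
    ((E +ᵥ D : S.preconnections) : H →ₗ[ℂ] H) = D + E := rfl

/-- For a linear map `χ : A → H`, the map `φ ⊗ c ↦ φ χ(c)`. -/
def contract (χ : A →ₗ[ℂ] H) : H ⊗[ℂ] A →ₗ[ℂ] H := LinearMap.mul' ℂ H ∘ₗ χ.lTensor H

/-- `χ` is the map `χ♮_E` of `E`: one has `E(φ) = -(-1)^{∂φ} ∑ φ_k χ(c_k)` where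
`F(φ) = ∑ φ_k ⊗ c_k`. -/
def IsChiNat (E : H →ₗ[ℂ] H) (χ : A →ₗ[ℂ] H) : Prop :=
  ∀ n, ∀ φ ∈ 𝓗 n, E φ = -((-1 : ℂ) ^ n • contract χ (S.F φ))

/-- `ρ` is the map `ϱ♮_D` of `D`: one has `D²(φ) = -∑ φ_k ρ(c_k)` where
`F(φ) = ∑ φ_k ⊗ c_k`. -/
def IsRhoNat (D : H →ₗ[ℂ] H) (ρ : A →ₗ[ℂ] H) : Prop :=
  ∀ φ, D (D φ) = -contract ρ (S.F φ)

open Classical in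
/-- The map `χ♮_E : A → H` (zero if there is none). -/
def chiNat (E : H →ₗ[ℂ] H) : A →ₗ[ℂ] H :=
  if h : ∃ χ, S.IsChiNat E χ then h.choose else 0

open Classical in
/-- The map `ϱ♮_D : A → H` (zero if there is none). -/
def rhoNat (D : H →ₗ[ℂ] H) : A →ₗ[ℂ] H :=
  if h : ∃ ρ, S.IsRhoNat D ρ then h.choose else 0

/-- On the bundle, `Δ` is a hermitian derivation, of the form `Δ(b) = -∑ b_k χ(c_k)`. -/
structure IsBaseDerivation (Δ : H →ₗ[ℂ] H) (χ : A →ₗ[ℂ] H) : Prop where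
  apply_eq : ∀ b ∈ 𝓗 0, Δ b = -contract χ (S.F b)
  leibniz : ∀ b ∈ 𝓗 0, ∀ b' ∈ 𝓗 0, Δ (b * b') = Δ b * b' + b * Δ b'
  map_star : ∀ b ∈ 𝓗 0, Δ (star b) = star (Δ b)

theorem one_mem_zero : (1 : H) ∈ 𝓗 0 := SetLike.GradedOne.one_mem

theorem mul_mem_zero {b b' : H} (hb : b ∈ 𝓗 0) (hb' : b' ∈ 𝓗 0) : b * b' ∈ 𝓗 0 := by
  simpa using SetLike.GradedMul.mul_mem hb hb'

theorem star_mul_zero (S : HorizontalForms A 𝓗) {b : H} (hb : b ∈ 𝓗 0) (φ : H) :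
    star (b * φ) = star φ * star b ∧ star (φ * b) = star b * star φ := by
  classical
  induction φ using DirectSum.Decomposition.inductionOn 𝓗 with
  | zero => simp
  | homogeneous φ =>
    refine ⟨?_, ?_⟩
    · simpa using S.star_mul 0 _ b hb φ φ.2
    · simpa using S.star_mul _ 0 φ φ.2 b hb
  | add x y hx hy =>
    exact ⟨by rw [mul_add, star_add, hx.1, hy.1, star_add, add_mul],
      by rw [add_mul, star_add, hx.2, hy.2, star_add, mul_add]⟩

variable {S}

theorem contract_tmul_mul (χ : A →ₗ[ℂ] H) (q : H) (t : H ⊗[ℂ] A) :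
    contract χ ((q ⊗ₜ 1) * t) = q * contract χ t := by
  induction t with
  | zero => simp
  | add u v hu hv => simp only [mul_add, map_add, hu, hv]
  | tmul u v => simp [contract, mul_assoc]

theorem contract_one_tmul (χ : A →ₗ[ℂ] H) (a : A) : contract χ (1 ⊗ₜ a) = χ a := by
  simp [contract]

theorem IsBaseDerivation.map_one {Δ : H →ₗ[ℂ] H} {χ : A →ₗ[ℂ] H} (h : S.IsBaseDerivation Δ χ) :
    Δ 1 = 0 ∧ χ 1 = 0 := by
  have h1 := h.leibniz 1 one_mem_zero 1 one_mem_zero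
  have h2 : Δ 1 = 0 := by simpa using h1
  refine ⟨h2, ?_⟩
  have h3 := h.apply_eq 1 one_mem_zero
  rw [h2, _root_.map_one, Algebra.TensorProduct.one_def, contract_one_tmul] at h3
  simpa using h3.symm

/-- `χ(a) b = ∑ b_k χ(a c_k) + ε(a) Δ(b)`. -/
theorem IsBaseDerivation.chi_mul {Δ : H →ₗ[ℂ] H} {χ : A →ₗ[ℂ] H} (h : S.IsBaseDerivation Δ χ)
    (a : A) {b : H} (hb : b ∈ 𝓗 0) :
    χ a * b = contract (χ ∘ₗ LinearMap.mulLeft ℂ a) (S.F b) + counit (R := ℂ) a • Δ b := by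
  obtain ⟨n, q, e, hq, he, hqe⟩ := S.free a
  have h1 : ∑ i, q i * Δ (e i) = - χ a := by
    have := congr(contract χ $hqe)
    rw [map_sum, contract_one_tmul] at this
    rw [← this, ← Finset.sum_neg_distrib]
    refine Finset.sum_congr rfl fun i _ => ?_
    rw [h.apply_eq _ (he i), contract_tmul_mul, mul_neg]
  have h2 : ∑ i, q i * e i = counit (R := ℂ) a • (1 : H) := by
    have := congr(TensorProduct.rid ℂ H ((counit (R := ℂ) (A := A)).lTensor H $hqe))
    rw [map_sum, map_sum] at this
    simp only [LinearMap.lTensor_tmul, TensorProduct.rid_tmul] at this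
    rw [← this]
    refine Finset.sum_congr rfl fun i _ => ?_
    have h3 : ∀ t : H ⊗[ℂ] A, (counit (R := ℂ) (A := A)).lTensor H ((q i ⊗ₜ[ℂ] (1 : A)) * t) =
        (q i ⊗ₜ[ℂ] (1 : ℂ)) * (counit (R := ℂ) (A := A)).lTensor H t := by
      intro t
      induction t with
      | zero => simp
      | add u v hu hv => simp only [mul_add, map_add, hu, hv]
      | tmul u v => simp
    rw [h3, S.counit_F]
    simp
  have h4 : ∑ i, q i * Δ (e i * b) = - contract (χ ∘ₗ LinearMap.mulLeft ℂ a) (S.F b) := by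
    have h5 : contract χ ((1 ⊗ₜ[ℂ] a) * S.F b) = contract (χ ∘ₗ LinearMap.mulLeft ℂ a) (S.F b) := by
      generalize S.F b = t
      induction t with
      | zero => simp
      | add u v hu hv => simp only [mul_add, map_add, hu, hv]
      | tmul u v => simp [contract]
    rw [← h5, ← hqe, Finset.sum_mul, map_sum, ← Finset.sum_neg_distrib]
    refine Finset.sum_congr rfl fun i _ => ?_
    rw [h.apply_eq _ (mul_mem_zero (he i) hb), map_mul, mul_assoc, contract_tmul_mul, mul_neg]
  have h6 : ∑ i, q i * Δ (e i * b) = - χ a * b + counit (R := ℂ) a • Δ b := by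
    rw [← h1, ← one_mul (Δ b), ← smul_mul_assoc, ← h2, Finset.sum_mul, Finset.sum_mul,
      ← Finset.sum_add_distrib]
    refine Finset.sum_congr rfl fun i _ => ?_
    rw [h.leibniz _ (he i) _ hb, mul_add, mul_assoc, mul_assoc]
  rw [h4] at h6
  rw [neg_mul] at h6
  have h7 := congrArg Neg.neg h6
  rw [neg_neg, neg_add, neg_neg] at h7
  rw [h7]
  abel

theorem IsBaseDerivation.chi_mul_eq_zero {Δ : H →ₗ[ℂ] H} {χ : A →ₗ[ℂ] H}
    (h : S.IsBaseDerivation Δ χ) {c : A} (hc : counit (R := ℂ) c = 0) (hχ : χ c = 0) (a : A) :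
    χ (c * a) = 0 := by
  obtain ⟨n, q, e, hq, he, hqe⟩ := S.free a
  have h1 : ∀ i, contract (χ ∘ₗ LinearMap.mulLeft ℂ c) (S.F (e i)) = 0 := by
    intro i
    have := h.chi_mul c (he i)
    rw [hχ, zero_mul, hc, zero_smul, add_zero] at this
    exact this.symm
  have := congr(contract (χ ∘ₗ LinearMap.mulLeft ℂ c) $hqe)
  rw [map_sum, contract_one_tmul] at this
  simp only [contract_tmul_mul, h1, mul_zero, Finset.sum_const_zero] at this
  exact this.symm

theorem star_one_eq (S : HorizontalForms A 𝓗) : star (1 : H) = 1 := by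
  have h := (S.star_mul_zero one_mem_zero (star (1 : H))).1
  rw [one_mul, star_star, one_mul] at h
  exact h.symm

theorem IsBaseDerivation.chi_star [HopfStar A] {Δ : H →ₗ[ℂ] H} {χ : A →ₗ[ℂ] H}
    (h : S.IsBaseDerivation Δ χ) (a : A) : χ (star (antipode ℂ a)) = -star (χ a) := by
  let σ : A →ₛₗ[starRingEnd ℂ] A := (starLinearEquiv ℂ (A := A)).toLinearMap
  let τ : H →ₛₗ[starRingEnd ℂ] H := (starLinearEquiv ℂ (A := H)).toLinearMap
  let ψ₁ : A →ₛₗ[starRingEnd ℂ] H := χ.comp (σ.comp (antipode ℂ (A := A)))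
  let ψ₂ : A →ₛₗ[starRingEnd ℂ] H := τ.comp χ
  let P : (A →ₛₗ[starRingEnd ℂ] H) → (H ⊗[ℂ] A →ₛₗ[starRingEnd ℂ] H) := fun ψ =>
    TensorProduct.lift (LinearMap.mk₂'ₛₗ (starRingEnd ℂ) (starRingEnd ℂ)
      (fun (b : H) (c : A) => ψ c * star b) (fun b b' c => by simp [mul_add])
      (fun r b c => by simp) (fun b c c' => by simp [add_mul])
      (fun r b c => by simp))
  have P_tmul : ∀ ψ b c, P ψ (b ⊗ₜ c) = ψ c * star b := fun ψ b c => rfl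
  have P2 : ∀ b ∈ 𝓗 0, P ψ₂ (S.F b) = - star (Δ b) := by
    intro b hb
    rw [h.apply_eq b hb, star_neg, neg_neg]
    obtain ⟨t, ht⟩ := S.F_mem 0 b hb
    rw [← ht]
    clear ht
    induction t with
    | zero => simp
    | add u v hu hv => simp only [map_add, hu, hv, star_add]
    | tmul u v =>
      rw [LinearMap.rTensor_tmul, P_tmul]
      change star (χ v) * star (u : H) = star ((u : H) * χ v)
      exact (S.star_mul_zero u.2 _).1.symm
  have P1 : ∀ b ∈ 𝓗 0, P ψ₁ (S.F b) = Δ (star b) := by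
    intro b hb
    let Z : H ⊗[ℂ] (A ⊗[ℂ] A) →ₛₗ[starRingEnd ℂ] H :=
      TensorProduct.lift (LinearMap.mk₂'ₛₗ (starRingEnd ℂ) (starRingEnd ℂ)
        (fun (b : H) (c : A ⊗[ℂ] A) =>
          star b * χ (star (LinearMap.mul' ℂ A ((antipode ℂ).lTensor A c))))
        (fun b b' c => by simp [add_mul]) (fun r b c => by simp)
        (fun b c c' => by simp [mul_add]) (fun r b c => by simp))
    have Z_tmul : ∀ b c, Z (b ⊗ₜ c) =
      star b * χ (star (LinearMap.mul' ℂ A ((antipode ℂ).lTensor A c))) := fun b c => rfl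
    have e1 : ∀ t : H ⊗[ℂ] A, Z ((comul (R := ℂ) (A := A)).lTensor H t) = 0 := by
      intro t
      induction t with
      | zero => simp
      | add u v hu hv => simp only [map_add, hu, hv, add_zero]
      | tmul u v =>
        rw [LinearMap.lTensor_tmul, Z_tmul, HopfAlgebra.mul_antipode_lTensor_comul_apply,
          Algebra.algebraMap_eq_smul_one, star_smul, map_smul, star_one, h.map_one.2]
        simp
    have e2 : ∀ t : 𝓗 0 ⊗[ℂ] A, P ψ₁ ((𝓗 0).subtype.rTensor A t) =
        Z (TensorProduct.assoc ℂ H A A (S.F.toLinearMap.rTensor A ((𝓗 0).subtype.rTensor A t))) +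
        Δ (star (TensorProduct.rid ℂ H
          ((counit (R := ℂ) (A := A)).lTensor H ((𝓗 0).subtype.rTensor A t)))) := by
      intro t
      induction t with
      | zero => simp
      | add u v hu hv =>
        simp only [map_add, hu, hv, star_add]
        abel
      | tmul u v =>
        rw [LinearMap.rTensor_tmul, P_tmul, LinearMap.rTensor_tmul, LinearMap.lTensor_tmul,
          TensorProduct.rid_tmul]
        change χ (star (antipode ℂ v)) * star (u : H) = _
        rw [h.chi_mul _ (S.star_mem 0 _ u.2), HopfStar.counit_star, counit_antipode, S.F_star]
        congr 1
        · simp only [AlgHom.toLinearMap_apply, Submodule.subtype_apply]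
          generalize S.F (u : H) = t
          induction t with
          | zero => simp
          | add u v hu hv => simp only [map_add, star_add, hu, hv, TensorProduct.add_tmul]
          | tmul x y => simp [contract, Z_tmul]
        · simp
    obtain ⟨t, ht⟩ := S.F_mem 0 b hb
    rw [← ht, e2, ht, ← S.coassoc, e1, S.counit_F]
    simp
  have P0 : ∀ b ∈ 𝓗 0, P (ψ₁ + ψ₂) (S.F b) = 0 := by
    intro b hb
    have e : ∀ t, P (ψ₁ + ψ₂) t = P ψ₁ t + P ψ₂ t := by
      intro t
      induction t with
      | zero => simp
      | add u v hu hv =>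
        simp only [map_add, hu, hv]
        abel
      | tmul u v => simp [P_tmul, add_mul]
    rw [e, P1 b hb, P2 b hb, h.map_star b hb, add_neg_cancel]
  obtain ⟨n, q, e, hq, he, hqe⟩ := S.free a
  have e3 : ∀ i, P (ψ₁ + ψ₂) ((q i ⊗ₜ[ℂ] (1 : A)) * S.F (e i)) = 0 := by
    intro i
    have e4 : ∀ t : H ⊗[ℂ] A, P (ψ₁ + ψ₂) ((q i ⊗ₜ[ℂ] (1 : A)) * t) =
        P (ψ₁ + ψ₂) t * star (q i) := by
      intro t
      induction t with
      | zero => simp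
      | add u v hu hv => simp only [mul_add, map_add, hu, hv, add_mul]
      | tmul u v =>
        rw [Algebra.TensorProduct.tmul_mul_tmul, one_mul, P_tmul, P_tmul,
          (S.star_mul_zero (hq i) u).1, mul_assoc]
    rw [e4, P0 _ (he i), zero_mul]
  have := congr(P (ψ₁ + ψ₂) $hqe)
  rw [map_sum, Finset.sum_congr rfl fun i _ => e3 i, Finset.sum_const_zero, P_tmul,
    S.star_one_eq, mul_one] at this
  exact eq_neg_of_add_eq_zero_left this.symm

theorem chiNat_spec {E : H →ₗ[ℂ] H} (hE : E ∈ S.differences) :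
    S.IsBaseDerivation E (S.chiNat E) ∨ S.chiNat E = 0 := by
  by_cases h : ∃ χ, S.IsChiNat E χ
  · left
    have h1 : S.chiNat E = h.choose := dif_pos h
    have h2 := h.choose_spec
    rw [← h1] at h2
    obtain ⟨hE, hE0⟩ := hE
    exact ⟨fun b hb => by simpa using h2 0 b hb,
      fun b hb b' hb' => by simpa using hE.leibniz 0 b hb b', fun b _ => hE.map_star b⟩
  · exact Or.inr (dif_neg h)

theorem rhoNat_spec {D : H →ₗ[ℂ] H} (hD : D ∈ S.preconnections) :
    S.IsBaseDerivation (D ∘ₗ D) (S.rhoNat D) ∨ S.rhoNat D = 0 := by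
  by_cases h : ∃ ρ, S.IsRhoNat D ρ
  · left
    have h1 : S.rhoNat D = h.choose := dif_pos h
    have h2 := h.choose_spec
    rw [← h1] at h2
    obtain ⟨hD, hD0⟩ := hD
    refine ⟨fun b _ => h2 b, fun b hb b' hb' => ?_, fun b _ => ?_⟩
    · have e1 := hD.leibniz 0 b hb
      have e2 := hD.leibniz 1 (D b) (hD.map_mem 0 b hb)
      simp only [pow_zero, one_smul, pow_one, neg_smul] at e1 e2
      simp only [LinearMap.comp_apply]
      rw [e1, map_add, e2, e1]
      abel
    · simp [hD.map_star]
  · exact Or.inr (dif_neg h)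

theorem chiNat_one {E : H →ₗ[ℂ] H} (hE : E ∈ S.differences) : S.chiNat E 1 = 0 := by
  rcases S.chiNat_spec hE with h | h
  · exact h.map_one.2
  · simp [h]

theorem rhoNat_one {D : H →ₗ[ℂ] H} (hD : D ∈ S.preconnections) : S.rhoNat D 1 = 0 := by
  rcases S.rhoNat_spec hD with h | h
  · exact h.map_one.2
  · simp [h]

variable (S)

/-- The right ideal `R̂ ⊆ ker ε`: the intersection of all the ideals
`{a ∈ ker ε | ϱ♮_D(a) = 0}` and `{a ∈ ker ε | χ♮_E(a) = 0}`. -/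
def idealHat [HopfStar A] : CalculusIdeal A where
  carrier := LinearMap.ker (counit (R := ℂ) (A := A)) ⊓
    (⨅ D ∈ S.preconnections, LinearMap.ker (S.rhoNat D)) ⊓
    (⨅ E ∈ S.differences, LinearMap.ker (S.chiNat E))
  counit_eq_zero := fun a ha => ha.1.1
  mul_mem := by
    rintro a ⟨⟨ha, hD⟩, hE⟩ b
    simp only [SetLike.mem_coe, Submodule.mem_iInf, LinearMap.mem_ker] at ha hD hE
    simp only [Submodule.mem_inf, Submodule.mem_iInf, LinearMap.mem_ker]
    refine ⟨⟨by simp [ha], fun D hD' => ?_⟩, fun E hE' => ?_⟩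
    · rcases S.rhoNat_spec hD' with h | h
      · exact h.chi_mul_eq_zero ha (hD D hD') b
      · simp [h]
    · rcases S.chiNat_spec hE' with h | h
      · exact h.chi_mul_eq_zero ha (hE E hE') b
      · simp [h]
  star_antipode_mem := by
    rintro a ⟨⟨ha, hD⟩, hE⟩
    simp only [SetLike.mem_coe, Submodule.mem_iInf, LinearMap.mem_ker] at ha hD hE
    simp only [Submodule.mem_inf, Submodule.mem_iInf, LinearMap.mem_ker]
    refine ⟨⟨by simp [HopfStar.counit_star, ha], fun D hD' => ?_⟩, fun E hE' => ?_⟩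
    · rcases S.rhoNat_spec hD' with h | h
      · rw [h.chi_star, hD D hD', star_zero, neg_zero]
      · simp [h]
    · rcases S.chiNat_spec hE' with h | h
      · rw [h.chi_star, hE E hE', star_zero, neg_zero]
      · simp [h]

/-- The map `χ_E : Ψ_inv → H` with `χ_E π = χ♮_E`. -/
def chi [HopfStar A] (E : S.differences) : InvForms S.idealHat →ₗ[ℂ] H :=
  (S.idealHat.carrier ⊔ Submodule.span ℂ {(1 : A)}).liftQ (S.chiNat E)
    (invForms_le_ker _ _ (fun a ha => by
      have := ha.2
      simp only [SetLike.mem_coe, Submodule.mem_iInf, LinearMap.mem_ker] at this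
      exact this E E.2) (S.chiNat_one E.2))

/-- The curvature `ϱ_D : Ψ_inv → H` of `D`, with `ϱ_D π = ϱ♮_D`. -/
def curvature [HopfStar A] (D : S.preconnections) : InvForms S.idealHat →ₗ[ℂ] H :=
  (S.idealHat.carrier ⊔ Submodule.span ℂ {(1 : A)}).liftQ (S.rhoNat D)
    (invForms_le_ker _ _ (fun a ha => by
      have := ha.1.2
      simp only [SetLike.mem_coe, Submodule.mem_iInf, LinearMap.mem_ker] at this
      exact this D D.2) (S.rhoNat_one D.2))

end HorizontalForms

end Bundle

section VerticalHorizontal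

variable {A : Type*} [Ring A] [HopfAlgebra ℂ A] [StarRing A] [StarModule ℂ A]
variable {H : Type*} [Ring H] [Algebra ℂ H] [StarAddMonoid H] [StarModule ℂ H]
variable {𝓗 : ℕ → Submodule ℂ H} [GradedAlgebra 𝓗]
variable (S : HorizontalForms A 𝓗) (R : CalculusIdeal A)

/-- The exchange map `η, φ ↦ (-1)^{∂η ∂φ} ∑ φ_k ⊗ (η ∘ c_k)`, where `F(φ) = ∑ φ_k ⊗ c_k`.
On the component of `φ` of degree `m` the sign is the `m`-th power of the parity automorphism,
applied to `η`. -/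
def cross : H →ₗ[ℂ] InvEnvelope R →ₗ[ℂ] H ⊗[ℂ] InvEnvelope R :=
  DirectSum.toModule ℂ ℕ _ (fun m =>
    (LinearMap.flip (LinearMap.lTensorHom H ∘ₗ envAct R ∘ₗ ((envParity R).toLinearMap ^ m)) ∘ₗ
      S.F.toLinearMap) ∘ₗ (𝓗 m).subtype) ∘ₗ
    (DirectSum.decomposeLinearEquiv 𝓗).toLinearMap

theorem cross_of_mem {m : ℕ} {φ : H} (hφ : φ ∈ 𝓗 m) (η : InvEnvelope R) :
    cross S R φ η = (envAct R (((envParity R).toLinearMap ^ m) η)).lTensor H (S.F φ) := by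
  lift φ to 𝓗 m using hφ
  rw [cross, LinearMap.comp_apply, LinearEquiv.coe_coe, DirectSum.decomposeLinearEquiv_apply,
    DirectSum.decompose_coe, ← DirectSum.lof_eq_of ℂ, DirectSum.toModule_lof]
  simp

/-- The product `(ψ ⊗ η)(φ ⊗ ϑ) = (-1)^{∂η ∂φ} ∑ ψ φ_k ⊗ (η ∘ c_k) ϑ`. -/
def vhMul : (H ⊗[ℂ] InvEnvelope R) ⊗[ℂ] (H ⊗[ℂ] InvEnvelope R) →ₗ[ℂ] H ⊗[ℂ] InvEnvelope R :=
  TensorProduct.map (LinearMap.mul' ℂ H) (LinearMap.mul' ℂ (InvEnvelope R)) ∘ₗ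
  (TensorProduct.assoc ℂ H H (InvEnvelope R ⊗[ℂ] InvEnvelope R)).symm.toLinearMap ∘ₗ
  LinearMap.lTensor H (TensorProduct.assoc ℂ H (InvEnvelope R) (InvEnvelope R)).toLinearMap ∘ₗ
  LinearMap.lTensor H ((TensorProduct.lift (cross S R).flip).rTensor (InvEnvelope R)) ∘ₗ
  LinearMap.lTensor H (TensorProduct.assoc ℂ (InvEnvelope R) H (InvEnvelope R)).symm.toLinearMap ∘ₗ
  (TensorProduct.assoc ℂ H (InvEnvelope R) (H ⊗[ℂ] InvEnvelope R)).toLinearMap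

theorem vhMul_tmul {m : ℕ} (ψ : H) (η : InvEnvelope R) {φ : H} (hφ : φ ∈ 𝓗 m)
    (θ : InvEnvelope R) :
    vhMul S R ((ψ ⊗ₜ η) ⊗ₜ (φ ⊗ₜ θ)) = TensorProduct.map (LinearMap.mulLeft ℂ ψ)
      (LinearMap.mulRight ℂ θ ∘ₗ envAct R (((envParity R).toLinearMap ^ m) η)) (S.F φ) := by
  simp only [vhMul, LinearMap.comp_apply, LinearEquiv.coe_coe, TensorProduct.assoc_tmul,
    LinearMap.lTensor_tmul, TensorProduct.assoc_symm_tmul, LinearMap.rTensor_tmul,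
    TensorProduct.lift.tmul, LinearMap.flip_apply, cross_of_mem S R hφ]
  generalize S.F φ = t
  induction t with
  | zero => simp
  | add u v hu hv => simp only [map_add, TensorProduct.add_tmul, TensorProduct.tmul_add, hu, hv]
  | tmul u v => simp

/-- The algebra `vh_P = hor_P ⊗ Ψ_inv^∧` of vertically-horizontally decomposed forms. -/
def VH (_S : HorizontalForms A 𝓗) (R : CalculusIdeal A) : Type _ := H ⊗[ℂ] InvEnvelope R

instance : AddCommGroup (VH S R) := inferInstanceAs (AddCommGroup (H ⊗[ℂ] InvEnvelope R))

instance : Module ℂ (VH S R) := inferInstanceAs (Module ℂ (H ⊗[ℂ] InvEnvelope R))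

/-- The element `φ ⊗ w` of `vh_P`. -/
def vhMk (φ : H) (w : InvEnvelope R) : VH S R := φ ⊗ₜ[ℂ] w

instance : Mul (VH S R) := ⟨fun x y => vhMul S R (x ⊗ₜ[ℂ] y)⟩

instance : One (VH S R) := ⟨vhMk S R 1 1⟩

theorem envParity_pow_mul (m : ℕ) (x y : InvEnvelope R) :
    ((envParity R).toLinearMap ^ m) (x * y) =
      ((envParity R).toLinearMap ^ m) x * ((envParity R).toLinearMap ^ m) y := by
  induction m with
  | zero => rfl
  | succ m ih => rw [pow_succ']; simp [ih]

theorem envParity_pow_one (m : ℕ) :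
    ((envParity R).toLinearMap ^ m) (1 : InvEnvelope R) = 1 := by
  induction m with
  | zero => rfl
  | succ m ih => rw [pow_succ']; simp [ih]

theorem envParity_pow_act (m : ℕ) (x : InvEnvelope R) (a : A) :
    ((envParity R).toLinearMap ^ m) (envAct R x a) =
      envAct R (((envParity R).toLinearMap ^ m) x) a := by
  induction m with
  | zero => rfl
  | succ m ih => rw [pow_succ']; simp [ih, envParity_act]

theorem F_mul_mem {m n : ℕ} {φ ψ : H} (hφ : φ ∈ 𝓗 m) (hψ : ψ ∈ 𝓗 n) : φ * ψ ∈ 𝓗 (n + m) := by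
  rw [add_comm]; exact SetLike.GradedMul.mul_mem hφ hψ

variable (𝓗) in
theorem vh_induction {C : H ⊗[ℂ] InvEnvelope R → Prop} (x : H ⊗[ℂ] InvEnvelope R) (h0 : C 0)
    (hadd : ∀ x y, C x → C y → C (x + y))
    (ht : ∀ (m : ℕ) (φ : H), φ ∈ 𝓗 m → ∀ w, C (φ ⊗ₜ w)) : C x := by
  classical
  induction x with
  | zero => exact h0
  | add x y hx hy => exact hadd x y hx hy
  | tmul φ w =>
    induction φ using DirectSum.Decomposition.inductionOn 𝓗 with
    | zero => simpa using h0
    | homogeneous φ => exact ht _ φ φ.2 w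
    | add x y hx hy => rw [TensorProduct.add_tmul]; exact hadd _ _ hx hy

theorem vhMul_assoc (x y z : H ⊗[ℂ] InvEnvelope R) :
    vhMul S R (vhMul S R (x ⊗ₜ y) ⊗ₜ z) = vhMul S R (x ⊗ₜ vhMul S R (y ⊗ₜ z)) := by
  induction x with
  | zero => simp
  | add u v hu hv => simp only [TensorProduct.add_tmul, map_add, hu, hv]
  | tmul ψ η =>
  induction y using vh_induction 𝓗 R with
  | h0 => simp
  | hadd u v hu hv => simp only [TensorProduct.add_tmul, TensorProduct.tmul_add, map_add, hu, hv]
  | ht m φ hφ θ =>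
  induction z using vh_induction 𝓗 R with
  | h0 => simp
  | hadd u v hu hv => simp only [TensorProduct.tmul_add, map_add, hu, hv]
  | ht n φ' hφ' θ' =>
  rw [vhMul_tmul S R ψ η hφ, vhMul_tmul S R φ θ hφ']
  set p : ℕ → InvEnvelope R →ₗ[ℂ] InvEnvelope R := fun m => (envParity R).toLinearMap ^ m with hp
  let Θ : H ⊗[ℂ] A → (H ⊗[ℂ] A) ⊗[ℂ] A →ₗ[ℂ] H ⊗[ℂ] InvEnvelope R := fun t =>
    TensorProduct.lift (LinearMap.compl₁₂
      ((LinearMap.mk₂ ℂ (fun (u : H ⊗[ℂ] InvEnvelope R) (w : InvEnvelope R) =>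
        (LinearMap.mulRight ℂ (w * θ')).lTensor H u)
        (fun u v w => by simp) (fun c u w => by simp)
        (fun u w w' => by
          rw [add_mul, ← LinearMap.add_apply, ← LinearMap.lTensor_add]
          congr 2
          ext; simp [mul_add, mul_assoc])
        (fun c u w => by
          rw [smul_mul_assoc, ← LinearMap.smul_apply, ← LinearMap.lTensor_smul]
          congr 2
          ext; simp [mul_assoc])))
      (TensorProduct.map (LinearMap.mulLeft ℂ ψ) (envAct R (p (n + m) η)) ∘ₗ
        LinearMap.mulLeft ℂ t)
      (envAct R (p n θ)))
  have hΘ : ∀ t s c, Θ t (s ⊗ₜ c) = (LinearMap.mulRight ℂ (envAct R (p n θ) c * θ')).lTensor H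
      (TensorProduct.map (LinearMap.mulLeft ℂ ψ) (envAct R (p (n + m) η)) (t * s)) :=
    fun t s c => rfl
  have rhs : ∀ s : 𝓗 n ⊗[ℂ] A, vhMul S R ((ψ ⊗ₜ η) ⊗ₜ TensorProduct.map (LinearMap.mulLeft ℂ φ)
      (LinearMap.mulRight ℂ θ' ∘ₗ envAct R (p n θ)) ((𝓗 n).subtype.rTensor A s)) =
      Θ (S.F φ) (S.F.toLinearMap.rTensor A ((𝓗 n).subtype.rTensor A s)) := by
    intro s
    induction s with
    | zero => simp
    | add u v hu hv => simp only [map_add, TensorProduct.tmul_add, hu, hv]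
    | tmul u c =>
      simp only [LinearMap.rTensor_tmul, TensorProduct.map_tmul, LinearMap.comp_apply, hΘ,
        Submodule.subtype_apply, LinearMap.mulLeft_apply, LinearMap.mulRight_apply,
        AlgHom.toLinearMap_apply]
      rw [vhMul_tmul S R ψ η (F_mul_mem hφ u.2), map_mul]
      generalize S.F φ * S.F (u : H) = z
      induction z with
      | zero => simp
      | add u v hu hv => simp only [map_add, hu, hv]
      | tmul x y => simp [hp, mul_assoc]
  have lhs : ∀ t : H ⊗[ℂ] A, vhMul S R (TensorProduct.map (LinearMap.mulLeft ℂ ψ)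
      (LinearMap.mulRight ℂ θ ∘ₗ envAct R (p m η)) t ⊗ₜ (φ' ⊗ₜ θ')) =
      Θ t ((TensorProduct.assoc ℂ H A A).symm
        ((comul (R := ℂ) (A := A)).lTensor H (S.F φ'))) := by
    intro t
    induction t with
    | zero =>
      have : Θ 0 = 0 := by
        apply TensorProduct.ext'
        intro s c
        rw [hΘ]; simp
      simp [this]
    | add u v hu hv =>
      have : Θ (u + v) = Θ u + Θ v := by
        apply TensorProduct.ext'
        intro s c
        simp only [LinearMap.add_apply, hΘ, add_mul, map_add]
      simp only [map_add, TensorProduct.add_tmul, hu, hv, this, LinearMap.add_apply]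
    | tmul χ c =>
      simp only [TensorProduct.map_tmul, LinearMap.comp_apply, LinearMap.mulLeft_apply,
        LinearMap.mulRight_apply]
      rw [vhMul_tmul S R _ _ hφ']
      generalize S.F φ' = s
      induction s with
      | zero => simp
      | add u v hu hv => simp only [map_add, hu, hv]
      | tmul χ' c' =>
        simp only [TensorProduct.map_tmul, LinearMap.comp_apply, LinearMap.mulLeft_apply,
          LinearMap.mulRight_apply, LinearMap.lTensor_tmul, envParity_pow_mul, envAct_mul,
          envParity_pow_act]
        generalize comul (R := ℂ) c' = d
        induction d with
        | zero => simp
        | add u v hu hv =>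
          simp only [map_add, hu, hv, TensorProduct.tmul_add, add_mul]
        | tmul d d' =>
          rw [TensorProduct.assoc_symm_tmul, hΘ]
          simp only [Algebra.TensorProduct.tmul_mul_tmul, TensorProduct.map_tmul,
            LinearMap.lTensor_tmul, LinearMap.mulLeft_apply, LinearMap.mulRight_apply,
            LinearMap.mul'_apply, envAct_apply_mul, hp, mul_assoc, pow_add,
            Module.End.mul_apply]
  obtain ⟨s, hs⟩ := S.F_mem n φ' hφ'
  rw [lhs, S.coassoc, LinearEquiv.symm_apply_apply, ← hs, rhs]

theorem vhMul_one (x : H ⊗[ℂ] InvEnvelope R) : vhMul S R (x ⊗ₜ (1 ⊗ₜ 1)) = x := by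
  induction x with
  | zero => simp
  | add u v hu hv => simp only [TensorProduct.add_tmul, map_add, hu, hv]
  | tmul ψ η =>
    rw [vhMul_tmul S R ψ η (HorizontalForms.one_mem_zero (𝓗 := 𝓗)), map_one,
      Algebra.TensorProduct.one_def]
    simp [envAct_apply_one]

theorem one_vhMul (x : H ⊗[ℂ] InvEnvelope R) : vhMul S R ((1 ⊗ₜ 1) ⊗ₜ x) = x := by
  induction x using vh_induction 𝓗 R with
  | h0 => simp
  | hadd u v hu hv => simp only [TensorProduct.tmul_add, map_add, hu, hv]
  | ht n φ hφ θ =>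
    rw [vhMul_tmul S R 1 1 hφ, envParity_pow_one]
    have : ∀ t : H ⊗[ℂ] A, TensorProduct.map (LinearMap.mulLeft ℂ (1 : H))
        (LinearMap.mulRight ℂ θ ∘ₗ envAct R 1) t =
        (LinearMap.toSpanSingleton ℂ (InvEnvelope R) θ).lTensor H
          ((counit (R := ℂ) (A := A)).lTensor H t) := by
      intro t
      induction t with
      | zero => simp
      | add u v hu hv => simp only [map_add, hu, hv]
      | tmul u v => simp [envAct_one, Algebra.algebraMap_eq_smul_one]
    rw [this, S.counit_F]
    simp

instance : Ring (VH S R) :=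
  { (inferInstance : AddCommGroup (VH S R)), (inferInstance : Mul (VH S R)),
    (inferInstance : One (VH S R)) with
    left_distrib := fun x y z =>
      (congrArg (vhMul S R) (TensorProduct.tmul_add x y z)).trans (map_add (vhMul S R) _ _)
    right_distrib := fun x y z =>
      (congrArg (vhMul S R) (TensorProduct.add_tmul x y z)).trans (map_add (vhMul S R) _ _)
    zero_mul := fun x =>
      (congrArg (vhMul S R) (TensorProduct.zero_tmul _ x)).trans (map_zero (vhMul S R))
    mul_zero := fun x =>
      (congrArg (vhMul S R) (TensorProduct.tmul_zero _ x)).trans (map_zero (vhMul S R))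
    mul_assoc := vhMul_assoc S R
    one_mul := one_vhMul S R
    mul_one := vhMul_one S R }

theorem vhMul_smul (r : ℂ) (x y : H ⊗[ℂ] InvEnvelope R) :
    vhMul S R ((r • x) ⊗ₜ y) = r • vhMul S R (x ⊗ₜ y) ∧
      vhMul S R (x ⊗ₜ (r • y)) = r • vhMul S R (x ⊗ₜ y) := by
  simp [← TensorProduct.smul_tmul']

instance : Algebra ℂ (VH S R) :=
  Algebra.ofModule (fun r x y => (vhMul_smul S R r x y).1) (fun r x y => (vhMul_smul S R r x y).2)

/-- The identification of the underlying vector space of `vh_P` with the tensor product. -/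
def vhOfTensor : H ⊗[ℂ] InvEnvelope R →ₗ[ℂ] VH S R := LinearMap.id

theorem envParity_pow_of_mem {n : ℕ} {η : InvEnvelope R} (hη : η ∈ envDeg R n) (m : ℕ) :
    ((envParity R).toLinearMap ^ m) η = (-1 : ℂ) ^ (n * m) • η := by
  induction m with
  | zero => simp
  | succ m ih =>
    rw [pow_succ', Module.End.mul_apply, ih, map_smul, AlgHom.toLinearMap_apply,
      envParity_of_mem R hη, smul_smul, ← pow_add, mul_add, mul_one]

/-- In `vh_P`: `(ψ ⊗ η)(φ ⊗ ϑ) = (-1)^{∂η ∂φ} ∑ ψ φ_k ⊗ (η ∘ c_k) ϑ`. -/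
theorem vhMk_mul_vhMk {m n : ℕ} (ψ : H) {η : InvEnvelope R} (hη : η ∈ envDeg R n) {φ : H}
    (hφ : φ ∈ 𝓗 m) (θ : InvEnvelope R) :
    vhMk S R ψ η * vhMk S R φ θ = (-1 : ℂ) ^ (n * m) •
      vhOfTensor S R (TensorProduct.map (LinearMap.mulLeft ℂ ψ)
        (LinearMap.mulRight ℂ θ ∘ₗ envAct R η) (S.F φ)) := by
  have h : vhMul S R ((ψ ⊗ₜ η) ⊗ₜ (φ ⊗ₜ θ)) = (-1 : ℂ) ^ (n * m) • TensorProduct.map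
      (LinearMap.mulLeft ℂ ψ) (LinearMap.mulRight ℂ θ ∘ₗ envAct R η) (S.F φ) := by
    rw [vhMul_tmul S R ψ η hφ, envParity_pow_of_mem R hη, map_smul, LinearMap.comp_smul,
      TensorProduct.map_smul_right, LinearMap.smul_apply]
  exact h

/-- The grading of `vh_P`: the sum of the degrees in both factors. -/
def vhDeg (n : ℕ) : Submodule ℂ (VH S R) :=
  ⨆ (p : ℕ × ℕ) (_ : p.1 + p.2 = n), Submodule.span ℂ
    {x | ∃ φ ∈ 𝓗 p.1, ∃ w ∈ envDeg R p.2, x = vhMk S R φ w}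

/-- The involution `(φ ⊗ w)^* = ∑ φ_k^* ⊗ (w^* ∘ c_k^*)` of `vh_P`, where
`F(φ) = ∑ φ_k ⊗ c_k`. -/
def vhStar [HopfStar A] : VH S R →ₛₗ[starRingEnd ℂ] VH S R :=
  TensorProduct.lift (LinearMap.mk₂'ₛₗ (starRingEnd ℂ) (starRingEnd ℂ)
    (fun (φ : H) (w : InvEnvelope R) =>
      vhOfTensor S R ((envAct R (envStar R w)).lTensor H (star (S.F φ))))
    (fun φ φ' w => by
      simp only [map_add, star_add])
    (fun c φ w => by
      simp only [map_smul, star_smul]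
      rfl)
    (fun φ w w' => by
      simp only [map_add, LinearMap.lTensor_add, LinearMap.add_apply])
    (fun c φ w => by
      simp only [map_smulₛₗ, LinearMap.lTensor_smul, LinearMap.smul_apply]
      rfl))

end VerticalHorizontal

/-- `d` and the involution `σ` make the algebra `X`, with the grading `𝒢`, a graded-differential
*-algebra. -/
structure IsDifferentialStarAlgebra {X : Type*} [Ring X] [Algebra ℂ X]
    (𝒢 : ℕ → Submodule ℂ X) (σ : X →ₛₗ[starRingEnd ℂ] X) (d : X →ₗ[ℂ] X) : Prop where
  one_mem : (1 : X) ∈ 𝒢 0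
  mul_mem : ∀ m n, ∀ x ∈ 𝒢 m, ∀ y ∈ 𝒢 n, x * y ∈ 𝒢 (m + n)
  star_mem : ∀ n, ∀ x ∈ 𝒢 n, σ x ∈ 𝒢 n
  star_star : ∀ x, σ (σ x) = x
  star_mul : ∀ m n, ∀ x ∈ 𝒢 m, ∀ y ∈ 𝒢 n, σ (x * y) = (-1 : ℂ) ^ (m * n) • (σ y * σ x)
  d_mem : ∀ n, ∀ x ∈ 𝒢 n, d x ∈ 𝒢 (n + 1)
  d_mul : ∀ n, ∀ x ∈ 𝒢 n, ∀ y, d (x * y) = d x * y + (-1 : ℂ) ^ n • (x * d y)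
  d_d : ∀ x, d (d x) = 0
  d_star : ∀ x, d (σ x) = σ (d x)

namespace HorizontalForms

variable {A : Type*} [Ring A] [HopfAlgebra ℂ A] [StarRing A] [StarModule ℂ A] [HopfStar A]
variable {H : Type*} [Ring H] [Algebra ℂ H] [StarAddMonoid H] [StarModule ℂ H]
variable {𝓗 : ℕ → Submodule ℂ H} [GradedAlgebra 𝓗]
variable (S : HorizontalForms A 𝓗)

/-- The algebra `vh_P = hor_P ⊗ Ψ_inv^∧` for the calculus determined by `R̂`. -/
abbrev Vh : Type _ := VH S S.idealHat

/-- The inclusion `hor_P → vh_P`. -/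
def ofHor (φ : H) : S.Vh := vhMk S S.idealHat φ 1

/-- The inclusion `Ψ_inv → vh_P`. -/
def ofInv (θ : InvForms S.idealHat) : S.Vh := vhMk S S.idealHat 1 (incl S.idealHat θ)

/-- The grading of `vh_P`. -/
abbrev deg (n : ℕ) : Submodule ℂ S.Vh := vhDeg S S.idealHat n

/-- The involution of `vh_P`. -/
abbrev conj : S.Vh →ₛₗ[starRingEnd ℂ] S.Vh := vhStar S S.idealHat

/-- `δ` is the differential `∂_D`: it satisfies the graded Leibniz rule and, with
`F(φ) = ∑ φ_k ⊗ c_k`,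
`∂_D(φ) = D(φ) + (-1)^{∂φ} ∑ φ_k π(c_k)` on `hor_P` and `∂_D(ϑ) = ϱ_D(ϑ) + d(ϑ)` on `Ψ_inv`. -/
structure IsVhDifferential (D : S.preconnections) (δ : S.Vh →ₗ[ℂ] S.Vh) : Prop where
  leibniz : ∀ n, ∀ x ∈ S.deg n, ∀ y, δ (x * y) = δ x * y + (-1 : ℂ) ^ n • (x * δ y)
  apply_hor : ∀ n, ∀ φ ∈ 𝓗 n, δ (S.ofHor φ) = S.ofHor (D.1 φ) +
    (-1 : ℂ) ^ n • vhOfTensor S S.idealHat ((envProj S.idealHat).lTensor H (S.F φ))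
  apply_inv : ∀ θ, δ (S.ofInv θ) =
    S.ofHor (S.curvature D θ) + vhMk S S.idealHat 1 (dInv S.idealHat θ)

/-- The homomorphism `g` is the identity on `hor_P` and it is `ϑ ↦ ϑ - χ_E(ϑ)` on `Ψ_inv`. -/
structure IsTwist (E : S.differences) (g : S.Vh →ₐ[ℂ] S.Vh) : Prop where
  apply_hor : ∀ φ, g (S.ofHor φ) = S.ofHor φ
  apply_inv : ∀ θ, g (S.ofInv θ) = S.ofInv θ - S.ofHor (S.chi E θ)

/-- The algebra `Ω_P` glued from the copies of `vh_P` labelled by the preconnections, with the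
help of the maps `h E`: the families `(x_D)` with `x_{D+E} = h_E(x_D)`. -/
def glued (h : S.differences → (S.Vh →ₐ[ℂ] S.Vh)) : Subalgebra ℂ (S.preconnections → S.Vh) where
  carrier := {x | ∀ (E : S.differences) (D : S.preconnections), x (E +ᵥ D) = h E (x D)}
  mul_mem' := fun hx hy E D => by simp [hx E D, hy E D]
  add_mem' := fun hx hy E D => by simp [hx E D, hy E D]
  algebraMap_mem' := fun r E D => by simp

end HorizontalForms

end
end QuantumBundle

open scoped TensorProduct
open Coalgebra HopfAlgebra

namespace QuantumBundle

set_option linter.unusedSectionVars false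

/-! Write F(φ) = Σ φ_k ⊗ c_k, let * between maps on A be the convolution product, and let V(φ) = Σ
φ_k π(c_k). Two tools carry everything: freeness and the Haar integral.

The Haar integral is needed for the existence of χ♮_E and ϱ♮_D. Up to signs, E and D² are linear
over the invariant forms: E vanishes on them by definition, D² because d_M² = 0. In the identity φ ⊗
1 = Σ F(φ_k)(1 ⊗ κ(c_k)), freeness replaces 1 ⊗ κ(c_k) by sums of F(r)(b ⊗ 1) with r, b in the
bundle. Integrating the second factor writes φ as a sum of terms w b with w invariant and b in the
bundle. Applying the operator, and using coassociativity, gives the form Σ φ_k χ(c_k)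
(`exists_contr_eq`). The integral itself is obtained algebraically in `exists_haar`, from
orthogonality inside finite-dimensional unitary corepresentations.

Freeness also shows that a linear map g on A is determined by the contractions b ↦ Σ b_k g(c_k) with
b in the bundle (`eq_of_contr_eq`). Identities between maps on A are therefore read off from
identities between operators. The Leibniz rule gives the exchange rules `chi_mul` and
`curvature_mul`; D D² = D² D gives the Bianchi identity Dϱ = 0; expanding (D+E)² gives ϱ_{D+E} = ϱ_D
+ Dχ + Eχ - χ*χ; covariance gives χ*π + π*χ = V∘χ and ϱ*π - π*ϱ = V∘ϱ.

The algebra vh_P is generated by hor_P and Ψ_inv, subject to the quadratic relations of Ψ_inv^∧ and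
one exchange relation. Homomorphisms out of it are thus prescribed on generators (`vhLift`). So are
graded derivations, once they are encoded as homomorphisms into upper triangular 2 × 2 matrices
(`exists_vhDerivation`). For ∂_D the obstruction coming from the quadratic relations is V∘ϱ♮_D,
which vanishes on R̂. For h_E it is -V∘χ + χ*χ. Here χ vanishes on R̂, and so does χ*χ, by the
curvature formula, since the curvatures of both D and D+E vanish there. This is why R̂ involves all
preconnections at once.

The other claims are compared on generators. The Bianchi identity and the formula for ϱ*π - π*ϱ give
∂_D² = 0, and the curvature formula gives h_E ∂_D = ∂_{D+E} h_E. The gluing works because the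
preconnections form a torsor under the differences E, while E ↦ h_E is an action of that additive
group. -/

noncomputable section


/-! ### Unitary corepresentations and invariant functionals on their coefficients. -/

section Haar

variable {A : Type*} [Ring A] [HopfAlgebra ℂ A] [StarRing A] [StarModule ℂ A]

/-- A matrix corepresentation whose entrywise adjoint is unitary. -/
structure IsCoUnitary {I : Type} [Fintype I] [DecidableEq I] (z : Matrix I I A) : Prop where
  comul_eq : ∀ i j, comul (R := ℂ) (z i j) = ∑ k, z i k ⊗ₜ[ℂ] z k j
  mul_star : ∀ p q, ∑ r, z r p * star (z r q) = (1 : Matrix I I A) p q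
  star_mul : ∀ p q, ∑ r, star (z p r) * z q r = (1 : Matrix I I A) p q

/-- The span of the entries of a matrix. -/
def coeffs {I : Type} (z : Matrix I I A) : Submodule ℂ A :=
  Submodule.span ℂ (Set.range fun p : I × I => z p.1 p.2)

theorem mem_coeffs {I : Type} (z : Matrix I I A) (i j : I) : z i j ∈ coeffs z :=
  Submodule.subset_span ⟨(i, j), rfl⟩

/-- The elements on which the functional `h` is left-invariant. -/
def leftInvariant (h : A →ₗ[ℂ] ℂ) : Submodule ℂ A :=
  LinearMap.ker ((TensorProduct.rid ℂ A).toLinearMap ∘ₗ h.lTensor A ∘ₗ comul -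
    (LinearMap.toSpanSingleton ℂ A 1) ∘ₗ h)

theorem mem_leftInvariant {h : A →ₗ[ℂ] ℂ} {a : A} : a ∈ leftInvariant h ↔
    TensorProduct.rid ℂ A (h.lTensor A (comul a)) = h a • (1 : A) := by
  simp [leftInvariant, sub_eq_zero]

theorem IsCoUnitary.one : IsCoUnitary (1 : Matrix (Fin 1) (Fin 1) A) where
  comul_eq i j := by
    obtain rfl := Subsingleton.elim i 0
    obtain rfl := Subsingleton.elim j 0
    simp [Algebra.TensorProduct.one_def]
  mul_star p q := by
    obtain rfl := Subsingleton.elim p 0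
    obtain rfl := Subsingleton.elim q 0
    simp
  star_mul p q := by
    obtain rfl := Subsingleton.elim p 0
    obtain rfl := Subsingleton.elim q 0
    simp

variable {I J : Type} [Fintype I] [DecidableEq I] [Fintype J] [DecidableEq J]

theorem IsCoUnitary.fromBlocks {z : Matrix I I A} {y : Matrix J J A} (hz : IsCoUnitary z)
    (hy : IsCoUnitary y) : IsCoUnitary (Matrix.fromBlocks z 0 0 y) where
  comul_eq i j := by
    rcases i with i | i <;> rcases j with j | j <;> simp [hz.comul_eq, hy.comul_eq]
  mul_star p q := by
    rcases p with p | p <;> rcases q with q | q <;>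
      simp [hz.mul_star, hy.mul_star, Matrix.one_apply]
  star_mul p q := by
    rcases p with p | p <;> rcases q with q | q <;>
      simp [hz.star_mul, hy.star_mul, Matrix.one_apply]

theorem coeffs_le_fromBlocks (z : Matrix I I A) (y : Matrix J J A) :
    coeffs z ≤ coeffs (Matrix.fromBlocks z 0 0 y) ∧
      coeffs y ≤ coeffs (Matrix.fromBlocks z 0 0 y) := by
  constructor <;> rw [coeffs, Submodule.span_le]
  · rintro _ ⟨p, rfl⟩
    exact mem_coeffs (Matrix.fromBlocks z 0 0 y) (Sum.inl p.1) (Sum.inl p.2)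
  · rintro _ ⟨p, rfl⟩
    exact mem_coeffs (Matrix.fromBlocks z 0 0 y) (Sum.inr p.1) (Sum.inr p.2)

/-- The tensor product of two matrix corepresentations. -/
def tensorMatrix (z : Matrix I I A) (y : Matrix J J A) : Matrix (I × J) (I × J) A :=
  Matrix.of fun p q => z p.1 q.1 * y p.2 q.2

theorem IsCoUnitary.tensorMatrix {z : Matrix I I A} {y : Matrix J J A} (hz : IsCoUnitary z)
    (hy : IsCoUnitary y) : IsCoUnitary (tensorMatrix z y) where
  comul_eq i j := by
    simp [QuantumBundle.tensorMatrix, hz.comul_eq, hy.comul_eq, Finset.sum_mul_sum,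
      Fintype.sum_prod_type]
  mul_star p q := by
    have : ∀ r : I × J, z r.1 p.1 * y r.2 p.2 * star (z r.1 q.1 * y r.2 q.2) =
        z r.1 p.1 * (y r.2 p.2 * star (y r.2 q.2)) * star (z r.1 q.1) := fun r => by
      simp [mul_assoc]
    simp only [QuantumBundle.tensorMatrix, Matrix.of_apply, this, Fintype.sum_prod_type,
      ← Finset.mul_sum, ← Finset.sum_mul, hy.mul_star]
    by_cases h : p.2 = q.2
    · simp [h, hz.mul_star, Matrix.one_apply, Prod.ext_iff]
    · simp [h, Prod.ext_iff]
  star_mul p q := by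
    have : ∀ r : I × J, star (z p.1 r.1 * y p.2 r.2) * (z q.1 r.1 * y q.2 r.2) =
        star (y p.2 r.2) * (star (z p.1 r.1) * z q.1 r.1) * y q.2 r.2 := fun r => by
      simp [mul_assoc]
    simp only [QuantumBundle.tensorMatrix, Matrix.of_apply, this]
    rw [Fintype.sum_prod_type_right]
    simp only [← Finset.mul_sum, ← Finset.sum_mul, hz.star_mul]
    by_cases h : p.1 = q.1
    · simp [h, hy.star_mul, Matrix.one_apply, Prod.ext_iff]
    · simp [h, Prod.ext_iff]

theorem mul_mem_coeffs {z : Matrix I I A} {y : Matrix J J A} {a b : A} (ha : a ∈ coeffs z)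
    (hb : b ∈ coeffs y) : a * b ∈ coeffs (tensorMatrix z y) := by
  have : coeffs z * coeffs y ≤ coeffs (tensorMatrix z y) := by
    rw [coeffs, coeffs, Submodule.span_mul_span, Submodule.span_le]
    rintro _ ⟨_, ⟨p, rfl⟩, _, ⟨q, rfl⟩, rfl⟩
    exact mem_coeffs (tensorMatrix z y) (p.1, q.1) (p.2, q.2)
  exact this (Submodule.mul_mem_mul ha hb)

/-- The counit axiom says that the scalar matrix ε(z) satisfies ε(z) z = z; cancelling the
invertible matrix z leaves the identity. -/
theorem IsCoUnitary.counit_eq {z : Matrix I I A} (hz : IsCoUnitary z) (p q : I) :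
    algebraMap ℂ A (counit (R := ℂ) (z p q)) = (1 : Matrix I I A) q p := by
  have h1 : ∀ s, ∑ k, counit (R := ℂ) (z p k) • z k s = z p s := by
    intro s
    have := congr(TensorProduct.lid ℂ A $(rTensor_counit_comul (R := ℂ) (z p s)))
    rw [hz.comul_eq] at this
    simpa using this
  rw [← hz.star_mul q p, Finset.sum_congr rfl fun r _ => by rw [← h1 r]]
  simp only [Finset.mul_sum]
  rw [Finset.sum_comm]
  simp only [mul_smul_comm, ← Finset.smul_sum, hz.star_mul]
  simp [Matrix.one_apply, Algebra.algebraMap_eq_smul_one]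

variable [HopfStar A]

/-- The antipode axiom makes (κ(z_pk^*)) a left inverse of the matrix (z_ks^*), and by `star_mul`
the transpose of z is a right inverse of it. -/
theorem IsCoUnitary.antipode_star {z : Matrix I I A} (hz : IsCoUnitary z) (p r : I) :
    antipode ℂ (star (z p r)) = z r p := by
  have h1 : ∀ s, ∑ k, antipode ℂ (star (z p k)) * star (z k s) = (1 : Matrix I I A) p s := by
    intro s
    have := HopfAlgebra.mul_antipode_rTensor_comul_apply (R := ℂ) (star (z p s))
    rw [HopfStar.comul_star, hz.comul_eq, HopfStar.counit_star] at this
    simp only [star_sum, TensorProduct.star_tmul, map_sum, LinearMap.rTensor_tmul,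
      LinearMap.mul'_apply] at this
    rw [this]
    have h2 := congr(star $(hz.counit_eq p s))
    rw [← algebraMap_star_comm] at h2
    rw [h2]
    simp only [Matrix.one_apply, eq_comm (a := s)]
    split <;> simp
  have h2 : ∑ s, (∑ k, antipode ℂ (star (z p k)) * star (z k s)) * z r s =
      antipode ℂ (star (z p r)) := by
    simp only [Finset.sum_mul, mul_assoc]
    refine Finset.sum_comm.trans ?_
    refine (Finset.sum_congr rfl fun k _ => (Finset.mul_sum _ _ _).symm).trans ?_
    simp only [hz.star_mul]
    simp [Matrix.one_apply]
  rw [← h2]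
  simp [h1, Matrix.one_apply]

/-- The linear map `x ↦ ∑ x_pq z_pq`. -/
def coeffMap (z : Matrix I I A) : EuclideanSpace ℂ (I × I) →ₗ[ℂ] A where
  toFun x := ∑ p, ∑ q, x (p, q) • z p q
  map_add' x y := by simp [add_smul, Finset.sum_add_distrib]
  map_smul' c x := by simp [mul_smul, Finset.smul_sum]

theorem coeffMap_apply (z : Matrix I I A) (x : EuclideanSpace ℂ (I × I)) :
    coeffMap z x = ∑ p, ∑ q, x (p, q) • z p q := rfl

theorem coeffMap_single (z : Matrix I I A) (p q : I) :
    coeffMap z (EuclideanSpace.single (p, q) 1) = z p q := by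
  rw [coeffMap_apply, ← Fintype.sum_prod_type' (f := fun a b =>
    (EuclideanSpace.single (p, q) (1 : ℂ) : EuclideanSpace ℂ (I × I)) (a, b) • z a b)]
  rw [Finset.sum_eq_single (p, q)]
  · simp
  · intro b _ hb
    simp [hb]
  · simp

/-- The matrix `x` multiplied by `(f (z_ps))ᵀ`. -/
def coeffTwist (z : Matrix I I A) (f : A →ₗ[ℂ] ℂ) (x : EuclideanSpace ℂ (I × I)) :
    EuclideanSpace ℂ (I × I) :=
  WithLp.toLp 2 fun p => ∑ s, x (s, p.2) * f (z s p.1)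

theorem coeffTwist_apply (z : Matrix I I A) (f : A →ₗ[ℂ] ℂ) (x : EuclideanSpace ℂ (I × I))
    (r q : I) : coeffTwist z f x (r, q) = ∑ s, x (s, q) * f (z s r) := rfl

/-- Twisting coordinates lifts the operator (f ⊗ id)φ from A. Hence twists preserve the kernel of
`coeffMap`, the space of linear relations among the entries of z. -/
theorem IsCoUnitary.coeffMap_coeffTwist {z : Matrix I I A} (hz : IsCoUnitary z) (f : A →ₗ[ℂ] ℂ)
    (x : EuclideanSpace ℂ (I × I)) : coeffMap z (coeffTwist z f x) =
      TensorProduct.lid ℂ A (f.rTensor A (comul (coeffMap z x))) := by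
  simp only [coeffMap_apply, coeffTwist_apply, map_sum, map_smul, hz.comul_eq,
    LinearMap.rTensor_tmul, TensorProduct.lid_tmul, Finset.smul_sum, Finset.sum_smul, mul_smul]
  rw [Finset.sum_comm]
  conv_rhs => rw [Finset.sum_comm]
  refine Finset.sum_congr rfl fun q _ => Finset.sum_comm

theorem euclidean_inner (x y : EuclideanSpace ℂ (I × I)) :
    inner ℂ x y = ∑ p, ∑ q, y (p, q) * star (x (p, q)) := by
  rw [EuclideanSpace.inner_eq_star_dotProduct, dotProduct, Fintype.sum_prod_type]
  rfl

/-- By unitarity the adjoint of a twist is again a twist, by the functional a ↦ conj f(κ(a^*)).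
Since twists preserve the kernel, they preserve its orthogonal complement. -/
theorem IsCoUnitary.coeffTwist_orthogonal {z : Matrix I I A} (hz : IsCoUnitary z)
    {w : EuclideanSpace ℂ (I × I)} (hw : w ∈ (LinearMap.ker (coeffMap z))ᗮ) (f : A →ₗ[ℂ] ℂ) :
    coeffTwist z f w ∈ (LinearMap.ker (coeffMap z))ᗮ := by
  intro x hx
  have key : ∑ r, ∑ q, ∑ p, (star (x (r, q)) * w (p, q)) • z p r = 0 := by
    rw [← star_eq_zero, ← Module.forall_dual_apply_eq_zero_iff ℂ]
    intro g
    -- The two stars around the antipode keep the functional complex linear, and `antipode_star`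
    -- evaluates it on z_pr as g(z_rp^*), the quantity in the starred sum.
    let g' : A →ₗ[ℂ] ℂ := g ∘ₗ
      { toFun := fun a => star (antipode ℂ (star a))
        map_add' := by simp
        map_smul' := by simp }
    have hg' : ∀ p r, g' (z p r) = g (star (z r p)) := by
      intro p r
      simp [g', hz.antipode_star]
    have h2 : coeffTwist z g' x ∈ LinearMap.ker (coeffMap z) := by
      rw [LinearMap.mem_ker, hz.coeffMap_coeffTwist, LinearMap.mem_ker.1 hx]; simp
    have h3 := Submodule.inner_left_of_mem_orthogonal h2 hw
    rw [euclidean_inner] at h3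
    simp only [coeffTwist_apply, hg', Finset.sum_mul] at h3
    simp only [star_sum, star_smul, map_sum, map_smul, star_mul', star_star, smul_eq_mul]
    rw [← h3, Finset.sum_comm, Finset.sum_comm (f := fun p q => ∑ r, _ * _ * star (w (p, q)))]
    refine Finset.sum_congr rfl fun q _ => ?_
    rw [Finset.sum_comm]
    refine Finset.sum_congr rfl fun p _ => Finset.sum_congr rfl fun r _ => ?_
    ring
  rw [euclidean_inner, ← map_zero f, ← key]
  simp only [coeffTwist_apply, map_sum, map_smul, Finset.sum_mul, smul_eq_mul]
  refine Finset.sum_congr rfl fun q _ => Finset.sum_congr rfl fun p _ =>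
    Finset.sum_congr rfl fun r _ => ?_
  ring

theorem coeffs_le_range (z : Matrix I I A) : coeffs z ≤ LinearMap.range (coeffMap z) := by
  rw [coeffs, Submodule.span_le]
  rintro _ ⟨p, rfl⟩
  exact ⟨_, coeffMap_single z p.1 p.2⟩

/-- Among the coordinate vectors of 1, take the w orthogonal to all relations. Every twist
multiplies it by a scalar, and this makes the functional induced by ⟨w, ·⟩ left-invariant; its value
at 1 is ⟨w, w⟩, by which it is normalised. -/
theorem IsCoUnitary.exists_leftInvariant [Nontrivial A] {z : Matrix I I A} (hz : IsCoUnitary z)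
    (h1 : (1 : A) ∈ coeffs z) : ∃ h : A →ₗ[ℂ] ℂ, h 1 = 1 ∧ coeffs z ≤ leftInvariant h := by
  obtain ⟨w₀, hw₀⟩ := coeffs_le_range z h1
  obtain ⟨k, hk, w, hw, hkw⟩ :=
    (LinearMap.ker (coeffMap z)).exists_add_mem_mem_orthogonal w₀
  have hTw : coeffMap z w = 1 := by
    rw [← hw₀, hkw, map_add, LinearMap.mem_ker.1 hk, zero_add]
  have hw0 : w ≠ 0 := by rintro rfl; exact one_ne_zero (α := A) (by rw [← hTw, map_zero])
  -- Both sides have image f(1)1 under `coeffMap`, and both lie in the orthogonal complement of its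
  -- kernel, where it is injective.
  have htwist : ∀ f, coeffTwist z f w = f 1 • w := by
    intro f
    have e1 : coeffTwist z f w - f 1 • w ∈ LinearMap.ker (coeffMap z) := by
      rw [LinearMap.mem_ker, map_sub, hz.coeffMap_coeffTwist, map_smul, hTw]
      simp [Algebra.TensorProduct.one_def]
    have e2 : coeffTwist z f w - f 1 • w ∈ (LinearMap.ker (coeffMap z))ᗮ :=
      Submodule.sub_mem _ (hz.coeffTwist_orthogonal hw f) (Submodule.smul_mem _ _ hw)
    have e3 := Submodule.mem_inf.2 ⟨e1, e2⟩
    rw [Submodule.inf_orthogonal_eq_bot, Submodule.mem_bot] at e3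
    exact sub_eq_zero.1 e3
  have hzw : ∀ r q, ∑ s, w (s, q) • z s r = w (r, q) • (1 : A) := by
    intro r q
    rw [← sub_eq_zero, ← Module.forall_dual_apply_eq_zero_iff ℂ]
    intro f
    have := congr($(htwist f) (r, q))
    rw [coeffTwist_apply] at this
    simp [this, mul_comm]
  -- The relation `hzw` is moved to the other side of z by unitarity and then conjugated. This is
  -- the left invariance of the functional z_pq ↦ conj w(p,q).
  have hzw' : ∀ p q, ∑ r, star (w (r, q)) • z p r = star (w (p, q)) • (1 : A) := by
    intro p q
    rw [← star_inj]
    simp only [star_sum, star_smul, star_star, star_one]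
    have : ∀ r, w (r, q) • star (z p r) = ∑ s, w (s, q) • (star (z p r) * z s r) := by
      intro r
      rw [← mul_one (star (z p r)), ← mul_smul_comm, ← hzw, Finset.mul_sum]
      simp
    rw [Finset.sum_congr rfl fun r _ => this r, Finset.sum_comm]
    simp only [← Finset.smul_sum, hz.star_mul]
    simp [Matrix.one_apply]
  -- Orthogonality of w to the relations lets ⟨w, ·⟩ factor through `coeffMap`, hence come from a
  -- functional on A.
  have hker : LinearMap.ker (coeffMap z) ≤ LinearMap.ker (innerₛₗ ℂ w) := fun x hx => by
    simpa using Submodule.inner_left_of_mem_orthogonal hx hw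
  obtain ⟨h, hh⟩ : (innerₛₗ ℂ w : Module.Dual ℂ (EuclideanSpace ℂ (I × I))) ∈
      LinearMap.range (coeffMap z).dualMap := by
    rw [LinearMap.range_dualMap_eq_dualAnnihilator_ker, Submodule.mem_dualAnnihilator]
    exact hker
  have hh' : ∀ x, h (coeffMap z x) = inner ℂ w x := fun x => congr($hh x)
  have hww : (inner ℂ w w : ℂ) ≠ 0 := inner_self_ne_zero.2 hw0
  refine ⟨(inner ℂ w w : ℂ)⁻¹ • h, ?_, ?_⟩
  · rw [← hTw, LinearMap.smul_apply, hh', smul_eq_mul, inv_mul_cancel₀ hww]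
  · rw [coeffs, Submodule.span_le]
    rintro _ ⟨⟨p, q⟩, rfl⟩
    have hzh : ∀ p q, h (z p q) = star (w (p, q)) := by
      intro p q
      rw [← coeffMap_single z, hh', EuclideanSpace.inner_single_right]
      simp
    simp only [SetLike.mem_coe, mem_leftInvariant, hz.comul_eq, map_sum, LinearMap.lTensor_tmul,
      TensorProduct.rid_tmul, hzh, LinearMap.smul_apply, smul_assoc, ← Finset.smul_sum, hzw']

end Haar

/-! ### Existence of the Haar integral. -/

section HaarExistence

variable {A : Type*} [Ring A] [HopfAlgebra ℂ A] [StarRing A] [StarModule ℂ A]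

/-- Direct sums of corepresentations account for sums of elements and tensor products for products.
The induction runs over a^*, because co-unitary matrices are the entrywise adjoints of unitary ones.
-/
theorem exists_coUnitary_mem_coeffs [CompactMatrixQuantumGroup A] (a : A) :
    ∃ (I : Type) (_ : Fintype I) (_ : DecidableEq I) (z : Matrix I I A),
      IsCoUnitary z ∧ a ∈ coeffs z := by
  obtain ⟨n, u, hu1, hu2, hu3, hu4⟩ := CompactMatrixQuantumGroup.exists_unitary_generators (A := A)
  have hu : IsCoUnitary (Matrix.of fun i j => star (u i j)) := by
    refine ⟨fun i j => ?_, fun p q => ?_, fun p q => ?_⟩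
    · simp [HopfStar.comul_star, hu3]
    · rw [← hu1]
      simp [Matrix.mul_apply]
    · rw [← hu2]
      simp [Matrix.mul_apply]
  have ha : star a ∈ Algebra.adjoin ℂ (Set.range fun p : Fin n × Fin n => u p.1 p.2) := by
    rw [hu4]; trivial
  suffices ∀ b ∈ Algebra.adjoin ℂ (Set.range fun p : Fin n × Fin n => u p.1 p.2),
      ∃ (I : Type) (_ : Fintype I) (_ : DecidableEq I) (z : Matrix I I A),
        IsCoUnitary z ∧ star b ∈ coeffs z by simpa using this _ ha
  intro b hb
  induction hb using Algebra.adjoin_induction with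
  | mem x hx =>
    obtain ⟨p, rfl⟩ := hx
    exact ⟨_, _, _, _, hu, mem_coeffs (Matrix.of fun i j => star (u i j)) p.1 p.2⟩
  | algebraMap r =>
    refine ⟨_, _, _, _, IsCoUnitary.one, ?_⟩
    rw [Algebra.algebraMap_eq_smul_one, star_smul, star_one]
    exact Submodule.smul_mem _ _ (mem_coeffs (1 : Matrix (Fin 1) (Fin 1) A) 0 0)
  | add x y _ _ hx hy =>
    obtain ⟨I, _, _, z, hz, hxz⟩ := hx
    obtain ⟨J, _, _, y, hy, hyz⟩ := hy
    refine ⟨_, _, _, _, hz.fromBlocks hy, ?_⟩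
    rw [star_add]
    exact Submodule.add_mem _ ((coeffs_le_fromBlocks z y).1 hxz) ((coeffs_le_fromBlocks z y).2 hyz)
  | mul x y _ _ hx hy =>
    obtain ⟨I, _, _, z, hz, hxz⟩ := hx
    obtain ⟨J, _, _, y, hy, hyz⟩ := hy
    -- The star reverses products, so the tensor factors appear in the opposite order.
    refine ⟨_, _, _, _, hy.tensorMatrix hz, ?_⟩
    rw [star_mul]
    exact mul_mem_coeffs hyz hxz

/-- The existence of a normalised left-invariant functional (the Haar integral). -/
theorem exists_haar [CompactMatrixQuantumGroup A] [Nontrivial A] :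
    ∃ h : A →ₗ[ℂ] ℂ, h 1 = 1 ∧
      ∀ a, TensorProduct.rid ℂ A (h.lTensor A (comul a)) = h a • (1 : A) := by
  -- A functional vanishes on N exactly when it is left-invariant, as one sees by testing the
  -- invariance against all f. It remains to separate 1 from N.
  let N : Submodule ℂ A := Submodule.span ℂ {x | ∃ (f : A →ₗ[ℂ] ℂ) (a : A),
    x = TensorProduct.lid ℂ A (f.rTensor A (comul a)) - f 1 • a}
  -- An element of N involves finitely many a, all coefficients of a single z; invariance on these
  -- coefficients is enough to annihilate it.
  have hN : ∀ x ∈ N, ∃ (I : Type) (_ : Fintype I) (_ : DecidableEq I) (z : Matrix I I A),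
      IsCoUnitary z ∧ ∀ h : A →ₗ[ℂ] ℂ, coeffs z ≤ leftInvariant h → h x = 0 := by
    intro x hx
    induction hx using Submodule.span_induction with
    | mem x hx =>
      obtain ⟨f, a, rfl⟩ := hx
      obtain ⟨I, _, _, z, hz, haz⟩ := exists_coUnitary_mem_coeffs a
      refine ⟨I, _, _, z, hz, fun h hh => ?_⟩
      have h1 := congr(f $(mem_leftInvariant.1 (hh haz)))
      rw [map_sub, map_smul, sub_eq_zero, smul_eq_mul, mul_comm, ← smul_eq_mul, ← map_smul, ← h1]
      generalize comul (R := ℂ) a = t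
      induction t with
      | zero => simp
      | add u v hu hv => simp only [map_add, hu, hv]
      | tmul u v => simp [mul_comm]
    | zero => exact ⟨_, _, _, _, IsCoUnitary.one, by simp⟩
    | add x y _ _ hx hy =>
      obtain ⟨I, _, _, z, hz, hxz⟩ := hx
      obtain ⟨J, _, _, y, hy, hyz⟩ := hy
      refine ⟨_, _, _, _, hz.fromBlocks hy, fun h hh => ?_⟩
      rw [map_add, hxz h ((coeffs_le_fromBlocks z y).1.trans hh),
        hyz h ((coeffs_le_fromBlocks z y).2.trans hh), add_zero]
    | smul c x _ hx =>
      obtain ⟨I, _, _, z, hz, hxz⟩ := hx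
      exact ⟨_, _, _, z, hz, fun h hh => by rw [map_smul, hxz h hh, smul_zero]⟩
  -- Adding the trivial corepresentation as a block puts 1 among the coefficients, so a functional
  -- normalised at 1 and invariant on the block matrix exists. It would annihilate 1 if 1 were in N.
  have h1 : (1 : A) ∉ N := by
    intro h
    obtain ⟨I, _, _, z, hz, hzh⟩ := hN 1 h
    obtain ⟨h, hh1, hh⟩ := (hz.fromBlocks IsCoUnitary.one).exists_leftInvariant
      ((coeffs_le_fromBlocks z _).2 (mem_coeffs (1 : Matrix (Fin 1) (Fin 1) A) 0 0))
    have := hzh h ((coeffs_le_fromBlocks z _).1.trans hh)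
    rw [hh1] at this
    exact one_ne_zero this
  obtain ⟨g, hg1, hgN⟩ := Submodule.exists_le_ker_of_notMem h1
  refine ⟨(g 1)⁻¹ • g, by simp [hg1], fun a => ?_⟩
  rw [← sub_eq_zero, ← Module.forall_dual_apply_eq_zero_iff ℂ]
  intro f
  have h2 : g (TensorProduct.lid ℂ A (f.rTensor A (comul a)) - f 1 • a) = 0 :=
    hgN (Submodule.subset_span ⟨f, a, rfl⟩)
  have h3 : ∀ t : A ⊗[ℂ] A, g (TensorProduct.lid ℂ A (f.rTensor A t)) =
      f (TensorProduct.rid ℂ A (g.lTensor A t)) := by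
    intro t
    induction t with
    | zero => simp
    | add u v hu hv => simp only [map_add, hu, hv]
    | tmul u v => simp [mul_comm]
  rw [map_sub, h3, map_smul, sub_eq_zero] at h2
  rw [LinearMap.lTensor_smul, LinearMap.smul_apply, map_smul, map_sub, map_smul, map_smul, h2]
  simp only [LinearMap.smul_apply, smul_eq_mul]
  ring

end HaarExistence

/-! ### Contractions with the coaction, freeness, and operators linear over the invariant forms. -/

section Contraction

variable {A : Type*} [Ring A] [HopfAlgebra ℂ A] [StarRing A] [StarModule ℂ A]
variable {H : Type*} [Ring H] [Algebra ℂ H] [StarAddMonoid H] [StarModule ℂ H]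
variable {𝓗 : ℕ → Submodule ℂ H} [GradedAlgebra 𝓗] (S : HorizontalForms A 𝓗)
variable {X Y : Type*} [Ring X] [Algebra ℂ X] [Ring Y] [Algebra ℂ Y]

/-- The convolution product of linear maps `A → X`. -/
def conv (g g' : A →ₗ[ℂ] X) : A →ₗ[ℂ] X :=
  LinearMap.mul' ℂ X ∘ₗ TensorProduct.map g g' ∘ₗ comul

theorem quad_eq_conv (g : A →ₗ[ℂ] X) : quad g = conv g g := rfl

theorem map_conv (f : X →ₐ[ℂ] Y) (g g' : A →ₗ[ℂ] X) (a : A) :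
    f (conv g g' a) = conv (f.toLinearMap ∘ₗ g) (f.toLinearMap ∘ₗ g') a := by
  simp only [conv, LinearMap.comp_apply]
  generalize comul (R := ℂ) a = t
  induction t with
  | zero => simp
  | add u v hu hv => simp only [map_add, hu, hv]
  | tmul u v => simp

namespace HorizontalForms

/-- The map `φ ↦ ∑ f(φ_k) g(c_k)`, where `F(φ) = ∑ φ_k ⊗ c_k`. -/
def contr (f : H →ₗ[ℂ] X) (g : A →ₗ[ℂ] X) : H →ₗ[ℂ] X :=
  LinearMap.mul' ℂ X ∘ₗ TensorProduct.map f g ∘ₗ S.F.toLinearMap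

theorem contr_apply (f : H →ₗ[ℂ] X) (g : A →ₗ[ℂ] X) (φ : H) :
    S.contr f g φ = LinearMap.mul' ℂ X (TensorProduct.map f g (S.F φ)) := rfl

theorem contr_add (f : H →ₗ[ℂ] X) (g g' : A →ₗ[ℂ] X) (φ : H) :
    S.contr f (g + g') φ = S.contr f g φ + S.contr f g' φ := by
  simp only [contr_apply, TensorProduct.map_add_right, LinearMap.add_apply, map_add]

theorem contr_smul (f : H →ₗ[ℂ] X) (r : ℂ) (g : A →ₗ[ℂ] X) (φ : H) :
    S.contr f (r • g) φ = r • S.contr f g φ := by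
  simp only [contr_apply, TensorProduct.map_smul_right, LinearMap.smul_apply, map_smul]

theorem contr_neg (f : H →ₗ[ℂ] X) (g : A →ₗ[ℂ] X) (φ : H) :
    S.contr f (-g) φ = -S.contr f g φ := by
  rw [← neg_one_smul ℂ g, contr_smul, neg_one_smul]

theorem contr_sub (f : H →ₗ[ℂ] X) (g g' : A →ₗ[ℂ] X) (φ : H) :
    S.contr f (g - g') φ = S.contr f g φ - S.contr f g' φ := by
  rw [sub_eq_add_neg, contr_add, contr_neg, sub_eq_add_neg]

theorem contract_eq_contr (χ : A →ₗ[ℂ] H) (φ : H) :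
    contract χ (S.F φ) = S.contr LinearMap.id χ φ := rfl

/-- Linear maps which agree on the tensors with homogeneous first factor agree on `F(φ)`. -/
theorem eq_on_coaction {Z : Type*} [AddCommGroup Z] [Module ℂ Z] {U V : H ⊗[ℂ] A →ₗ[ℂ] Z} {n : ℕ}
    {φ : H} (hφ : φ ∈ 𝓗 n) (h : ∀ y ∈ 𝓗 n, ∀ c, U (y ⊗ₜ c) = V (y ⊗ₜ c)) :
    U (S.F φ) = V (S.F φ) := by
  obtain ⟨t, ht⟩ := S.F_mem n φ hφ
  rw [← ht]
  clear ht
  induction t with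
  | zero => simp
  | add u v hu hv => simp only [map_add, hu, hv]
  | tmul u v => exact h u u.2 v

/-- Since F preserves degrees, an identity with a degree-dependent sign need only be checked for
first factors of the degree of φ. -/
theorem map_contr {n : ℕ} {φ : H} (hφ : φ ∈ 𝓗 n) {f : H →ₗ[ℂ] X} {g : A →ₗ[ℂ] X}
    {f' : H →ₗ[ℂ] Y} {g' : A →ₗ[ℂ] Y} (L : X →ₗ[ℂ] Y)
    (h : ∀ y ∈ 𝓗 n, ∀ c, L (f y * g c) = f' y * g' c) :
    L (S.contr f g φ) = S.contr f' g' φ :=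
  S.eq_on_coaction (U := L ∘ₗ LinearMap.mul' ℂ X ∘ₗ TensorProduct.map f g)
    (V := LinearMap.mul' ℂ Y ∘ₗ TensorProduct.map f' g') hφ (fun y hy c => by simpa using h y hy c)

theorem contr_congr {n : ℕ} {φ : H} (hφ : φ ∈ 𝓗 n) {f f' : H →ₗ[ℂ] X} {g g' : A →ₗ[ℂ] X}
    (h : ∀ y ∈ 𝓗 n, ∀ c, f y * g c = f' y * g' c) : S.contr f g φ = S.contr f' g' φ :=
  S.map_contr hφ LinearMap.id h

theorem contr_mem {n : ℕ} {φ : H} (hφ : φ ∈ 𝓗 n) {f : H →ₗ[ℂ] X} {g : A →ₗ[ℂ] X}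
    {N : Submodule ℂ X} (h : ∀ y ∈ 𝓗 n, ∀ c, f y * g c ∈ N) : S.contr f g φ ∈ N := by
  rw [← Submodule.Quotient.mk_eq_zero, ← Submodule.mkQ_apply]
  have := S.eq_on_coaction (U := N.mkQ ∘ₗ LinearMap.mul' ℂ X ∘ₗ TensorProduct.map f g) (V := 0) hφ
    (fun y hy c => by simpa using h y hy c)
  simpa [contr_apply] using this

theorem ext_homogeneous {Z : Type*} [AddCommGroup Z] [Module ℂ Z] {U V : H →ₗ[ℂ] Z}
    (h : ∀ n, ∀ φ ∈ 𝓗 n, U φ = V φ) : U = V := by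
  classical
  ext φ
  induction φ using DirectSum.Decomposition.inductionOn 𝓗 with
  | zero => simp
  | homogeneous φ => exact h _ φ φ.2
  | add x y hx hy => rw [map_add, map_add, hx, hy]

/-- Coassociativity: applying the coproduct to c_k may be replaced by applying F once more to φ_k. A
product as B yields `contr_contr`; a general bilinear B is needed for `exists_contr_eq`. -/
theorem contr_comul (f : H →ₗ[ℂ] X) (B : A →ₗ[ℂ] A →ₗ[ℂ] X) (φ : H) :
    S.contr f (TensorProduct.lift B ∘ₗ comul) φ =
      TensorProduct.lift (LinearMap.mk₂ ℂ (fun y c => S.contr f (B.flip c) y)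
        (fun y y' c => map_add _ _ _) (fun r y c => map_smul _ _ _)
        (fun y c c' => by rw [map_add, contr_add])
        (fun r y c => by rw [map_smul, contr_smul])) (S.F φ) := by
  let U : H ⊗[ℂ] (A ⊗[ℂ] A) →ₗ[ℂ] X :=
    LinearMap.mul' ℂ X ∘ₗ TensorProduct.map f (TensorProduct.lift B)
  have h1 : ∀ t : H ⊗[ℂ] A, LinearMap.mul' ℂ X (TensorProduct.map f
      (TensorProduct.lift B ∘ₗ comul) t) = U ((comul (R := ℂ) (A := A)).lTensor H t) := by
    intro t
    induction t with
    | zero => simp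
    | add u v hu hv => simp only [map_add, hu, hv]
    | tmul u v => simp [U]
  rw [contr_apply, h1, S.coassoc]
  generalize S.F φ = t
  induction t with
  | zero => simp
  | add u v hu hv => simp only [map_add, hu, hv]
  | tmul u v =>
    simp only [LinearMap.rTensor_tmul, TensorProduct.lift.tmul, LinearMap.mk₂_apply, contr_apply,
      AlgHom.toLinearMap_apply]
    generalize S.F u = s
    induction s with
    | zero => simp
    | add u v hu hv => simp only [map_add, hu, hv, TensorProduct.add_tmul]
    | tmul x y => simp [U]

theorem contr_contr (f : H →ₗ[ℂ] X) (g g' : A →ₗ[ℂ] X) (φ : H) :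
    S.contr (S.contr f g) g' φ = S.contr f (conv g g') φ := by
  have h1 : conv g g' =
      TensorProduct.lift ((LinearMap.mul ℂ X).compl₁₂ g g') ∘ₗ comul := by
    rw [conv, ← LinearMap.comp_assoc]
    congr 1
    ext; simp
  rw [h1, contr_comul, contr_apply]
  generalize S.F φ = t
  induction t with
  | zero => simp
  | add u v hu hv => simp only [map_add, hu, hv]
  | tmul u v =>
    simp only [LinearMap.mul'_apply, TensorProduct.map_tmul, TensorProduct.lift.tmul,
      LinearMap.mk₂_apply, contr_apply]
    generalize S.F u = s
    induction s with
    | zero => simp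
    | add u v hu hv => simp only [map_add, add_mul, hu, hv]
    | tmul x y => simp [mul_assoc]

theorem contr_comp_of_covariant {T : H →ₗ[ℂ] H} (hT : ∀ φ, S.F (T φ) = T.rTensor A (S.F φ))
    (f : H →ₗ[ℂ] X) (g : A →ₗ[ℂ] X) (φ : H) : S.contr f g (T φ) = S.contr (f ∘ₗ T) g φ := by
  rw [contr_apply, contr_apply, hT]
  generalize S.F φ = t
  induction t with
  | zero => simp
  | add u v hu hv => simp only [map_add, hu, hv]
  | tmul x y => simp

theorem contr_counit (f : H →ₗ[ℂ] X) (x : X) (φ : H) :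
    S.contr f ((counit (R := ℂ) (A := A)).smulRight x) φ = f φ * x := by
  have h := congr(LinearMap.mul' ℂ X (TensorProduct.map f (LinearMap.toSpanSingleton ℂ X x)
    $(S.counit_F φ)))
  rw [TensorProduct.map_tmul, LinearMap.mul'_apply, LinearMap.toSpanSingleton_apply,
    one_smul] at h
  rw [← h, contr_apply]
  generalize S.F φ = t
  induction t with
  | zero => simp
  | add u v hu hv => simp only [map_add, hu, hv]
  | tmul x y => simp

/-- The map `a ↦ ∑ f(ψ_k) g(a c_k)`. -/
def contrShift (f : H →ₗ[ℂ] X) (g : A →ₗ[ℂ] X) (ψ : H) : A →ₗ[ℂ] X where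
  toFun a := S.contr f (g ∘ₗ LinearMap.mulLeft ℂ a) ψ
  map_add' a b := by
    have : g ∘ₗ LinearMap.mulLeft ℂ (a + b) =
      g ∘ₗ LinearMap.mulLeft ℂ a + g ∘ₗ LinearMap.mulLeft ℂ b := by ext; simp [add_mul]
    rw [this, contr_add]
  map_smul' r a := by
    have : g ∘ₗ LinearMap.mulLeft ℂ (r • a) = r • (g ∘ₗ LinearMap.mulLeft ℂ a) := by ext; simp
    rw [this, contr_smul]; rfl

theorem contrShift_apply (f : H →ₗ[ℂ] X) (g : A →ₗ[ℂ] X) (ψ : H) (a : A) :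
    S.contrShift f g ψ a = S.contr f (g ∘ₗ LinearMap.mulLeft ℂ a) ψ := rfl

/-- As f is multiplicative, f(φ_k ψ_l) g(c_k d_l) regroups as f(φ_k) times an element depending only
on c_k and ψ. No commutation is involved. -/
theorem contr_mul (f : H →ₐ[ℂ] X) (g : A →ₗ[ℂ] X) (φ ψ : H) :
    S.contr f.toLinearMap g (φ * ψ) =
      S.contr f.toLinearMap (S.contrShift f.toLinearMap g ψ) φ := by
  rw [contr_apply, contr_apply, map_mul]
  generalize S.F φ = t
  induction t with
  | zero => simp
  | add u v hu hv => simp only [map_add, add_mul, hu, hv]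
  | tmul u v =>
    simp only [LinearMap.mul'_apply, TensorProduct.map_tmul, contrShift_apply, contr_apply]
    generalize S.F ψ = s
    induction s with
    | zero => simp
    | add u v hu hv => simp only [map_add, mul_add, hu, hv]
    | tmul x y => simp [mul_assoc]

/-- A linear map on `A` is recovered from its contractions with the elements of the bundle. -/
theorem sum_contr_of_free (f : H →ₐ[ℂ] X) (g : A →ₗ[ℂ] X) {a : A} {n : ℕ} {q b : Fin n → H}
    (h : ∑ i, (q i ⊗ₜ[ℂ] (1 : A)) * S.F (b i) = 1 ⊗ₜ[ℂ] a) :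
    ∑ i, f (q i) * S.contr f.toLinearMap g (b i) = g a := by
  have h1 := congr(LinearMap.mul' ℂ X (TensorProduct.map f.toLinearMap g $h))
  rw [map_sum, map_sum, TensorProduct.map_tmul, LinearMap.mul'_apply, AlgHom.toLinearMap_apply,
    map_one, one_mul] at h1
  rw [← h1]
  refine Finset.sum_congr rfl fun i _ => ?_
  rw [contr_apply]
  generalize S.F (b i) = t
  induction t with
  | zero => simp
  | add u v hu hv => simp only [map_add, mul_add, hu, hv]
  | tmul x y => simp [mul_assoc]

/-- By freeness, a linear map on `A` is determined by its contractions with the bundle. -/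
theorem eq_of_contr_eq (f : H →ₐ[ℂ] X) {g g' : A →ₗ[ℂ] X}
    (h : ∀ b ∈ 𝓗 0, S.contr f.toLinearMap g b = S.contr f.toLinearMap g' b) : g = g' := by
  ext a
  obtain ⟨n, q, b, hq, hb, hqb⟩ := S.free a
  rw [← S.sum_contr_of_free f g hqb, ← S.sum_contr_of_free f g' hqb]
  exact Finset.sum_congr rfl fun i _ => by rw [h _ (hb i)]

/-- In this form the coaction itself becomes subject to `contr_contr`. -/
theorem F_eq_contr : S.F.toLinearMap = S.contr
    (Algebra.TensorProduct.includeLeft : H →ₐ[ℂ] H ⊗[ℂ] A).toLinearMap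
    (Algebra.TensorProduct.includeRight : A →ₐ[ℂ] H ⊗[ℂ] A).toLinearMap := by
  ext φ
  rw [contr_apply, AlgHom.toLinearMap_apply]
  generalize S.F φ = t
  induction t with
  | zero => simp
  | add u v hu hv => simp only [map_add, ← hu, ← hv]
  | tmul x y => simp

/-- `∑ F(φ_k) (1 ⊗ κ(c_k)) = φ ⊗ 1`. -/
theorem contr_antipode (φ : H) : S.contr S.F.toLinearMap
    ((Algebra.TensorProduct.includeRight : A →ₐ[ℂ] H ⊗[ℂ] A).toLinearMap ∘ₗ antipode ℂ) φ =
      φ ⊗ₜ 1 := by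
  have h1 : conv (Algebra.TensorProduct.includeRight : A →ₐ[ℂ] H ⊗[ℂ] A).toLinearMap
      ((Algebra.TensorProduct.includeRight : A →ₐ[ℂ] H ⊗[ℂ] A).toLinearMap ∘ₗ antipode ℂ) =
      (counit (R := ℂ) (A := A)).smulRight 1 := by
    ext a
    have h2 : conv LinearMap.id (antipode ℂ) a = counit (R := ℂ) a • 1 := by
      rw [← Algebra.algebraMap_eq_smul_one, ← HopfAlgebra.mul_antipode_lTensor_comul_apply]
      rfl
    rw [LinearMap.smulRight_apply, ← map_one
      (Algebra.TensorProduct.includeRight : A →ₐ[ℂ] H ⊗[ℂ] A), ← map_smul, ← h2, map_conv]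
    rfl
  rw [F_eq_contr, contr_contr, h1, contr_counit, mul_one]
  rfl

/-- The elements `∑ φ_k h(c_k)`, for a left-invariant functional `h`, are invariant. -/
theorem average_mem_invariants {h : A →ₗ[ℂ] ℂ}
    (hh : ∀ a, TensorProduct.rid ℂ A (h.lTensor A (comul a)) = h a • (1 : A)) (φ : H) :
    S.contr LinearMap.id (h.smulRight 1) φ ∈ invariants S.F := by
  -- Left invariance of h, as a convolution identity: convolving the inclusion of A with h gives
  -- back h.
  have h1 : conv (Algebra.TensorProduct.includeRight : A →ₐ[ℂ] H ⊗[ℂ] A).toLinearMap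
      (h.smulRight 1) = h.smulRight 1 := by
    ext a
    have h2 : conv LinearMap.id (h.smulRight (1 : A)) a = h a • 1 := by
      rw [← hh, conv, LinearMap.comp_apply, LinearMap.comp_apply]
      generalize comul (R := ℂ) a = t
      induction t with
      | zero => simp
      | add u v hu hv => simp only [map_add, hu, hv]
      | tmul x y => simp
    rw [LinearMap.smulRight_apply, ← map_one
      (Algebra.TensorProduct.includeRight : A →ₐ[ℂ] H ⊗[ℂ] A), ← map_smul, ← h2, map_conv]
    refine congr(conv _ $(?_) a)
    ext; simp
  have h3 : ∀ L : H →ₐ[ℂ] H ⊗[ℂ] A, L (S.contr LinearMap.id (h.smulRight 1) φ) =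
      S.contr L.toLinearMap (h.smulRight 1) φ := by
    intro L
    rw [contr_apply, contr_apply]
    generalize S.F φ = t
    induction t with
    | zero => simp
    | add u v hu hv => simp only [map_add, hu, hv]
    | tmul x y => simp
  change S.F _ = Algebra.TensorProduct.includeLeft _
  rw [h3, h3, F_eq_contr, contr_contr, h1]

theorem star_tmul_one_mul (S : HorizontalForms A 𝓗) {q : H} (hq : q ∈ 𝓗 0) (t : H ⊗[ℂ] A) :
    star ((q ⊗ₜ[ℂ] (1 : A)) * t) = star t * (star q ⊗ₜ[ℂ] (1 : A)) := by
  induction t with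
  | zero => simp
  | add u v hu hv => simp only [mul_add, star_add, hu, hv, add_mul]
  | tmul u v => simp [(S.star_mul_zero hq u).1]

/-- The right-handed form of freeness, with a choice which is linear in `a`. -/
theorem exists_free_right : ∃ τ : A →ₗ[ℂ] 𝓗 0 ⊗[ℂ] 𝓗 0,
    ∀ a, LinearMap.mul' ℂ (H ⊗[ℂ] A) (TensorProduct.map (S.F.toLinearMap ∘ₗ (𝓗 0).subtype)
      ((TensorProduct.mk ℂ H A).flip 1 ∘ₗ (𝓗 0).subtype) (τ a)) = 1 ⊗ₜ a := by
  set L : 𝓗 0 ⊗[ℂ] 𝓗 0 →ₗ[ℂ] H ⊗[ℂ] A := LinearMap.mul' ℂ (H ⊗[ℂ] A) ∘ₗ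
    TensorProduct.map (S.F.toLinearMap ∘ₗ (𝓗 0).subtype)
      ((TensorProduct.mk ℂ H A).flip 1 ∘ₗ (𝓗 0).subtype) with hL
  have h1 : ∀ a : A, (TensorProduct.mk ℂ H A 1) a ∈ LinearMap.range L := by
    intro a
    -- The involution reverses the products (q_i ⊗ 1)F(b_i), so freeness for a^* becomes the
    -- right-handed form for a.
    obtain ⟨n, q, b, hq, hb, hqb⟩ := S.free (star a)
    refine ⟨∑ i, (⟨star (b i), S.star_mem 0 _ (hb i)⟩ : 𝓗 0) ⊗ₜ
      (⟨star (q i), S.star_mem 0 _ (hq i)⟩ : 𝓗 0), ?_⟩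
    have h2 := congr(star $hqb)
    rw [star_sum, TensorProduct.star_tmul, star_star, S.star_one_eq] at h2
    rw [TensorProduct.mk_apply, ← h2, map_sum]
    refine Finset.sum_congr rfl fun i _ => ?_
    rw [S.star_tmul_one_mul (hq i), ← S.F_star]
    simp [hL]
  -- Vector spaces are projective, so preimages can be chosen linearly.
  obtain ⟨τ, hτ⟩ := Module.projective_lifting_property L.rangeRestrict
    ((TensorProduct.mk ℂ H A 1).codRestrict (LinearMap.range L) h1) L.surjective_rangeRestrict
  exact ⟨τ, fun a => congr(($hτ a : H ⊗[ℂ] A))⟩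

theorem nontrivial_of_hopf (A : Type*) [Ring A] [HopfAlgebra ℂ A] : Nontrivial A :=
  (Bialgebra.counitAlgHom ℂ A).toRingHom.domain_nontrivial

/-- A linear map which is linear, up to signs, over the invariant forms is given by contractions
with a linear map on `A`. -/
theorem exists_contr_eq [CompactMatrixQuantumGroup A] (T : H →ₗ[ℂ] H) (s : ℕ → ℂ)
    (hs : ∀ n, s n * s n = 1)
    (hT : ∀ n, ∀ w ∈ invariants S.F, w ∈ 𝓗 n → ∀ b ∈ 𝓗 0, T (w * b) = s n • (w * T b)) :
    ∃ χ : A →ₗ[ℂ] H, ∀ n, ∀ φ ∈ 𝓗 n, T φ = -(s n • S.contr LinearMap.id χ φ) := by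
  have := nontrivial_of_hopf A
  obtain ⟨h, h1, hh⟩ := exists_haar (A := A)
  obtain ⟨τ, hτ⟩ := S.exists_free_right
  -- Integration of the second factor; Q∘F is the averaging onto the invariant forms.
  let Q : H ⊗[ℂ] A →ₗ[ℂ] H := LinearMap.mul' ℂ H ∘ₗ TensorProduct.map LinearMap.id (h.smulRight 1)
  have hQ : ∀ z (r : H), Q (z * (r ⊗ₜ 1)) = Q z * r := by
    intro z r
    induction z with
    | zero => simp
    | add u v hu hv => simp only [map_add, add_mul, hu, hv]
    | tmul x y => simp [Q]
  -- G(c)(r ⊗ b) = Q((1 ⊗ c)F(r)) T(b): the part of Q(F(y r)) T(b) that remains to the right of the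
  -- y_k.
  let G : A →ₗ[ℂ] (𝓗 0 ⊗[ℂ] 𝓗 0) →ₗ[ℂ] H :=
    { toFun := fun c => LinearMap.mul' ℂ H ∘ₗ TensorProduct.map
        (Q ∘ₗ LinearMap.mulLeft ℂ (1 ⊗ₜ c) ∘ₗ S.F.toLinearMap ∘ₗ (𝓗 0).subtype)
        (T ∘ₗ (𝓗 0).subtype)
      map_add' := fun c d => by
        apply TensorProduct.ext'
        intro x y
        simp [TensorProduct.tmul_add, add_mul]
      map_smul' := fun r c => by
        apply TensorProduct.ext'
        intro x y
        simp }
  -- The average of y r is invariant of degree n, so T passes over it at the price of s_n. The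
  -- condition s_n² = 1 moves this sign to the other side.
  have hG : ∀ n, ∀ y ∈ 𝓗 n, ∀ t, S.contr LinearMap.id (G.flip t) y = s n •
      T (Q (S.F y * LinearMap.mul' ℂ (H ⊗[ℂ] A) (TensorProduct.map
        (S.F.toLinearMap ∘ₗ (𝓗 0).subtype)
        ((TensorProduct.mk ℂ H A).flip 1 ∘ₗ (𝓗 0).subtype) t))) := by
    intro n y hy t
    induction t with
    | zero => simp [contr_apply]
    | add u v hu hv =>
      simp only [map_add, mul_add, ← hu, ← hv, smul_add]
      simp [contr_apply, TensorProduct.map_add_right]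
    | tmul r b =>
      have e1 : ∀ t : H ⊗[ℂ] A, LinearMap.mul' ℂ H (TensorProduct.map LinearMap.id
          (G.flip (r ⊗ₜ b)) t) = Q (t * S.F r) * T b := by
        intro t
        induction t with
        | zero => simp
        | add u v hu hv => simp only [map_add, add_mul, hu, hv]
        | tmul x c =>
          simp only [TensorProduct.map_tmul, LinearMap.mul'_apply, LinearMap.flip_apply, G,
            LinearMap.coe_mk, AddHom.coe_mk, LinearMap.comp_apply, Submodule.subtype_apply,
            LinearMap.mulLeft_apply, AlgHom.toLinearMap_apply, LinearMap.id_apply]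
          generalize S.F (r : H) = z
          induction z with
          | zero => simp
          | add u v hu hv => simp only [map_add, add_mul, mul_add, hu, hv]
          | tmul x y => simp [Q, mul_assoc]
      have hyr : y * (r : H) ∈ 𝓗 n := by simpa using SetLike.GradedMul.mul_mem hy r.2
      have e2 : Q (S.F (y * r)) ∈ 𝓗 n :=
        S.contr_mem (f := LinearMap.id) (g := h.smulRight 1) hyr (fun u hu c => by
          simpa using Submodule.smul_mem _ _ hu)
      rw [contr_apply, e1, ← map_mul]
      simp only [TensorProduct.map_tmul, LinearMap.mul'_apply, LinearMap.comp_apply,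
        Submodule.subtype_apply, AlgHom.toLinearMap_apply, LinearMap.flip_apply,
        TensorProduct.mk_apply]
      have e3 : Q (S.F (y * r)) ∈ invariants S.F := S.average_mem_invariants hh (y * r)
      rw [← mul_assoc, ← map_mul, hQ, hT n _ e3 e2 _ b.2, smul_smul, hs, one_smul]
  -- Thus χ(c) = -G(c⁽¹⁾)(τ(κ(c⁽²⁾))). Coassociativity lets `hG` be applied to each φ_k, and Σ
  -- F(φ_k)(1 ⊗ κ(c_k)) = φ ⊗ 1 reassembles φ, with h(1) = 1.
  refine ⟨-(TensorProduct.lift (G.compl₂ (τ ∘ₗ antipode ℂ)) ∘ₗ comul), fun n φ hφ => ?_⟩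
  have e3 : S.contr LinearMap.id (-(TensorProduct.lift (G.compl₂ (τ ∘ₗ antipode ℂ)) ∘ₗ comul)) φ =
      -(s n • T (Q (S.contr S.F.toLinearMap
    ((Algebra.TensorProduct.includeRight : A →ₐ[ℂ] H ⊗[ℂ] A).toLinearMap ∘ₗ antipode ℂ) φ))) := by
    rw [contr_neg, contr_comul]
    congr 1
    refine S.eq_on_coaction (V := (s n • T ∘ₗ Q) ∘ₗ LinearMap.mul' ℂ (H ⊗[ℂ] A) ∘ₗ
      TensorProduct.map S.F.toLinearMap ((Algebra.TensorProduct.includeRight :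
        A →ₐ[ℂ] H ⊗[ℂ] A).toLinearMap ∘ₗ antipode ℂ)) hφ ?_
    intro y hy c
    have e5 := hG n y hy (τ (antipode ℂ c))
    rw [hτ] at e5
    refine e5.trans ?_
    simp
  rw [e3, contr_antipode]
  simp [Q, h1, smul_smul, hs]

end HorizontalForms

end Contraction

/-! ### The maps χ♮_E and ϱ♮_D: existence, exchange rules, Bianchi identity, change of
preconnection. -/

section Coefficients

variable {A : Type*} [Ring A] [HopfAlgebra ℂ A] [StarRing A] [StarModule ℂ A]
variable {H : Type*} [Ring H] [Algebra ℂ H] [StarAddMonoid H] [StarModule ℂ H]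
variable {𝓗 : ℕ → Submodule ℂ H} [GradedAlgebra 𝓗] {S : HorizontalForms A 𝓗}

namespace HorizontalForms

theorem map_contr_add {X Y : Type*} [Ring X] [Algebra ℂ X] [Ring Y] [Algebra ℂ Y]
    (S : HorizontalForms A 𝓗) {n : ℕ} {φ : H} (hφ : φ ∈ 𝓗 n) {f : H →ₗ[ℂ] X} {g : A →ₗ[ℂ] X}
    {f₁ f₂ : H →ₗ[ℂ] Y} {g₁ g₂ : A →ₗ[ℂ] Y} (L : X →ₗ[ℂ] Y)
    (h : ∀ y ∈ 𝓗 n, ∀ c, L (f y * g c) = f₁ y * g₁ c + f₂ y * g₂ c) :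
    L (S.contr f g φ) = S.contr f₁ g₁ φ + S.contr f₂ g₂ φ :=
  S.eq_on_coaction (U := L ∘ₗ LinearMap.mul' ℂ X ∘ₗ TensorProduct.map f g)
    (V := LinearMap.mul' ℂ Y ∘ₗ TensorProduct.map f₁ g₁ +
      LinearMap.mul' ℂ Y ∘ₗ TensorProduct.map f₂ g₂) hφ (fun y hy c => by simpa using h y hy c)

theorem base_ext {g g' : A →ₗ[ℂ] H}
    (h : ∀ b ∈ 𝓗 0, S.contr LinearMap.id g b = S.contr LinearMap.id g' b) : g = g' :=
  S.eq_of_contr_eq (AlgHom.id ℂ H) h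

theorem mul_mem_of_base {b φ : H} {n : ℕ} (hb : b ∈ 𝓗 0) (hφ : φ ∈ 𝓗 n) : b * φ ∈ 𝓗 n := by
  simpa using SetLike.GradedMul.mul_mem hb hφ

theorem mem_of_contr_mem {g : A →ₗ[ℂ] H} {n : ℕ}
    (h : ∀ b ∈ 𝓗 0, S.contr LinearMap.id g b ∈ 𝓗 n) (a : A) : g a ∈ 𝓗 n := by
  obtain ⟨m, q, b, hq, hb, hqb⟩ := S.free a
  rw [← S.sum_contr_of_free (AlgHom.id ℂ H) g hqb]
  exact Submodule.sum_mem _ fun i _ => mul_mem_of_base (hq i) (h _ (hb i))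

section Chi

variable {E : H →ₗ[ℂ] H} {χ : A →ₗ[ℂ] H}

theorem IsChiNat.apply (h : S.IsChiNat E χ) {n : ℕ} {φ : H} (hφ : φ ∈ 𝓗 n) :
    E φ = -((-1 : ℂ) ^ n • S.contr LinearMap.id χ φ) := h n φ hφ

theorem IsChiNat.apply_base (h : S.IsChiNat E χ) {b : H} (hb : b ∈ 𝓗 0) :
    S.contr LinearMap.id χ b = -E b := by
  rw [h.apply hb]; simp

theorem IsChiNat.unique {χ' : A →ₗ[ℂ] H} (h : S.IsChiNat E χ) (h' : S.IsChiNat E χ') : χ = χ' :=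
  base_ext (S := S) fun b hb => by rw [h.apply_base hb, h'.apply_base hb]

theorem IsChiNat.mem (h : S.IsChiNat E χ) (hE : S.IsAntiderivation E) (a : A) : χ a ∈ 𝓗 1 :=
  mem_of_contr_mem (S := S) (fun b hb => by
    rw [h.apply_base hb]
    exact Submodule.neg_mem _ (hE.map_mem 0 b hb)) a

theorem IsAntiderivation.base_mul (hE : S.IsAntiderivation E) {b : H} (hb : b ∈ 𝓗 0) (φ : H) :
    E (b * φ) = E b * φ + b * E φ := by
  simpa using hE.leibniz 0 b hb φ

/-- Contracted with b in the bundle, this is the Leibniz rule E(bφ) = E(b)φ + bE(φ) with all three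
values of E expressed through χ; freeness removes b. -/
theorem IsChiNat.mul (h : S.IsChiNat E χ) (hE : S.IsAntiderivation E) (a : A) {n : ℕ} {φ : H}
    (hφ : φ ∈ 𝓗 n) : χ a * φ = (-1 : ℂ) ^ n • (S.contr LinearMap.id (χ ∘ₗ LinearMap.mulLeft ℂ a) φ -
      counit (R := ℂ) a • S.contr LinearMap.id χ φ) := by
  have key : LinearMap.mulRight ℂ φ ∘ₗ χ = (-1 : ℂ) ^ n • (S.contrShift LinearMap.id χ φ -
      (counit (R := ℂ) (A := A)).smulRight (S.contr LinearMap.id χ φ)) := by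
    refine base_ext (S := S) fun b hb => ?_
    rw [contr_smul, contr_sub, contr_counit]
    have e1 : S.contr LinearMap.id (LinearMap.mulRight ℂ φ ∘ₗ χ) b =
        S.contr LinearMap.id χ b * φ :=
      (S.map_contr hb (LinearMap.mulRight ℂ φ) (fun y _ c => by simp [mul_assoc])).symm
    have e2 : S.contr LinearMap.id χ (b * φ) =
        S.contr LinearMap.id (S.contrShift LinearMap.id χ φ) b :=
      S.contr_mul (AlgHom.id ℂ H) χ b φ
    rw [e1, ← e2, h.apply_base hb]
    have e3 := hE.base_mul hb φ
    rw [h.apply hφ, h.apply (mul_mem_of_base hb hφ)] at e3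
    rw [neg_mul, eq_sub_of_add_eq e3.symm]
    simp only [LinearMap.id_apply, mul_neg, mul_smul_comm, smul_sub]
    abel
  exact congr($key a)

theorem exists_isChiNat [CompactMatrixQuantumGroup A] (hE : E ∈ S.differences) :
    ∃ χ, S.IsChiNat E χ := by
  obtain ⟨hE, hE0⟩ := hE
  refine S.exists_contr_eq E (fun n => (-1) ^ n) (fun n => ?_) (fun n w hw hwn b hb => ?_)
  · rw [← mul_pow]; simp
  · rw [hE.leibniz n w hwn, hE0 ⟨w, hw⟩, zero_mul, zero_add]

theorem isChiNat_chiNat [CompactMatrixQuantumGroup A] (hE : E ∈ S.differences) :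
    S.IsChiNat E (S.chiNat E) := by
  have h := S.exists_isChiNat hE
  rw [chiNat, dif_pos h]
  exact h.choose_spec

theorem chiNat_add [CompactMatrixQuantumGroup A] {W : H →ₗ[ℂ] H} (hE : E ∈ S.differences)
    (hW : W ∈ S.differences) : S.chiNat (E + W) = S.chiNat E + S.chiNat W := by
  refine (isChiNat_chiNat (S.differences.add_mem hE hW)).unique fun n φ hφ => ?_
  rw [contract_eq_contr, contr_add, LinearMap.add_apply, (isChiNat_chiNat hE).apply hφ,
    (isChiNat_chiNat hW).apply hφ, smul_add, neg_add]

end Chi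

section Rho

variable {D : H →ₗ[ℂ] H} {ρ : A →ₗ[ℂ] H}

theorem IsRhoNat.apply (h : S.IsRhoNat D ρ) (φ : H) : S.contr LinearMap.id ρ φ = -D (D φ) := by
  rw [h φ, neg_neg]; rfl

theorem IsRhoNat.unique {ρ' : A →ₗ[ℂ] H} (h : S.IsRhoNat D ρ) (h' : S.IsRhoNat D ρ') : ρ = ρ' :=
  base_ext (S := S) fun b _ => by rw [h.apply, h'.apply]

theorem IsRhoNat.mem (h : S.IsRhoNat D ρ) (hD : S.IsAntiderivation D) (a : A) : ρ a ∈ 𝓗 2 :=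
  mem_of_contr_mem (S := S) (fun b hb => by
    rw [h.apply]
    exact Submodule.neg_mem _ (hD.map_mem 1 _ (hD.map_mem 0 b hb))) a

theorem IsAntiderivation.sq_mul (hD : S.IsAntiderivation D) {n : ℕ} {φ : H} (hφ : φ ∈ 𝓗 n)
    (ψ : H) : D (D (φ * ψ)) = D (D φ) * ψ + φ * D (D ψ) := by
  rw [hD.leibniz n φ hφ, map_add, map_smul, hD.leibniz (n + 1) _ (hD.map_mem n φ hφ),
    hD.leibniz n φ hφ, smul_add, smul_smul, ← mul_pow, pow_succ]
  simp only [mul_neg, mul_one, neg_smul, neg_neg, one_pow, one_smul]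
  abel

theorem IsRhoNat.mul (h : S.IsRhoNat D ρ) (hD : S.IsAntiderivation D) (a : A) (φ : H) :
    ρ a * φ = S.contr LinearMap.id (ρ ∘ₗ LinearMap.mulLeft ℂ a) φ -
      counit (R := ℂ) a • S.contr LinearMap.id ρ φ := by
  have key : LinearMap.mulRight ℂ φ ∘ₗ ρ = S.contrShift LinearMap.id ρ φ -
      (counit (R := ℂ) (A := A)).smulRight (S.contr LinearMap.id ρ φ) := by
    refine base_ext (S := S) fun b hb => ?_
    rw [contr_sub, contr_counit]
    have e1 : S.contr LinearMap.id (LinearMap.mulRight ℂ φ ∘ₗ ρ) b =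
        S.contr LinearMap.id ρ b * φ :=
      (S.map_contr hb (LinearMap.mulRight ℂ φ) (fun y _ c => by simp [mul_assoc])).symm
    have e2 : S.contr LinearMap.id ρ (b * φ) =
        S.contr LinearMap.id (S.contrShift LinearMap.id ρ φ) b :=
      S.contr_mul (AlgHom.id ℂ H) ρ b φ
    rw [e1, ← e2, h.apply, h.apply, h.apply, hD.sq_mul hb]
    simp only [LinearMap.id_apply, mul_neg, neg_mul]
    abel
  exact congr($key a)

/-- The square of an odd antiderivation is an ordinary derivation. It kills the invariant forms,
because D is d_M there; hence it is linear over them without sign. -/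
theorem exists_isRhoNat [CompactMatrixQuantumGroup A] (hD : D ∈ S.preconnections) :
    ∃ ρ, S.IsRhoNat D ρ := by
  obtain ⟨hD, hD0⟩ := hD
  obtain ⟨ρ, hρ⟩ := S.exists_contr_eq (D ∘ₗ D) (fun _ => 1) (fun n => by simp)
    (fun n w hw hwn b hb => by
      simp only [LinearMap.comp_apply, one_smul]
      rw [hD.sq_mul hwn, hD0 ⟨w, hw⟩, hD0, S.dM_dM]
      simp)
  refine ⟨ρ, fun φ => ?_⟩
  have : D ∘ₗ D = -S.contr LinearMap.id ρ :=
    ext_homogeneous (𝓗 := 𝓗) fun n φ hφ => by simpa using hρ n φ hφ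
  exact congr($this φ)

theorem isRhoNat_rhoNat [CompactMatrixQuantumGroup A] (hD : D ∈ S.preconnections) :
    S.IsRhoNat D (S.rhoNat D) := by
  have h := S.exists_isRhoNat hD
  rw [rhoNat, dif_pos h]
  exact h.choose_spec

/-- The Bianchi identity. -/
theorem IsRhoNat.bianchi (h : S.IsRhoNat D ρ) (hD : S.IsAntiderivation D) (a : A) :
    D (ρ a) = 0 := by
  have key : D ∘ₗ ρ = 0 := by
    refine base_ext (S := S) fun b hb => ?_
    -- D(D²b) = D²(Db) is evaluated twice: the Leibniz rule gives two terms, while covariance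
    -- identifies the right side with the first of them. The contraction of D∘ρ with b therefore
    -- vanishes.
    have e1 : D (S.contr LinearMap.id ρ b) = S.contr D ρ b + S.contr LinearMap.id (D ∘ₗ ρ) b :=
      S.map_contr_add hb D fun y hy c => by simpa using hD.base_mul hy (ρ c)
    have e2 := S.contr_comp_of_covariant hD.covariant LinearMap.id ρ b
    rw [LinearMap.id_comp, h.apply] at e2
    rw [← e2, h.apply, map_neg] at e1
    have e3 : S.contr LinearMap.id (0 : A →ₗ[ℂ] H) b = 0 := by simp [contr_apply]
    rw [e3]
    exact left_eq_add.1 e1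
  exact congr($key a)

/-- The curvatures of `D` and `D + E`. -/
theorem IsRhoNat.add {E : H →ₗ[ℂ] H} {χ ρ' : A →ₗ[ℂ] H} (h : S.IsRhoNat D ρ)
    (hD : S.IsAntiderivation D) (hχ : S.IsChiNat E χ) (hE : S.IsAntiderivation E)
    (h' : S.IsRhoNat (D + E) ρ') (a : A) :
    ρ' a = ρ a + D (χ a) + E (χ a) - conv χ χ a := by
  have key : ρ' = ρ + D ∘ₗ χ + E ∘ₗ χ - conv χ χ := by
    refine base_ext (S := S) fun b hb => ?_
    rw [contr_sub, contr_add, contr_add, h.apply, h'.apply]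
    have e1 : D (E b) = -(S.contr D χ b + S.contr LinearMap.id (D ∘ₗ χ) b) := by
      have : D (S.contr LinearMap.id χ b) = S.contr D χ b + S.contr LinearMap.id (D ∘ₗ χ) b :=
        S.map_contr_add hb D fun y hy c => by simpa using hD.base_mul hy (χ c)
      rw [← this, hχ.apply_base hb, map_neg, neg_neg]
    -- Since Db has degree one, the sign here is opposite to that in `e1`, and the terms in
    -- D(b_k)χ(c_k) cancel in DE + ED.
    have e2 : E (D b) = S.contr D χ b := by
      have := S.contr_comp_of_covariant hD.covariant LinearMap.id χ b
      rw [LinearMap.id_comp] at this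
      rw [hχ.apply (hD.map_mem 0 b hb), this]
      simp
    have e3 : E (E b) = -(S.contr E χ b + S.contr LinearMap.id (E ∘ₗ χ) b) := by
      have : E (S.contr LinearMap.id χ b) = S.contr E χ b + S.contr LinearMap.id (E ∘ₗ χ) b :=
        S.map_contr_add hb E fun y hy c => by simpa using hE.base_mul hy (χ c)
      rw [← this, hχ.apply_base hb, map_neg, neg_neg]
    have e4 : S.contr E χ b = -S.contr LinearMap.id (conv χ χ) b := by
      rw [← contr_contr, ← contr_neg]
      exact S.contr_congr hb fun y hy c => by simp [hχ.apply_base hy]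
    simp only [LinearMap.add_apply, map_add, e1, e2, e3, e4]
    abel
  exact congr($key a)

end Rho

section Quotient

variable [CompactMatrixQuantumGroup A]

theorem chi_proj (E : S.differences) (a : A) : S.chi E (proj S.idealHat a) = S.chiNat E a := rfl

theorem curvature_proj (D : S.preconnections) (a : A) :
    S.curvature D (proj S.idealHat a) = S.rhoNat D a := rfl

theorem chi_mem (E : S.differences) (θ : InvForms S.idealHat) : S.chi E θ ∈ 𝓗 1 := by
  obtain ⟨a, rfl⟩ := proj_surjective _ θ
  exact (isChiNat_chiNat E.2).mem E.2.1 a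

theorem curvature_mem (D : S.preconnections) (θ : InvForms S.idealHat) :
    S.curvature D θ ∈ 𝓗 2 := by
  obtain ⟨a, rfl⟩ := proj_surjective _ θ
  exact (isRhoNat_rhoNat D.2).mem D.2.1 a

/-- This is the rule by which θ itself is exchanged with φ in vh_P. It is what allows θ - χ_E(θ) to
be the image of θ under a homomorphism fixing hor_P. -/
theorem chi_mul (E : S.differences) (θ : InvForms S.idealHat) {n : ℕ} {φ : H} (hφ : φ ∈ 𝓗 n) :
    S.chi E θ * φ = (-1 : ℂ) ^ n •
      S.contr LinearMap.id (S.chi E ∘ₗ invAct S.idealHat θ) φ := by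
  obtain ⟨a, rfl⟩ := proj_surjective _ θ
  rw [chi_proj, (isChiNat_chiNat E.2).mul E.2.1 a hφ, ← contr_smul, ← contr_sub]
  refine congr(_ • S.contr _ $(?_) φ)
  ext b
  simp [invAct_proj, chi_proj]

theorem curvature_mul (D : S.preconnections) (θ : InvForms S.idealHat) (φ : H) :
    S.curvature D θ * φ = S.contr LinearMap.id (S.curvature D ∘ₗ invAct S.idealHat θ) φ := by
  obtain ⟨a, rfl⟩ := proj_surjective _ θ
  rw [curvature_proj, (isRhoNat_rhoNat D.2).mul D.2.1 a φ, ← contr_smul, ← contr_sub]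
  refine congr(S.contr _ $(?_) φ)
  ext b
  simp [invAct_proj, curvature_proj]

theorem bianchi (D : S.preconnections) (θ : InvForms S.idealHat) : D.1 (S.curvature D θ) = 0 := by
  obtain ⟨a, rfl⟩ := proj_surjective _ θ
  exact (isRhoNat_rhoNat D.2).bianchi D.2.1 a

theorem curvature_vadd (E : S.differences) (D : S.preconnections) (a : A) :
    S.curvature (E +ᵥ D) (proj S.idealHat a) = S.curvature D (proj S.idealHat a) +
      D.1 (S.chi E (proj S.idealHat a)) + E.1 (S.chi E (proj S.idealHat a)) -
      conv (S.chiNat E) (S.chiNat E) a :=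
  (isRhoNat_rhoNat D.2).add D.2.1 (isChiNat_chiNat E.2) E.2.1 (isRhoNat_rhoNat (E +ᵥ D).2) a

/-- On R̂ both curvatures and χ vanish, so the formula for the curvature of D + E leaves only χ*χ.
This is the point at which some preconnection must exist. -/
theorem conv_chiNat_eq_zero (hne : S.preconnections.Nonempty) (E : S.differences) {a : A}
    (ha : a ∈ S.idealHat.carrier) : conv (S.chiNat E) (S.chiNat E) a = 0 := by
  obtain ⟨D, hD⟩ := hne
  have := curvature_vadd E ⟨D, hD⟩ a
  rw [proj_eq_zero ha] at this
  simpa using this.symm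

theorem chi_add (E W : S.differences) : S.chi (E + W) = S.chi E + S.chi W := by
  refine LinearMap.ext fun θ => ?_
  obtain ⟨a, rfl⟩ := proj_surjective _ θ
  rw [LinearMap.add_apply, chi_proj, chi_proj, chi_proj, Submodule.coe_add, chiNat_add E.2 W.2]
  rfl

theorem chi_zero : S.chi (0 : S.differences) = 0 := by
  have := chi_add (0 : S.differences) 0
  simpa using this

theorem chi_invStar (E : S.differences) (θ : InvForms S.idealHat) :
    S.chi E (invStar S.idealHat θ) = star (S.chi E θ) := by
  obtain ⟨a, rfl⟩ := proj_surjective _ θ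
  rw [invStar_proj, map_neg, chi_proj, chi_proj]
  rcases S.chiNat_spec E.2 with h | h
  · rw [h.chi_star, neg_neg]
  · simp [h]

theorem curvature_invStar (D : S.preconnections) (θ : InvForms S.idealHat) :
    S.curvature D (invStar S.idealHat θ) = star (S.curvature D θ) := by
  obtain ⟨a, rfl⟩ := proj_surjective _ θ
  rw [invStar_proj, map_neg, curvature_proj, curvature_proj]
  rcases S.rhoNat_spec D.2 with h | h
  · rw [h.chi_star, neg_neg]
  · simp [h]

end Quotient

end HorizontalForms

end Coefficients

/-! ### Generators, grading and universal property of vh_P. -/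

section UniversalProperty

variable {A : Type*} [Ring A] [HopfAlgebra ℂ A] [StarRing A] [StarModule ℂ A]
variable {H : Type*} [Ring H] [Algebra ℂ H] [StarAddMonoid H] [StarModule ℂ H]
variable {𝓗 : ℕ → Submodule ℂ H} [GradedAlgebra 𝓗]
variable (S : HorizontalForms A 𝓗) (R : CalculusIdeal A)

theorem HorizontalForms.coaction_mem {Z : Type*} [AddCommGroup Z] [Module ℂ Z] {N : Submodule ℂ Z}
    {U : H ⊗[ℂ] A →ₗ[ℂ] Z} {n : ℕ} {φ : H} (hφ : φ ∈ 𝓗 n)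
    (h : ∀ y ∈ 𝓗 n, ∀ c, U (y ⊗ₜ c) ∈ N) : U (S.F φ) ∈ N := by
  rw [← Submodule.Quotient.mk_eq_zero, ← Submodule.mkQ_apply]
  have := S.eq_on_coaction (U := N.mkQ ∘ₗ U) (V := 0) hφ (fun y hy c => by simpa using h y hy c)
  simpa using this

variable {R}

theorem mem_iSup_envDeg (w : InvEnvelope R) : w ∈ ⨆ n, envDeg R n := by
  induction w using env_induction with
  | h0 r =>
    refine Submodule.mem_iSup_of_mem 0 ?_
    rw [envDeg, pow_zero]
    exact Submodule.mem_one.2 ⟨r, rfl⟩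
  | h1 θ =>
    refine Submodule.mem_iSup_of_mem 1 ?_
    rw [envDeg, pow_one]
    exact ⟨θ, rfl⟩
  | hm x y hx hy =>
    have := Submodule.mul_mem_mul hx hy
    simp only [Submodule.iSup_mul, Submodule.mul_iSup] at this
    refine (iSup₂_le fun n m => ?_ : (⨆ n, ⨆ m, envDeg R m * envDeg R n) ≤ _) this
    rw [envDeg, envDeg, ← pow_add]
    exact le_iSup (envDeg R) (m + n)
  | ha x y hx hy => exact Submodule.add_mem _ hx hy

theorem envAct_mem {n : ℕ} {w : InvEnvelope R} (hw : w ∈ envDeg R n) (a : A) :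
    envAct R w a ∈ envDeg R n := by
  induction n generalizing w a with
  | zero =>
    rw [envDeg, pow_zero, Submodule.mem_one] at hw
    obtain ⟨c, rfl⟩ := hw
    rw [envAct_algebraMap, envDeg, pow_zero]
    exact Submodule.smul_mem _ _ (Submodule.mem_one.2 ⟨_, rfl⟩)
  | succ n ih =>
    rw [envDeg, pow_succ'] at hw ⊢
    induction hw using Submodule.mul_induction_on' with
    | mem_mul_mem x hx y hy =>
      obtain ⟨θ, rfl⟩ := hx
      rw [envAct_mul]
      generalize comul (R := ℂ) a = t
      induction t with
      | zero => simp
      | add u v hu hv => simp only [map_add]; exact Submodule.add_mem _ hu hv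
      | tmul u v =>
        rw [TensorProduct.map_tmul, LinearMap.mul'_apply, envAct_incl]
        exact Submodule.mul_mem_mul ⟨_, rfl⟩ (ih hy v)
    | add x _ y _ hx hy => rw [map_add, LinearMap.add_apply]; exact Submodule.add_mem _ hx hy

variable (R)

theorem vhMk_one_mul_vhMk (ψ φ : H) (θ : InvEnvelope R) :
    vhMk S R ψ 1 * vhMk S R φ θ = vhMk S R (ψ * φ) θ := by
  let L : H →ₗ[ℂ] VH S R := vhOfTensor S R ∘ₗ (TensorProduct.mk ℂ H (InvEnvelope R)).flip θ
  have hL : ∀ φ, L φ = vhMk S R φ θ := fun φ => rfl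
  have : LinearMap.mulLeft ℂ (vhMk S R ψ 1) ∘ₗ L = L ∘ₗ LinearMap.mulLeft ℂ ψ := by
    refine HorizontalForms.ext_homogeneous (𝓗 := 𝓗) fun n φ hφ => ?_
    simp only [LinearMap.comp_apply, LinearMap.mulLeft_apply, hL]
    change vhMul S R ((ψ ⊗ₜ 1) ⊗ₜ (φ ⊗ₜ θ)) = _
    rw [vhMul_tmul S R ψ 1 hφ, envParity_pow_one]
    have : ∀ t : H ⊗[ℂ] A, TensorProduct.map (LinearMap.mulLeft ℂ ψ)
        (LinearMap.mulRight ℂ θ ∘ₗ envAct R 1) t =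
        TensorProduct.map (LinearMap.mulLeft ℂ ψ) (LinearMap.toSpanSingleton ℂ (InvEnvelope R) θ)
          ((counit (R := ℂ) (A := A)).lTensor H t) := by
      intro t
      induction t with
      | zero => simp
      | add u v hu hv => simp only [map_add, hu, hv]
      | tmul u v => simp [envAct_one, Algebra.algebraMap_eq_smul_one]
    rw [this, S.counit_F]
    simp [vhMk]
  exact congr($this φ)

theorem vhMk_mul_one_vhMk (φ : H) (w v : InvEnvelope R) :
    vhMk S R φ w * vhMk S R 1 v = vhMk S R φ (w * v) := by
  change vhMul S R ((φ ⊗ₜ w) ⊗ₜ (1 ⊗ₜ v)) = φ ⊗ₜ (w * v)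
  rw [vhMul_tmul S R φ w (HorizontalForms.one_mem_zero (𝓗 := 𝓗)), map_one,
    Algebra.TensorProduct.one_def]
  simp [envAct_apply_one]

/-- The inclusion `hor_P → vh_P`. -/
def vhHor : H →ₐ[ℂ] VH S R :=
  AlgHom.ofLinearMap (vhOfTensor S R ∘ₗ (TensorProduct.mk ℂ H (InvEnvelope R)).flip 1) rfl
    (fun φ ψ => (vhMk_one_mul_vhMk S R φ ψ 1).symm)

theorem vhHor_apply (φ : H) : vhHor S R φ = vhMk S R φ 1 := rfl

/-- The inclusion `Ψ_inv^∧ → vh_P`. -/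
def vhEnv : InvEnvelope R →ₐ[ℂ] VH S R :=
  AlgHom.ofLinearMap (vhOfTensor S R ∘ₗ TensorProduct.mk ℂ H (InvEnvelope R) 1) rfl
    (fun w v => (vhMk_mul_one_vhMk S R 1 w v).symm)

theorem vhEnv_apply (w : InvEnvelope R) : vhEnv S R w = vhMk S R 1 w := rfl

theorem vhMk_eq (φ : H) (w : InvEnvelope R) : vhMk S R φ w = vhHor S R φ * vhEnv S R w := by
  rw [vhHor_apply, vhEnv_apply, vhMk_mul_one_vhMk, one_mul]

theorem vhOfTensor_tmul (φ : H) (w : InvEnvelope R) :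
    vhOfTensor S R (φ ⊗ₜ w) = vhHor S R φ * vhEnv S R w := vhMk_eq S R φ w

/-- The inclusion `Ψ_inv → vh_P`. -/
def vhInv : InvForms R →ₗ[ℂ] VH S R := (vhEnv S R).toLinearMap ∘ₗ incl R

theorem vhInv_apply (θ : InvForms R) : vhInv S R θ = vhEnv S R (incl R θ) := rfl

theorem vhOfTensor_lTensor (g : A →ₗ[ℂ] InvEnvelope R) (φ : H) :
    vhOfTensor S R (g.lTensor H (S.F φ)) =
      S.contr (vhHor S R).toLinearMap ((vhEnv S R).toLinearMap ∘ₗ g) φ := by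
  rw [HorizontalForms.contr_apply]
  generalize S.F φ = t
  induction t with
  | zero => simp
  | add u v hu hv => simp only [map_add, hu, hv]
  | tmul x y => simp [vhOfTensor_tmul]

/-- The exchange relation between the two kinds of generators, on which the universal property
rests. -/
theorem vhInv_mul_vhHor (θ : InvForms R) {n : ℕ} {φ : H} (hφ : φ ∈ 𝓗 n) :
    vhInv S R θ * vhHor S R φ = (-1 : ℂ) ^ n •
      S.contr (vhHor S R).toLinearMap (vhInv S R ∘ₗ invAct R θ) φ := by
  have h1 : incl R θ ∈ envDeg R 1 := by rw [envDeg, pow_one]; exact ⟨θ, rfl⟩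
  rw [vhInv_apply, vhEnv_apply, vhHor_apply, vhMk_mul_vhMk S R 1 h1 hφ 1, one_mul]
  congr 1
  have h2 : TensorProduct.map (LinearMap.mulLeft ℂ (1 : H))
      (LinearMap.mulRight ℂ 1 ∘ₗ envAct R (incl R θ)) = (envAct R (incl R θ)).lTensor H := by
    ext; simp
  rw [h2, vhOfTensor_lTensor]
  refine congr(S.contr _ $(?_) φ)
  ext c
  simp [vhInv_apply, envAct_incl]

variable {R} in
theorem vhMk_mem {p q : ℕ} {φ : H} (hφ : φ ∈ 𝓗 p) {w : InvEnvelope R} (hw : w ∈ envDeg R q) :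
    vhMk S R φ w ∈ vhDeg S R (p + q) :=
  Submodule.mem_iSup_of_mem (p, q) (Submodule.mem_iSup_of_mem rfl
    (Submodule.subset_span ⟨φ, hφ, w, hw, rfl⟩))

theorem vhDeg_le {n : ℕ} {N : Submodule ℂ (VH S R)} (h : ∀ p q, p + q = n → ∀ φ ∈ 𝓗 p,
    ∀ w ∈ envDeg R q, vhMk S R φ w ∈ N) : vhDeg S R n ≤ N := by
  refine iSup₂_le fun p hp => ?_
  rw [Submodule.span_le]
  rintro _ ⟨φ, hφ, w, hw, rfl⟩
  exact h _ _ hp φ hφ w hw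

theorem vh_mul_mem {m n : ℕ} {x y : VH S R} (hx : x ∈ vhDeg S R m) (hy : y ∈ vhDeg S R n) :
    x * y ∈ vhDeg S R (m + n) := by
  have h1 : vhDeg S R m ≤ (vhDeg S R (m + n)).comap (LinearMap.mulRight ℂ y) := by
    refine vhDeg_le S R ?_
    rintro p q rfl φ hφ w hw
    have h2 : vhDeg S R n ≤ (vhDeg S R (p + q + n)).comap
        (LinearMap.mulLeft ℂ (vhMk S R φ w)) := by
      refine vhDeg_le S R ?_
      rintro p' q' rfl ψ hψ v hv
      rw [Submodule.mem_comap, LinearMap.mulLeft_apply, vhMk_mul_vhMk S R φ hw hψ]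
      refine Submodule.smul_mem _ _ (S.coaction_mem (U := vhOfTensor S R ∘ₗ TensorProduct.map
        (LinearMap.mulLeft ℂ φ) (LinearMap.mulRight ℂ v ∘ₗ envAct R w)) hψ fun y hy c => ?_)
      have h3 : φ * y ∈ 𝓗 (p + p') := SetLike.GradedMul.mul_mem hφ hy
      have h4 : envAct R w c * v ∈ envDeg R (q + q') := by
        have := Submodule.mul_mem_mul (envAct_mem hw c) hv
        rwa [envDeg, envDeg, ← pow_add] at this
      have h5 := vhMk_mem S h3 h4
      rwa [add_add_add_comm] at h5
    exact h2 hy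
  exact h1 hx

theorem vhHor_mem {n : ℕ} {φ : H} (hφ : φ ∈ 𝓗 n) : vhHor S R φ ∈ vhDeg S R n :=
  vhMk_mem S hφ (q := 0) (by rw [envDeg, pow_zero]; exact Submodule.mem_one.2 ⟨1, map_one _⟩)

theorem vhEnv_mem {n : ℕ} {w : InvEnvelope R} (hw : w ∈ envDeg R n) :
    vhEnv S R w ∈ vhDeg S R n := by
  have := vhMk_mem S (HorizontalForms.one_mem_zero (𝓗 := 𝓗)) hw
  rwa [zero_add] at this

theorem vhInv_mem (θ : InvForms R) : vhInv S R θ ∈ vhDeg S R 1 :=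
  vhEnv_mem S R (by rw [envDeg, pow_one]; exact ⟨θ, rfl⟩)

variable {S R} in
/-- Induction on homogeneous elements of `vh_P`. -/
theorem vhDeg_induction {C : ℕ → VH S R → Prop} (zero : ∀ n, C n 0)
    (add : ∀ n x y, x ∈ vhDeg S R n → y ∈ vhDeg S R n → C n x → C n y → C n (x + y))
    (hor : ∀ n, ∀ φ ∈ 𝓗 n, C n (vhHor S R φ)) (inv : ∀ θ, C 1 (vhInv S R θ))
    (mul : ∀ m n x y, x ∈ vhDeg S R m → y ∈ vhDeg S R n → C m x → C n y → C (m + n) (x * y))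
    {n : ℕ} {x : VH S R} (hx : x ∈ vhDeg S R n) : C n x := by
  have hscal : ∀ c : ℂ, algebraMap ℂ H c ∈ 𝓗 0 := fun c => SetLike.algebraMap_mem_graded 𝓗 c
  have henv : ∀ q, ∀ w ∈ envDeg R q, C q (vhEnv S R w) := by
    intro q
    induction q with
    | zero =>
      intro w hw
      rw [envDeg, pow_zero, Submodule.mem_one] at hw
      obtain ⟨c, rfl⟩ := hw
      have := hor 0 _ (hscal c)
      rwa [AlgHom.commutes] at this ⊢
    | succ q ih =>
      intro w hw
      have hw' := hw
      rw [envDeg, pow_succ'] at hw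
      induction hw using Submodule.mul_induction_on' with
      | mem_mul_mem x hx y hy =>
        obtain ⟨θ, rfl⟩ := hx
        rw [map_mul, add_comm]
        exact mul 1 q _ _ (vhInv_mem S R θ) (vhEnv_mem S R hy) (inv θ) (ih y hy)
      | add x hx y hy hx' hy' =>
        rw [← pow_succ'] at hx hy
        rw [map_add]
        exact add _ _ _ (vhEnv_mem S R hx) (vhEnv_mem S R hy) (hx' hx) (hy' hy)
  let N : Submodule ℂ (VH S R) :=
    { carrier := {x | x ∈ vhDeg S R n ∧ C n x}
      zero_mem' := ⟨Submodule.zero_mem _, zero n⟩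
      add_mem' := fun hx hy => ⟨Submodule.add_mem _ hx.1 hy.1, add n _ _ hx.1 hy.1 hx.2 hy.2⟩
      -- A scalar is a horizontal element of degree zero, so closure under scalars is an instance of
      -- `mul`.
      smul_mem' := fun c x hx => ⟨Submodule.smul_mem _ _ hx.1, by
        have := mul 0 n _ _ (vhHor_mem S R (hscal c)) hx.1 (hor 0 _ (hscal c)) hx.2
        rwa [zero_add, AlgHom.commutes, ← Algebra.smul_def] at this⟩ }
  have h1 : vhDeg S R n ≤ N := by
    refine vhDeg_le S R ?_
    rintro p q rfl φ hφ w hw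
    refine ⟨vhMk_mem S hφ hw, ?_⟩
    rw [vhMk_eq]
    exact mul p q _ _ (vhHor_mem S R hφ) (vhEnv_mem S R hw) (hor p φ hφ) (henv q w hw)
  exact (h1 hx).2

theorem mem_iSup_vhDeg (x : VH S R) : x ∈ ⨆ n, vhDeg S R n := by
  induction x using vh_induction 𝓗 R with
  | h0 => exact Submodule.zero_mem _
  | hadd x y hx hy => exact Submodule.add_mem _ hx hy
  | ht m φ hφ w =>
    have h1 : (⨆ n, envDeg R n) ≤ (⨆ n, vhDeg S R n).comap
        (LinearMap.mulLeft ℂ (vhHor S R φ) ∘ₗ (vhEnv S R).toLinearMap) := by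
      refine iSup_le fun n w hw => Submodule.mem_iSup_of_mem (m + n) ?_
      exact vh_mul_mem S R (vhHor_mem S R hφ) (vhEnv_mem S R hw)
    have := h1 (mem_iSup_envDeg w)
    rw [Submodule.mem_comap, LinearMap.comp_apply, LinearMap.mulLeft_apply] at this
    rw [AlgHom.toLinearMap_apply, ← vhMk_eq] at this
    exact this

variable {S R} in
theorem vh_homogeneous_induction {C : VH S R → Prop} (zero : C 0)
    (add : ∀ x y, C x → C y → C (x + y)) (homogeneous : ∀ n, ∀ x ∈ vhDeg S R n, C x)
    (x : VH S R) : C x :=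
  Submodule.iSup_induction _ (motive := C) (mem_iSup_vhDeg S R x) homogeneous zero add

variable {S R} in
theorem vh_gen_induction {C : VH S R → Prop} (zero : C 0)
    (add : ∀ x y, C x → C y → C (x + y)) (hor : ∀ n, ∀ φ ∈ 𝓗 n, C (vhHor S R φ))
    (inv : ∀ θ, C (vhInv S R θ)) (mul : ∀ x y, C x → C y → C (x * y)) (x : VH S R) : C x :=
  vh_homogeneous_induction zero add (fun _ _ hx =>
    vhDeg_induction (C := fun _ x => C x) (fun _ => zero) (fun _ x y _ _ => add x y) hor inv
      (fun _ _ x y _ _ => mul x y) hx) x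

section Lift

variable {X : Type*} [Ring X] [Algebra ℂ X] {S R}

theorem vh_algHom_ext {f g : VH S R →ₐ[ℂ] X} (h1 : ∀ φ, f (vhHor S R φ) = g (vhHor S R φ))
    (h2 : ∀ θ, f (vhInv S R θ) = g (vhInv S R θ)) : f = g := by
  ext x
  induction x using vh_gen_induction with
  | zero => simp
  | add x y hx hy => rw [map_add, map_add, hx, hy]
  | hor n φ _ => exact h1 φ
  | inv θ => exact h2 θ
  | mul x y hx hy => rw [map_mul, map_mul, hx, hy]

variable (f : H →ₐ[ℂ] X) (g : InvForms R →ₗ[ℂ] X)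
  (hg : ∀ a ∈ R.carrier, quad (g.comp (proj R)) a = 0)
  (hfg : ∀ n, ∀ φ ∈ 𝓗 n, ∀ θ, g θ * f φ =
    (-1 : ℂ) ^ n • S.contr f.toLinearMap (g ∘ₗ invAct R θ) φ)

variable (S) in
/-- The linear map `φ ⊗ w ↦ f(φ) g(w)`. -/
def vhLiftLin : VH S R →ₗ[ℂ] X :=
  TensorProduct.lift ((LinearMap.mul ℂ X).compl₁₂ f.toLinearMap (envLift g hg).toLinearMap)

theorem vhLiftLin_mul (φ : H) (w : InvEnvelope R) :
    vhLiftLin S f g hg (vhHor S R φ * vhEnv S R w) = f φ * envLift g hg w := by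
  rw [← vhMk_eq]
  rfl

theorem vh_mk_induction {C : VH S R → Prop} (zero : C 0)
    (add : ∀ x y, C x → C y → C (x + y))
    (mk : ∀ n, ∀ φ ∈ 𝓗 n, ∀ w, C (vhHor S R φ * vhEnv S R w)) (x : VH S R) : C x := by
  induction x using vh_induction 𝓗 R with
  | h0 => exact zero
  | hadd x y hx hy => exact add x y hx hy
  | ht m φ hφ w =>
    have := mk m φ hφ w
    rw [← vhMk_eq] at this
    exact this

theorem vhLiftLin_hor_mul (φ : H) (x : VH S R) :
    vhLiftLin S f g hg (vhHor S R φ * x) = f φ * vhLiftLin S f g hg x := by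
  induction x using vh_mk_induction with
  | zero => simp
  | add x y hx hy => rw [mul_add, map_add, map_add, hx, hy, mul_add]
  | mk n ψ _ w => rw [← mul_assoc, ← map_mul, vhLiftLin_mul, vhLiftLin_mul, map_mul, mul_assoc]

theorem vhLiftLin_mul_env (x : VH S R) (w : InvEnvelope R) :
    vhLiftLin S f g hg (x * vhEnv S R w) = vhLiftLin S f g hg x * envLift g hg w := by
  induction x using vh_mk_induction with
  | zero => simp
  | add x y hx hy => rw [add_mul, map_add, map_add, hx, hy, add_mul]
  | mk n ψ _ v => rw [mul_assoc, ← map_mul, vhLiftLin_mul, vhLiftLin_mul, map_mul, mul_assoc]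

/-- Only here does the exchange condition on f and g enter. Induction on w reduces the claim to a
single one-form θ, which then has to be moved past one horizontal factor. -/
theorem vhLiftLin_env_mul (hfg : ∀ n, ∀ φ ∈ 𝓗 n, ∀ θ, g θ * f φ =
    (-1 : ℂ) ^ n • S.contr f.toLinearMap (g ∘ₗ invAct R θ) φ) (w : InvEnvelope R) (x : VH S R) :
    vhLiftLin S f g hg (vhEnv S R w * x) = envLift g hg w * vhLiftLin S f g hg x := by
  induction w using env_induction generalizing x with
  | h0 r => simp [← Algebra.smul_def]
  | hm v w hv hw => rw [map_mul (vhEnv S R), mul_assoc, hv, hw, map_mul (envLift g hg), mul_assoc]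
  | ha v w hv hw => rw [map_add, add_mul, map_add, map_add, hv, hw, add_mul]
  | h1 θ =>
    induction x using vh_mk_induction with
    | zero => simp
    | add x y hx hy => rw [mul_add, map_add, map_add, hx, hy, mul_add]
    | mk n φ hφ w =>
      rw [← mul_assoc, ← vhInv_apply, vhInv_mul_vhHor S R θ hφ, vhLiftLin_mul_env, map_smul,
        vhLiftLin_mul, ← mul_assoc, envLift_incl, hfg n φ hφ θ]
      congr 2
      exact S.map_contr hφ (vhLiftLin S f g hg) fun y _ c => by
        simp [vhInv_apply, vhLiftLin_mul, envLift_incl]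

variable (S) in
/-- The universal property of `vh_P`. -/
def vhLift : VH S R →ₐ[ℂ] X :=
  AlgHom.ofLinearMap (vhLiftLin S f g hg)
    (by
      have := vhLiftLin_mul (S := S) f g hg 1 1
      simpa using this)
    (fun x y => by
      induction x using vh_mk_induction with
      | zero => simp
      | add u v hu hv => rw [add_mul, map_add, map_add, hu, hv, add_mul]
      | mk n φ _ w =>
        rw [mul_assoc, vhLiftLin_hor_mul, vhLiftLin_env_mul f g hg hfg, vhLiftLin_mul, mul_assoc])

theorem vhLift_hor (φ : H) : vhLift S f g hg hfg (vhHor S R φ) = f φ := by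
  have := vhLiftLin_mul (S := S) f g hg φ 1
  rw [map_one, map_one, mul_one, mul_one] at this
  exact this

theorem vhLift_inv (θ : InvForms R) : vhLift S f g hg hfg (vhInv S R θ) = g θ := by
  have := vhLiftLin_mul (S := S) f g hg 1 (incl R θ)
  rw [map_one, map_one, one_mul, one_mul, envLift_incl] at this
  exact this

end Lift

end UniversalProperty

/-! ### The involution of vh_P. -/

section Involution

variable {A : Type*} [Ring A] [HopfAlgebra ℂ A] [StarRing A] [StarModule ℂ A]

/-- The map `a ↦ κ(a)^*` is an involution. -/
theorem star_antipode_star_antipode [HopfStar A] (a : A) :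
    star (antipode ℂ (star (antipode ℂ a))) = a := by
  let T : A →ₗ[ℂ] A :=
    { toFun := fun a => star (antipode ℂ (star a))
      map_add' := by simp
      map_smul' := by simp }
  -- The star of an antipode axiom: T satisfies it with the order of the coproduct reversed, T(b⁽²⁾)
  -- b⁽¹⁾ = ε(b).
  have h1 : ∀ b : A, LinearMap.mul' ℂ A (TensorProduct.map T LinearMap.id
      (TensorProduct.comm ℂ A A (comul b))) = counit (R := ℂ) b • 1 := by
    intro b
    have h2 := congr(star $(HopfAlgebra.mul_antipode_lTensor_comul_apply (R := ℂ) (star b)))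
    rw [HopfStar.comul_star, HopfStar.counit_star, Algebra.algebraMap_eq_smul_one, star_smul,
      star_star, star_one] at h2
    rw [← h2]
    generalize comul (R := ℂ) b = t
    induction t with
    | zero => simp
    | add u v hu hv => simp only [map_add, star_add, hu, hv]
    | tmul u v => simp [T]
  have h3 : WithConv.toConv (T ∘ₗ antipode ℂ) * WithConv.toConv (antipode ℂ (A := A)) = 1 := by
    ext a
    rw [LinearMap.convMul_apply, LinearMap.convOne_apply, Algebra.algebraMap_eq_smul_one,
      ← counit_antipode (R := ℂ) a, ← h1, comul_antipode]
    change LinearMap.mul' ℂ A (TensorProduct.map (T ∘ₗ antipode ℂ) (antipode ℂ) (comul a)) = _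
    generalize comul (R := ℂ) a = t
    induction t with
    | zero => simp
    | add u v hu hv => simp only [map_add, hu, hv]
    | tmul u v => simp
  -- T∘κ is a left convolution inverse of κ and the identity map a right one; hence they coincide.
  have h4 := left_inv_eq_right_inv h3 (LinearMap.antipode_mul_id (R := ℂ) (C := A))
  exact LinearMap.congr_fun (WithConv.toConv_injective h4) a

variable {H : Type*} [Ring H] [Algebra ℂ H] [StarAddMonoid H] [StarModule ℂ H]
variable {𝓗 : ℕ → Submodule ℂ H} [GradedAlgebra 𝓗]
variable (S : HorizontalForms A 𝓗) (R : CalculusIdeal A)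

/-- The additive version of `eq_on_coaction` serves for the conjugate-linear maps built from the
involution. -/
theorem HorizontalForms.addHom_eq_on_coaction {Z : Type*} [AddCommGroup Z]
    {U V : H ⊗[ℂ] A →+ Z} {n : ℕ} {φ : H} (hφ : φ ∈ 𝓗 n)
    (h : ∀ y ∈ 𝓗 n, ∀ c, U (y ⊗ₜ c) = V (y ⊗ₜ c)) : U (S.F φ) = V (S.F φ) := by
  obtain ⟨t, ht⟩ := S.F_mem n φ hφ
  rw [← ht]
  clear ht
  induction t with
  | zero => simp
  | add u v hu hv => simp only [map_add, hu, hv]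
  | tmul u v => exact h u u.2 v

theorem HorizontalForms.addHom_eq_sub_on_coaction {Z : Type*} [AddCommGroup Z]
    {U V W : H ⊗[ℂ] A →+ Z} {n : ℕ} {φ : H} (hφ : φ ∈ 𝓗 n)
    (h : ∀ y ∈ 𝓗 n, ∀ c, U (y ⊗ₜ c) = V (y ⊗ₜ c) - W (y ⊗ₜ c)) :
    U (S.F φ) = V (S.F φ) - W (S.F φ) :=
  S.addHom_eq_on_coaction (V := V - W) hφ h

theorem star_mul_one_tmul (t : H ⊗[ℂ] A) (c : A) :
    star (t * (1 ⊗ₜ[ℂ] c)) = (1 ⊗ₜ[ℂ] star c) * star t := by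
  induction t with
  | zero => simp
  | add u v hu hv => simp only [mul_add, star_add, hu, hv, add_mul]
  | tmul u v => simp

variable {S R} in
theorem vhDeg_mk_induction {n : ℕ} {C : VH S R → Prop} (zero : C 0)
    (add : ∀ x y, C x → C y → C (x + y))
    (mk : ∀ p q, p + q = n → ∀ φ ∈ 𝓗 p, ∀ w ∈ envDeg R q, C (vhHor S R φ * vhEnv S R w))
    {x : VH S R} (hx : x ∈ vhDeg S R n) : C x := by
  let N : Submodule ℂ (VH S R) :=
    { carrier := {x | ∀ c : ℂ, C (c • x)}
      zero_mem' := fun c => by rw [smul_zero]; exact zero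
      add_mem' := fun hx hy c => by rw [smul_add]; exact add _ _ (hx c) (hy c)
      smul_mem' := fun r x hx c => by rw [smul_smul]; exact hx _ }
  have h1 : vhDeg S R n ≤ N := by
    refine vhDeg_le S R fun p q hpq φ hφ w hw c => ?_
    have := mk p q hpq (c • φ) (Submodule.smul_mem _ _ hφ) w hw
    rwa [map_smul, smul_mul_assoc, ← vhMk_eq] at this
  simpa using h1 hx 1

theorem vhEnv_mul_vhHor {q : ℕ} {w : InvEnvelope R} (hw : w ∈ envDeg R q) {p : ℕ} {φ : H}
    (hφ : φ ∈ 𝓗 p) : vhEnv S R w * vhHor S R φ = (-1 : ℂ) ^ (q * p) •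
      S.contr (vhHor S R).toLinearMap ((vhEnv S R).toLinearMap ∘ₗ envAct R w) φ := by
  rw [vhEnv_apply, vhHor_apply, vhMk_mul_vhMk S R 1 hw hφ 1, ← vhOfTensor_lTensor]
  congr 2
  refine LinearMap.congr_fun ?_ _
  ext; simp

variable [HopfStar A]

theorem vhStar_mk (φ : H) (w : InvEnvelope R) : vhStar S R (vhHor S R φ * vhEnv S R w) =
    S.contr (vhHor S R).toLinearMap ((vhEnv S R).toLinearMap ∘ₗ envAct R (envStar R w))
      (star φ) := by
  rw [← vhMk_eq, ← vhOfTensor_lTensor, S.F_star]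
  rfl

/-- The formula defining the involution is w^* φ^* with its factors put back in standard order; the
exchange produces the sign (-1)^{pq} a second time. -/
theorem vhStar_mk_eq {p : ℕ} {φ : H} (hφ : φ ∈ 𝓗 p) {q : ℕ} {w : InvEnvelope R}
    (hw : w ∈ envDeg R q) : vhStar S R (vhHor S R φ * vhEnv S R w) =
      (-1 : ℂ) ^ (p * q) • (vhEnv S R (envStar R w) * vhHor S R (star φ)) := by
  rw [vhStar_mk, vhEnv_mul_vhHor S R (envStar_mem R hw) (S.star_mem p φ hφ), smul_smul,
    mul_comm q p, ← mul_pow]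
  simp

theorem vhStar_hor {φ : H} : vhStar S R (vhHor S R φ) = vhHor S R (star φ) := by
  have h := vhStar_mk S R φ 1
  have h2 : (vhEnv S R).toLinearMap ∘ₗ envAct R (1 : InvEnvelope R) =
      (counit (R := ℂ) (A := A)).smulRight 1 := by
    ext c
    simp [envAct_one, Algebra.algebraMap_eq_smul_one]
  rw [map_one, mul_one, envStar_one, h2, HorizontalForms.contr_counit, mul_one] at h
  exact h

theorem vhStar_env {q : ℕ} {w : InvEnvelope R} (hw : w ∈ envDeg R q) :
    vhStar S R (vhEnv S R w) = vhEnv S R (envStar R w) := by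
  have h := vhStar_mk_eq S R (HorizontalForms.one_mem_zero (𝓗 := 𝓗)) hw
  rw [S.star_one_eq] at h
  simpa using h

theorem incl_mem (θ : InvForms R) : incl R θ ∈ envDeg R 1 := by
  rw [envDeg, pow_one]; exact ⟨θ, rfl⟩

theorem vhStar_inv (θ : InvForms R) : vhStar S R (vhInv S R θ) = vhInv S R (invStar R θ) := by
  rw [vhInv_apply, vhStar_env S R (incl_mem R θ), envStar_incl, vhInv_apply]

theorem invStar_invAct (θ : InvForms R) (c : A) :
    invStar R (invAct R θ c) = invAct R (invStar R θ) (star (antipode ℂ c)) := by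
  obtain ⟨b, rfl⟩ := proj_surjective R θ
  rw [invAct_proj, map_sub, map_smulₛₗ, invStar_proj, invStar_proj, invStar_proj, map_neg,
    LinearMap.neg_apply, invAct_proj, antipode_mul_antidistrib, star_mul, HopfStar.counit_star,
    counit_antipode]
  simp only [smul_neg, neg_sub, sub_neg_eq_add, neg_add_eq_sub, starRingEnd_apply]

theorem invStar_invStar (θ : InvForms R) : invStar R (invStar R θ) = θ := by
  obtain ⟨b, rfl⟩ := proj_surjective R θ
  rw [invStar_proj, map_neg, invStar_proj, neg_neg, star_antipode_star_antipode]

theorem vhStar_hor_mul_inv (φ : H) (θ : InvForms R) :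
    vhStar S R (vhHor S R φ * vhInv S R θ) = LinearMap.mul' ℂ (VH S R)
      (TensorProduct.map (vhHor S R).toLinearMap (vhInv S R ∘ₗ invAct R (invStar R θ))
        (star (S.F φ))) := by
  rw [vhInv_apply, vhStar_mk, envStar_incl, HorizontalForms.contr_apply, S.F_star]
  congr 3
  ext c
  simp [envAct_incl, vhInv_apply]

/-- For this order of factors antimultiplicativity is not built into the definition. Exchanging
first and then conjugating leaves θ^* acted upon by κ(c_k)^* and by the coefficients of F(φ_k)^*;
the identity Σ F(φ_k)(1 ⊗ κ(c_k)) = φ ⊗ 1 removes this action. -/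
theorem vhStar_inv_mul_hor (θ : InvForms R) {p : ℕ} {φ : H} (hφ : φ ∈ 𝓗 p) :
    vhStar S R (vhInv S R θ * vhHor S R φ) =
      (-1 : ℂ) ^ p • (vhHor S R (star φ) * vhInv S R (invStar R θ)) := by
  let U : H ⊗[ℂ] A →ₗ[ℂ] VH S R := LinearMap.mul' ℂ (VH S R) ∘ₗ
    TensorProduct.map (vhHor S R).toLinearMap (vhInv S R ∘ₗ invAct R (invStar R θ))
  have h1 : vhStar S R (S.contr (vhHor S R).toLinearMap (vhInv S R ∘ₗ invAct R θ) φ) =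
      U (star (S.contr S.F.toLinearMap
        ((Algebra.TensorProduct.includeRight : A →ₐ[ℂ] H ⊗[ℂ] A).toLinearMap ∘ₗ antipode ℂ) φ)) := by
    refine S.addHom_eq_on_coaction
      (U := (vhStar S R : VH S R →+ VH S R).comp (LinearMap.mul' ℂ (VH S R) ∘ₗ
        TensorProduct.map (vhHor S R).toLinearMap (vhInv S R ∘ₗ invAct R θ)).toAddMonoidHom)
      (V := U.toAddMonoidHom.comp ((starAddEquiv : H ⊗[ℂ] A ≃+ H ⊗[ℂ] A).toAddMonoidHom.comp
        (LinearMap.mul' ℂ (H ⊗[ℂ] A) ∘ₗ TensorProduct.map S.F.toLinearMap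
          ((Algebra.TensorProduct.includeRight : A →ₐ[ℂ] H ⊗[ℂ] A).toLinearMap ∘ₗ
            antipode ℂ)).toAddMonoidHom)) hφ fun y hy c => ?_
    change vhStar S R (vhHor S R y * vhInv S R (invAct R θ c)) =
      U (star (S.F y * (1 ⊗ₜ antipode ℂ c)))
    rw [vhStar_hor_mul_inv, star_mul_one_tmul, invStar_invAct]
    generalize star (S.F y) = t
    induction t with
    | zero => simp
    | add u v hu hv => simp only [map_add, mul_add, hu, hv]
    | tmul u v => simp [U, invAct_mul]
  rw [vhInv_mul_vhHor S R θ hφ, map_smulₛₗ, h1, HorizontalForms.contr_antipode]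
  simp [U, invAct_one]

theorem vhStar_hor_mul {m : ℕ} {φ : H} (hφ : φ ∈ 𝓗 m) {n : ℕ} {y : VH S R}
    (hy : y ∈ vhDeg S R n) : vhStar S R (vhHor S R φ * y) =
      (-1 : ℂ) ^ (m * n) • (vhStar S R y * vhHor S R (star φ)) := by
  refine vhDeg_mk_induction (C := fun y => vhStar S R (vhHor S R φ * y) =
    (-1 : ℂ) ^ (m * n) • (vhStar S R y * vhHor S R (star φ)))
    (by simp) ?_ ?_ hy
  · intro x y hx hy
    rw [mul_add, map_add, map_add, hx, hy, add_mul, smul_add]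
  · rintro p q rfl ψ hψ w hw
    rw [← mul_assoc, ← map_mul, vhStar_mk_eq S R (SetLike.GradedMul.mul_mem hφ hψ) hw,
      vhStar_mk_eq S R hψ hw, S.star_mul m p φ hφ ψ hψ, map_smul, map_mul]
    simp only [mul_smul_comm, smul_mul_assoc, smul_smul, mul_assoc]
    congr 1
    ring

theorem vhStar_mul_env {n : ℕ} {y : VH S R} (hy : y ∈ vhDeg S R n) {m : ℕ} {w : InvEnvelope R}
    (hw : w ∈ envDeg R m) : vhStar S R (y * vhEnv S R w) =
      (-1 : ℂ) ^ (n * m) • (vhEnv S R (envStar R w) * vhStar S R y) := by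
  refine vhDeg_mk_induction (C := fun y => vhStar S R (y * vhEnv S R w) =
    (-1 : ℂ) ^ (n * m) • (vhEnv S R (envStar R w) * vhStar S R y))
    (by simp) ?_ ?_ hy
  · intro x y hx hy
    rw [add_mul, map_add, map_add, hx, hy, mul_add, smul_add]
  · rintro p q rfl ψ hψ v hv
    have hvw : v * w ∈ envDeg R (q + m) := by
      have := Submodule.mul_mem_mul hv hw
      rwa [envDeg, envDeg, ← pow_add] at this
    rw [mul_assoc, ← map_mul, vhStar_mk_eq S R hψ hvw,
      vhStar_mk_eq S R hψ hv, envStar_mul R hv hw, map_smul, map_mul]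
    simp only [mul_smul_comm, smul_mul_assoc, smul_smul, mul_assoc]
    congr 1
    ring

theorem vhStar_inv_mul (θ : InvForms R) {n : ℕ} {y : VH S R} (hy : y ∈ vhDeg S R n) :
    vhStar S R (vhInv S R θ * y) =
      (-1 : ℂ) ^ n • (vhStar S R y * vhInv S R (invStar R θ)) := by
  refine vhDeg_mk_induction (C := fun y => vhStar S R (vhInv S R θ * y) =
    (-1 : ℂ) ^ n • (vhStar S R y * vhInv S R (invStar R θ)))
    (by simp) ?_ ?_ hy
  · intro x y hx hy
    rw [mul_add, map_add, map_add, hx, hy, add_mul, smul_add]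
  · rintro p q rfl ψ hψ v hv
    rw [← mul_assoc, vhStar_mul_env S R
      (vh_mul_mem S R (vhInv_mem S R θ) (vhHor_mem S R hψ)) hv, vhStar_inv_mul_hor S R θ hψ,
      vhStar_mk_eq S R hψ hv]
    simp only [mul_smul_comm, smul_mul_assoc, smul_smul, mul_assoc]
    congr 1
    ring

theorem vhStar_mul {m n : ℕ} {x y : VH S R} (hx : x ∈ vhDeg S R m) (hy : y ∈ vhDeg S R n) :
    vhStar S R (x * y) = (-1 : ℂ) ^ (m * n) • (vhStar S R y * vhStar S R x) := by
  refine vhDeg_induction (C := fun m x => ∀ n, ∀ y ∈ vhDeg S R n, vhStar S R (x * y) =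
    (-1 : ℂ) ^ (m * n) • (vhStar S R y * vhStar S R x)) ?_ ?_ ?_ ?_ ?_ hx n y hy
  · intro m n y _; simp
  · intro m x x' _ _ hx hx' n y hy
    rw [add_mul, map_add, map_add, hx n y hy, hx' n y hy, mul_add, smul_add]
  · intro m φ hφ n y hy
    rw [vhStar_hor_mul S R hφ hy, vhStar_hor]
  · intro θ n y hy
    rw [vhStar_inv_mul S R θ hy, vhStar_inv, one_mul]
  · intro m m' x x' hx hx' hCx hCx' n y hy
    rw [mul_assoc, hCx _ _ (vh_mul_mem S R hx' hy), hCx' n y hy, hCx m' x' hx']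
    simp only [mul_smul_comm, smul_mul_assoc, smul_smul, mul_assoc]
    congr 1
    ring

theorem vhStar_mem {n : ℕ} {x : VH S R} (hx : x ∈ vhDeg S R n) :
    vhStar S R x ∈ vhDeg S R n := by
  refine vhDeg_induction (C := fun n x => vhStar S R x ∈ vhDeg S R n) ?_ ?_ ?_ ?_ ?_ hx
  · intro n; rw [map_zero]; exact Submodule.zero_mem _
  · intro n x y _ _ hx hy; rw [map_add]; exact Submodule.add_mem _ hx hy
  · intro n φ hφ; rw [vhStar_hor]; exact vhHor_mem S R (S.star_mem n φ hφ)
  · intro θ; rw [vhStar_inv]; exact vhInv_mem S R _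
  · intro m n x y hx hy hx' hy'
    rw [vhStar_mul S R hx hy, add_comm]
    exact Submodule.smul_mem _ _ (vh_mul_mem S R hy' hx')

theorem vhStar_vhStar (x : VH S R) : vhStar S R (vhStar S R x) = x := by
  induction x using vh_homogeneous_induction with
  | zero => simp
  | add x y hx hy => rw [map_add, map_add, hx, hy]
  | homogeneous n x hx =>
    refine vhDeg_induction (C := fun n x => vhStar S R (vhStar S R x) = x) ?_ ?_ ?_ ?_ ?_ hx
    · simp
    · intro n x y _ _ hx hy; rw [map_add, map_add, hx, hy]
    · intro n φ _; rw [vhStar_hor, vhStar_hor, star_star]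
    · intro θ; rw [vhStar_inv, vhStar_inv, invStar_invStar]
    · intro m n x y hx hy hx' hy'
      rw [vhStar_mul S R hx hy, map_smulₛₗ, vhStar_mul S R (vhStar_mem S R hy)
        (vhStar_mem S R hx), hx', hy', smul_smul, mul_comm n m]
      simp [← mul_pow]

/-- The map `φ ↦ ∑ φ_k π(c_k)`. -/
def vertical : H →ₗ[ℂ] VH S R :=
  S.contr (vhHor S R).toLinearMap (vhInv S R ∘ₗ proj R)

/-- Acting by v on π(c)^* = -π(κ(c)^*) gives two terms, one with the counit and one with the
antipode. The first sums to F(φ)^*, giving the right side; the second sums to (φ ⊗ 1)^*, which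
contributes nothing as π(1) = 0. -/
theorem vhStar_vertical {n : ℕ} {φ : H} (hφ : φ ∈ 𝓗 n) :
    vhStar S R (vertical S R φ) = vertical S R (star φ) := by
  let U : H ⊗[ℂ] A →ₗ[ℂ] VH S R := LinearMap.mul' ℂ (VH S R) ∘ₗ
    TensorProduct.map (vhHor S R).toLinearMap (vhInv S R ∘ₗ proj R)
  let st : H ⊗[ℂ] A →+ VH S R :=
    U.toAddMonoidHom.comp (starAddEquiv : H ⊗[ℂ] A ≃+ H ⊗[ℂ] A).toAddMonoidHom
  have h1 : vhStar S R (vertical S R φ) =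
      st (S.contr S.F.toLinearMap ((counit (R := ℂ) (A := A)).smulRight 1) φ) -
      st (S.contr S.F.toLinearMap
        ((Algebra.TensorProduct.includeRight : A →ₐ[ℂ] H ⊗[ℂ] A).toLinearMap ∘ₗ antipode ℂ) φ) := by
    refine S.addHom_eq_sub_on_coaction
      (U := (vhStar S R : VH S R →+ VH S R).comp U.toAddMonoidHom)
      (V := st.comp (LinearMap.mul' ℂ (H ⊗[ℂ] A) ∘ₗ TensorProduct.map S.F.toLinearMap
          ((counit (R := ℂ) (A := A)).smulRight 1)).toAddMonoidHom)
      (W := st.comp (LinearMap.mul' ℂ (H ⊗[ℂ] A) ∘ₗ TensorProduct.map S.F.toLinearMap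
          ((Algebra.TensorProduct.includeRight : A →ₐ[ℂ] H ⊗[ℂ] A).toLinearMap ∘ₗ
            antipode ℂ)).toAddMonoidHom) hφ fun y hy c => ?_
    have e1 : (U (y ⊗ₜ c)) = vhHor S R y * vhInv S R (proj R c) := rfl
    have e2 : LinearMap.mul' ℂ (H ⊗[ℂ] A) (TensorProduct.map S.F.toLinearMap
        ((counit (R := ℂ) (A := A)).smulRight 1) (y ⊗ₜ c)) = counit (R := ℂ) c • S.F y := by
      simp
    have e3 : LinearMap.mul' ℂ (H ⊗[ℂ] A) (TensorProduct.map S.F.toLinearMap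
        ((Algebra.TensorProduct.includeRight : A →ₐ[ℂ] H ⊗[ℂ] A).toLinearMap ∘ₗ
            antipode ℂ) (y ⊗ₜ c)) = S.F y * (1 ⊗ₜ antipode ℂ c) := by
      simp
    have e4 : ∀ z, st z = U (star z) := fun _ => rfl
    simp only [AddMonoidHom.comp_apply, LinearMap.toAddMonoidHom_coe, LinearMap.comp_apply, e1, e2,
      e3, e4]
    change vhStar S R (vhHor S R y * vhInv S R (proj R c)) = _
    rw [vhStar_hor_mul_inv, star_mul_one_tmul, star_smul, map_smul,
      invStar_proj]
    generalize star (S.F y) = t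
    induction t with
    | zero => simp
    | add u v hu hv =>
      simp only [map_add, mul_add, hu, hv, smul_add]
      abel
    | tmul u v =>
      simp [U, invAct_proj, HopfStar.counit_star, counit_antipode, mul_sub]
  rw [h1, HorizontalForms.contr_counit, HorizontalForms.contr_antipode, mul_one]
  change U (star (S.F φ)) - U (star (φ ⊗ₜ 1)) = U (S.F (star φ))
  rw [S.F_star]
  simp [U, proj_one]

end Involution

/-! ### Convolution identities, the differential of Ψ_inv^∧, and the vertical part of ∂_D. -/

section Vertical

variable {A : Type*} [Ring A] [HopfAlgebra ℂ A]

section Conv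

variable {X : Type*} [Ring X] [Algebra ℂ X]

theorem conv_add_left (f g k : A →ₗ[ℂ] X) : conv (f + g) k = conv f k + conv g k := by
  simp only [conv, TensorProduct.map_add_left, LinearMap.add_comp, LinearMap.comp_add]

theorem conv_add_right (f g k : A →ₗ[ℂ] X) : conv f (g + k) = conv f g + conv f k := by
  simp only [conv, TensorProduct.map_add_right, LinearMap.add_comp, LinearMap.comp_add]

theorem conv_smul_left (r : ℂ) (f g : A →ₗ[ℂ] X) : conv (r • f) g = r • conv f g := by
  simp only [conv, TensorProduct.map_smul_left, LinearMap.smul_comp, LinearMap.comp_smul]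

theorem conv_smul_right (r : ℂ) (f g : A →ₗ[ℂ] X) : conv f (r • g) = r • conv f g := by
  simp only [conv, TensorProduct.map_smul_right, LinearMap.smul_comp, LinearMap.comp_smul]

theorem conv_neg_left (f g : A →ₗ[ℂ] X) : conv (-f) g = -conv f g := by
  rw [← neg_one_smul ℂ f, conv_smul_left]; exact neg_one_smul ℂ (conv f g)

theorem conv_neg_right (f g : A →ₗ[ℂ] X) : conv f (-g) = -conv f g := by
  rw [← neg_one_smul ℂ g, conv_smul_right]; exact neg_one_smul ℂ (conv f g)

theorem conv_sub_left (f g k : A →ₗ[ℂ] X) : conv (f - g) k = conv f k - conv g k := by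
  rw [sub_eq_add_neg, conv_add_left, conv_neg_left, sub_eq_add_neg]

theorem conv_sub_right (f g k : A →ₗ[ℂ] X) : conv f (g - k) = conv f g - conv f k := by
  rw [sub_eq_add_neg, conv_add_right, conv_neg_right, sub_eq_add_neg]

theorem conv_assoc (f g k : A →ₗ[ℂ] X) : conv (conv f g) k = conv f (conv g k) := by
  ext a
  have h1 : ∀ t : A ⊗[ℂ] A, LinearMap.mul' ℂ X (TensorProduct.map (conv f g) k t) =
      LinearMap.mul' ℂ X (TensorProduct.map f (LinearMap.mul' ℂ X ∘ₗ TensorProduct.map g k)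
        (TensorProduct.assoc ℂ A A A ((comul (R := ℂ) (A := A)).rTensor A t))) := by
    intro t
    induction t with
    | zero => simp
    | add u v hu hv => simp only [map_add, hu, hv]
    | tmul u v =>
      simp only [conv, TensorProduct.map_tmul, LinearMap.mul'_apply, LinearMap.comp_apply,
        LinearMap.rTensor_tmul]
      generalize comul (R := ℂ) u = s
      induction s with
      | zero => simp
      | add x y hx hy => simp only [map_add, add_mul, TensorProduct.add_tmul, hx, hy]
      | tmul x y => simp [mul_assoc]
  have h2 : ∀ t : A ⊗[ℂ] A, LinearMap.mul' ℂ X (TensorProduct.map f (conv g k) t) =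
      LinearMap.mul' ℂ X (TensorProduct.map f (LinearMap.mul' ℂ X ∘ₗ TensorProduct.map g k)
        ((comul (R := ℂ) (A := A)).lTensor A t)) := by
    intro t
    induction t with
    | zero => simp
    | add u v hu hv => simp only [map_add, hu, hv]
    | tmul u v => simp [conv]
  change LinearMap.mul' ℂ X (TensorProduct.map (conv f g) k (comul a)) =
    LinearMap.mul' ℂ X (TensorProduct.map f (conv g k) (comul a))
  rw [h1, h2, coassoc_apply]

end Conv

section EnvelopeDifferential

variable [StarRing A] (R : CalculusIdeal A)

theorem dInv_proj (a : A) : dInv R (proj R a) = -conv (envProj R) (envProj R) a := rfl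

theorem conv_envProj_mem (a : A) : conv (envProj R) (envProj R) a ∈ envDeg R 2 := by
  simp only [conv, LinearMap.comp_apply]
  generalize comul (R := ℂ) a = t
  induction t with
  | zero => simp
  | add u v hu hv => simp only [map_add]; exact Submodule.add_mem _ hu hv
  | tmul u v =>
    rw [TensorProduct.map_tmul, LinearMap.mul'_apply]
    rw [envDeg, pow_two]
    exact Submodule.mul_mem_mul ⟨proj R u, rfl⟩ ⟨proj R v, rfl⟩

theorem dInv_mem (θ : InvForms R) : dInv R θ ∈ envDeg R 2 := by
  obtain ⟨a, rfl⟩ := proj_surjective R θ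
  rw [dInv_proj]
  exact Submodule.neg_mem _ (conv_envProj_mem R a)

/-- `d(ϑ ∘ c) = d(ϑ) ∘ c - (ϑ ∘ c⁽¹⁾) π(c⁽²⁾) - π(c⁽¹⁾) (ϑ ∘ c⁽²⁾)`. -/
theorem dInv_invAct (θ : InvForms R) : dInv R ∘ₗ invAct R θ = envAct R (dInv R θ) -
    conv (incl R ∘ₗ invAct R θ) (envProj R) - conv (envProj R) (incl R ∘ₗ invAct R θ) := by
  obtain ⟨b, rfl⟩ := proj_surjective R θ
  have hJ : ∀ x : A, incl R ∘ₗ invAct R (proj R x) =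
      envProj R ∘ₗ LinearMap.mulLeft ℂ x - counit (R := ℂ) x • envProj R := by
    intro x
    ext c
    simp [invAct_proj, envProj]
  have h1 : ∀ c, envAct R (conv (envProj R) (envProj R) b) c =
      conv (envProj R) (envProj R) (b * c) -
      conv (envProj R) (envProj R ∘ₗ LinearMap.mulLeft ℂ b) c -
      conv (envProj R ∘ₗ LinearMap.mulLeft ℂ b) (envProj R) c +
      counit (R := ℂ) b • conv (envProj R) (envProj R) c := by
    intro c
    -- For a general tensor t in place of φ(b), expanding (π(x)∘c⁽¹⁾)(π(y)∘c⁽²⁾) gives four terms.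
    -- At t = φ(b) the counit axioms collapse the terms containing ε.
    have h2 : ∀ t : A ⊗[ℂ] A, envAct R (LinearMap.mul' ℂ _
        (TensorProduct.map (envProj R) (envProj R) t)) c =
        LinearMap.mul' ℂ _ (TensorProduct.map (envProj R) (envProj R) (t * comul c)) -
        conv (envProj R) (envProj R ∘ₗ LinearMap.mulLeft ℂ
          (TensorProduct.lid ℂ A ((counit (R := ℂ) (A := A)).rTensor A t))) c -
        conv (envProj R ∘ₗ LinearMap.mulLeft ℂ
          (TensorProduct.rid ℂ A ((counit (R := ℂ) (A := A)).lTensor A t))) (envProj R) c +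
        counit (R := ℂ) (TensorProduct.lid ℂ A ((counit (R := ℂ) (A := A)).rTensor A t)) •
          conv (envProj R) (envProj R) c := by
      intro t
      induction t with
      | zero => simp [conv]
      | add u v hu hv =>
        have e : ∀ x y : A, envProj R ∘ₗ LinearMap.mulLeft ℂ (x + y) =
            envProj R ∘ₗ LinearMap.mulLeft ℂ x + envProj R ∘ₗ LinearMap.mulLeft ℂ y := by
          intro x y; ext; simp [add_mul]
        simp only [map_add, add_mul, LinearMap.add_apply, hu, hv, e, conv_add_left,
          conv_add_right, add_smul]
        abel
      | tmul x y =>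
        have e : ∀ (r : ℂ) (x : A), envProj R ∘ₗ LinearMap.mulLeft ℂ (r • x) =
            r • (envProj R ∘ₗ LinearMap.mulLeft ℂ x) := by
          intro r x; ext; simp
        have e2 : LinearMap.mul' ℂ _ (TensorProduct.map (envProj R) (envProj R)
            ((x ⊗ₜ y) * comul c)) = conv (envProj R ∘ₗ LinearMap.mulLeft ℂ x)
              (envProj R ∘ₗ LinearMap.mulLeft ℂ y) c := by
          simp only [conv, LinearMap.comp_apply]
          generalize comul (R := ℂ) c = t
          induction t with
          | zero => simp
          | add u v hu hv => simp only [mul_add, map_add, hu, hv]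
          | tmul u v => simp
        have e3 : envAct R (envProj R x * envProj R y) c =
            conv (incl R ∘ₗ invAct R (proj R x)) (incl R ∘ₗ invAct R (proj R y)) c := by
          rw [envAct_mul]
          have e4 : ∀ x, envAct R (envProj R x) = incl R ∘ₗ invAct R (proj R x) := by
            intro x; ext c; exact envAct_incl R _ _
          rw [e4, e4]
          rfl
        rw [e2, TensorProduct.map_tmul, LinearMap.mul'_apply, e3, hJ, hJ]
        simp only [conv_sub_left, conv_sub_right, conv_smul_left, conv_smul_right,
          LinearMap.rTensor_tmul, LinearMap.lTensor_tmul, TensorProduct.lid_tmul,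
          TensorProduct.rid_tmul, e, LinearMap.sub_apply, LinearMap.smul_apply, map_smul,
          smul_eq_mul, mul_smul, smul_sub]
        rw [smul_comm (counit (R := ℂ) y)]
        abel
    have h3 := h2 (comul b)
    rw [rTensor_counit_comul, lTensor_counit_comul, TensorProduct.lid_tmul,
      TensorProduct.rid_tmul, one_smul, ← Bialgebra.comul_mul] at h3
    exact h3
  ext c
  simp only [LinearMap.sub_apply, LinearMap.comp_apply, invAct_proj, map_sub, map_smul, dInv_proj,
    map_neg, LinearMap.neg_apply, h1]
  have h4 := hJ b
  simp only [h4, conv_sub_left, conv_sub_right, conv_smul_left, conv_smul_right,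
    LinearMap.sub_apply, LinearMap.smul_apply, smul_neg]
  abel

/-- The map a ↦ κ(a)^* reverses the coproduct, as the involution reverses a product of one-forms;
the sign from the grading matches that in π(a)^* = -π(κ(a)^*). -/
theorem envStar_dInv [StarModule ℂ A] [HopfStar A] (θ : InvForms R) :
    envStar R (dInv R θ) = dInv R (invStar R θ) := by
  obtain ⟨a, rfl⟩ := proj_surjective R θ
  rw [invStar_proj, map_neg, dInv_proj, dInv_proj, neg_neg, ← quad_eq_conv,
    quad_star_antipode, quad_apply, map_neg, map_sum, ← Finset.sum_neg_distrib]
  refine Finset.sum_congr rfl fun i _ => ?_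
  simp only [envProj, LinearMap.comp_apply]
  rw [envStar_incl_mul, envStar_incl, envParity_incl, invStar_proj, invStar_proj]
  simp

end EnvelopeDifferential

variable [StarRing A] [StarModule ℂ A]
variable {H : Type*} [Ring H] [Algebra ℂ H] [StarAddMonoid H] [StarModule ℂ H]
variable {𝓗 : ℕ → Submodule ℂ H} [GradedAlgebra 𝓗]

section General

variable (S : HorizontalForms A 𝓗) (R : CalculusIdeal A)

theorem HorizontalForms.contr_mulRight {X : Type*} [Ring X] [Algebra ℂ X] (f : H →ₗ[ℂ] X)
    (g : A →ₗ[ℂ] X) (x : X) (φ : H) :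
    S.contr f (LinearMap.mulRight ℂ x ∘ₗ g) φ = S.contr f g φ * x := by
  rw [contr_apply, contr_apply]
  generalize S.F φ = t
  induction t with
  | zero => simp
  | add u v hu hv => simp only [map_add, add_mul, hu, hv]
  | tmul u v => simp [mul_assoc]

/-- From π(cd) = π(c)∘d + ε(c)π(d): the first term is π(c) moved past ψ, and the second leaves φ in
front of V(ψ). It is the Leibniz rule for (-1)^{∂φ}V(φ). -/
theorem vertical_mul (φ : H) {m : ℕ} {ψ : H} (hψ : ψ ∈ 𝓗 m) :
    vertical S R (φ * ψ) = (-1 : ℂ) ^ m • (vertical S R φ * vhHor S R ψ) +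
      vhHor S R φ * vertical S R ψ := by
  have h1 : S.contrShift (vhHor S R).toLinearMap (vhInv S R ∘ₗ proj R) ψ =
      (-1 : ℂ) ^ m • (LinearMap.mulRight ℂ (vhHor S R ψ) ∘ₗ (vhInv S R ∘ₗ proj R)) +
      (counit (R := ℂ) (A := A)).smulRight (vertical S R ψ) := by
    ext a
    have h2 : (vhInv S R ∘ₗ proj R) ∘ₗ LinearMap.mulLeft ℂ a =
        vhInv S R ∘ₗ invAct R (proj R a) + counit (R := ℂ) a • (vhInv S R ∘ₗ proj R) := by
      ext c
      simp [invAct_proj]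
    rw [HorizontalForms.contrShift_apply, h2, HorizontalForms.contr_add,
      HorizontalForms.contr_smul]
    simp only [LinearMap.add_apply, LinearMap.smul_apply, LinearMap.comp_apply,
      LinearMap.mulRight_apply, LinearMap.smulRight_apply, vhInv_mul_vhHor S R _ hψ, smul_smul,
      ← mul_pow]
    simp [vertical]
  rw [vertical, HorizontalForms.contr_mul, h1, HorizontalForms.contr_add,
    HorizontalForms.contr_smul, HorizontalForms.contr_mulRight, HorizontalForms.contr_counit]
  rfl

theorem vertical_comp_of_covariant {T : H →ₗ[ℂ] H} (hT : ∀ φ, S.F (T φ) = T.rTensor A (S.F φ))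
    (φ : H) : S.contr ((vhHor S R).toLinearMap ∘ₗ T) (vhInv S R ∘ₗ proj R) φ =
      vertical S R (T φ) :=
  (S.contr_comp_of_covariant hT _ _ φ).symm

theorem contr_vertical (g : A →ₗ[ℂ] VH S R) (φ : H) : S.contr (vertical S R) g φ =
    S.contr (vhHor S R).toLinearMap (conv (vhInv S R ∘ₗ proj R) g) φ :=
  S.contr_contr _ _ _ _

theorem hor_contr (χ : A →ₗ[ℂ] H) (φ : H) :
    S.contr (vhHor S R).toLinearMap ((vhHor S R).toLinearMap ∘ₗ χ) φ =
      vhHor S R (S.contr LinearMap.id χ φ) := by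
  rw [HorizontalForms.contr_apply, HorizontalForms.contr_apply]
  generalize S.F φ = t
  induction t with
  | zero => simp
  | add u v hu hv => simp only [map_add, hu, hv]
  | tmul u v => simp

theorem vertical_mem {n : ℕ} {φ : H} (hφ : φ ∈ 𝓗 n) : vertical S R φ ∈ vhDeg S R (n + 1) :=
  S.contr_mem hφ fun _ hy c => vh_mul_mem S R (vhHor_mem S R hy) (vhInv_mem S R (proj R c))

theorem vhEnv_comp_envProj : (vhEnv S R).toLinearMap ∘ₗ envProj R = vhInv S R ∘ₗ proj R := rfl

theorem vhEnv_dInv_proj (a : A) : vhEnv S R (dInv R (proj R a)) =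
    -conv (vhInv S R ∘ₗ proj R) (vhInv S R ∘ₗ proj R) a := by
  rw [dInv_proj, map_neg, map_conv]
  rfl

variable {S R}

/-- `χ(a⁽¹⁾) π(a⁽²⁾) + π(a⁽¹⁾) χ(a⁽²⁾) = ∑ χ(a)_k π(c_k)`. -/
theorem HorizontalForms.IsChiNat.conv_proj {E : H →ₗ[ℂ] H} {χ : A →ₗ[ℂ] H} (h : S.IsChiNat E χ)
    (hE : S.IsAntiderivation E) :
    conv ((vhHor S R).toLinearMap ∘ₗ χ) (vhInv S R ∘ₗ proj R) +
      conv (vhInv S R ∘ₗ proj R) ((vhHor S R).toLinearMap ∘ₗ χ) = vertical S R ∘ₗ χ := by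
  refine S.eq_of_contr_eq (vhHor S R) fun b hb => ?_
  -- V is applied to Σ b_k χ(c_k) = -E(b) and expanded by its Leibniz rule. Covariance of E
  -- identifies -V(E(b)) with the contraction of χ*π in `h3`.
  have h1 : vertical S R (S.contr LinearMap.id χ b) =
      S.contr (vertical S R) (-((vhHor S R).toLinearMap ∘ₗ χ)) b +
      S.contr (vhHor S R).toLinearMap (vertical S R ∘ₗ χ) b :=
    map_contr_add S hb (vertical S R) fun y _ c => by
      simp [vertical_mul S R y (h.mem hE c)]
  have h3 : S.contr (S.contr (vhHor S R).toLinearMap ((vhHor S R).toLinearMap ∘ₗ χ))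
      (vhInv S R ∘ₗ proj R) b =
      S.contr ((vhHor S R).toLinearMap ∘ₗ E) (-(vhInv S R ∘ₗ proj R)) b :=
    S.contr_congr hb fun y hy c => by rw [hor_contr, h.apply_base hy]; simp
  rw [S.contr_neg (vertical S R) ((vhHor S R).toLinearMap ∘ₗ χ), contr_vertical, h.apply_base hb,
    map_neg] at h1
  rw [S.contr_contr (vhHor S R).toLinearMap ((vhHor S R).toLinearMap ∘ₗ χ)
      (vhInv S R ∘ₗ proj R),
    S.contr_neg ((vhHor S R).toLinearMap ∘ₗ E) (vhInv S R ∘ₗ proj R),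
    vertical_comp_of_covariant S R hE.covariant] at h3
  rw [S.contr_add (vhHor S R).toLinearMap, h3, h1]
  abel

/-- `ρ(a⁽¹⁾) π(a⁽²⁾) - π(a⁽¹⁾) ρ(a⁽²⁾) = ∑ ρ(a)_k π(c_k)`. -/
theorem HorizontalForms.IsRhoNat.conv_proj {D : H →ₗ[ℂ] H} {ρ : A →ₗ[ℂ] H} (h : S.IsRhoNat D ρ)
    (hD : S.IsAntiderivation D) :
    conv ((vhHor S R).toLinearMap ∘ₗ ρ) (vhInv S R ∘ₗ proj R) -
      conv (vhInv S R ∘ₗ proj R) ((vhHor S R).toLinearMap ∘ₗ ρ) = vertical S R ∘ₗ ρ := by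
  refine S.eq_of_contr_eq (vhHor S R) fun b hb => ?_
  -- The same comparison with D² in place of E, covariance being used for each D. The even degree of
  -- ρ changes the relative sign.
  have h1 : vertical S R (S.contr LinearMap.id ρ b) =
      S.contr (vertical S R) ((vhHor S R).toLinearMap ∘ₗ ρ) b +
      S.contr (vhHor S R).toLinearMap (vertical S R ∘ₗ ρ) b :=
    map_contr_add S hb (vertical S R) fun y _ c => by
      simp [vertical_mul S R y (h.mem hD c)]
  have h3 : S.contr (S.contr (vhHor S R).toLinearMap ((vhHor S R).toLinearMap ∘ₗ ρ))
      (vhInv S R ∘ₗ proj R) b =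
      S.contr (((vhHor S R).toLinearMap ∘ₗ D) ∘ₗ D) (-(vhInv S R ∘ₗ proj R)) b :=
    S.contr_congr hb fun y hy c => by rw [hor_contr, h.apply]; simp
  rw [contr_vertical, h.apply, map_neg] at h1
  rw [S.contr_contr (vhHor S R).toLinearMap ((vhHor S R).toLinearMap ∘ₗ ρ)
      (vhInv S R ∘ₗ proj R),
    S.contr_neg (((vhHor S R).toLinearMap ∘ₗ D) ∘ₗ D) (vhInv S R ∘ₗ proj R),
    ← S.contr_comp_of_covariant hD.covariant, vertical_comp_of_covariant S R hD.covariant] at h3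
  rw [S.contr_sub (vhHor S R).toLinearMap, h3, h1]
  abel

end General

end Vertical

/-! ### Graded derivations as homomorphisms into triangular matrices. -/

section DerivationExtension

variable {A : Type*} [Ring A] [HopfAlgebra ℂ A] [StarRing A] [StarModule ℂ A]
variable {H : Type*} [Ring H] [Algebra ℂ H] [StarAddMonoid H] [StarModule ℂ H]
variable {𝓗 : ℕ → Submodule ℂ H} [GradedAlgebra 𝓗]

variable (𝓗) in
/-- The grading involution, equal to `(-1)^n` in degree `n`, as a linear map. -/
def horParityLin : H →ₗ[ℂ] H :=
  DirectSum.toModule ℂ ℕ _ (fun n => (-1 : ℂ) ^ n • (𝓗 n).subtype) ∘ₗ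
    (DirectSum.decomposeLinearEquiv 𝓗).toLinearMap

theorem horParityLin_of_mem {n : ℕ} {φ : H} (hφ : φ ∈ 𝓗 n) :
    horParityLin 𝓗 φ = (-1 : ℂ) ^ n • φ := by
  lift φ to 𝓗 n using hφ
  rw [horParityLin, LinearMap.comp_apply, LinearEquiv.coe_coe, DirectSum.decomposeLinearEquiv_apply,
    DirectSum.decompose_coe, ← DirectSum.lof_eq_of ℂ, DirectSum.toModule_lof]
  simp

theorem horParityLin_mul (φ ψ : H) :
    horParityLin 𝓗 (φ * ψ) = horParityLin 𝓗 φ * horParityLin 𝓗 ψ := by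
  have h1 : ∀ m, ∀ φ ∈ 𝓗 m, horParityLin 𝓗 ∘ₗ LinearMap.mulLeft ℂ φ =
      LinearMap.mulLeft ℂ (horParityLin 𝓗 φ) ∘ₗ horParityLin 𝓗 := fun m φ hφ =>
    HorizontalForms.ext_homogeneous (𝓗 := 𝓗) fun n ψ hψ => by
      simp only [LinearMap.comp_apply, LinearMap.mulLeft_apply,
        horParityLin_of_mem (SetLike.GradedMul.mul_mem hφ hψ), horParityLin_of_mem hφ,
        horParityLin_of_mem hψ, smul_mul_smul_comm, pow_add]
  have h2 : horParityLin 𝓗 ∘ₗ LinearMap.mulRight ℂ ψ =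
      LinearMap.mulRight ℂ (horParityLin 𝓗 ψ) ∘ₗ horParityLin 𝓗 :=
    HorizontalForms.ext_homogeneous (𝓗 := 𝓗) fun m φ hφ => LinearMap.congr_fun (h1 m φ hφ) ψ
  exact LinearMap.congr_fun h2 φ

variable (𝓗) in
/-- The grading involution of the horizontal forms. -/
def horParity : H →ₐ[ℂ] H :=
  AlgHom.ofLinearMap (horParityLin 𝓗)
    (by rw [horParityLin_of_mem (HorizontalForms.one_mem_zero (𝓗 := 𝓗))]; simp)
    horParityLin_mul

theorem horParity_of_mem {n : ℕ} {φ : H} (hφ : φ ∈ 𝓗 n) :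
    horParity 𝓗 φ = (-1 : ℂ) ^ n • φ := horParityLin_of_mem hφ

variable (S : HorizontalForms A 𝓗) (R : CalculusIdeal A)

/-- Upper triangular matrices over `X`, as images of linear maps. -/
def upperTri {X M : Type*} [Ring X] [Algebra ℂ X] [AddCommGroup M] [Module ℂ M]
    (a b c : M →ₗ[ℂ] X) : M →ₗ[ℂ] Matrix (Fin 2) (Fin 2) X where
  toFun x := !![a x, b x; 0, c x]
  map_add' x y := by ext i j; fin_cases i <;> fin_cases j <;> simp
  map_smul' r x := by ext i j; fin_cases i <;> fin_cases j <;> simp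

theorem upperTri_apply {X M : Type*} [Ring X] [Algebra ℂ X] [AddCommGroup M] [Module ℂ M]
    (a b c : M →ₗ[ℂ] X) (x : M) : upperTri a b c x = !![a x, b x; 0, c x] := rfl

theorem upperTri_comp {X M N : Type*} [Ring X] [Algebra ℂ X] [AddCommGroup M] [Module ℂ M]
    [AddCommGroup N] [Module ℂ N] (a b c : M →ₗ[ℂ] X) (g : N →ₗ[ℂ] M) :
    upperTri a b c ∘ₗ g = upperTri (a ∘ₗ g) (b ∘ₗ g) (c ∘ₗ g) := rfl

theorem conv_upperTri {X : Type*} [Ring X] [Algebra ℂ X] (a b c a' b' c' : A →ₗ[ℂ] X) :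
    conv (upperTri a b c) (upperTri a' b' c') =
      upperTri (conv a a') (conv a b' + conv b c') (conv c c') := by
  ext x : 1
  simp only [conv, upperTri_apply, LinearMap.comp_apply, LinearMap.add_apply]
  generalize comul (R := ℂ) x = t
  induction t with
  | zero => ext i j; fin_cases i <;> fin_cases j <;> simp
  | add u v hu hv =>
    rw [map_add, map_add, hu, hv]
    ext i j; fin_cases i <;> fin_cases j <;> simp; abel
  | tmul u v =>
    ext i j; fin_cases i <;> fin_cases j <;>
      simp [upperTri_apply, Matrix.mul_apply, Fin.sum_univ_two]

theorem HorizontalForms.contr_upperTri {X : Type*} [Ring X] [Algebra ℂ X] (a b c : H →ₗ[ℂ] X)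
    (a' b' c' : A →ₗ[ℂ] X) (φ : H) :
    S.contr (upperTri a b c) (upperTri a' b' c') φ =
      !![S.contr a a' φ, S.contr a b' φ + S.contr b c' φ; 0, S.contr c c' φ] := by
  simp only [contr_apply]
  generalize S.F φ = t
  induction t with
  | zero => ext i j; fin_cases i <;> fin_cases j <;> simp
  | add u v hu hv =>
    rw [map_add, map_add, hu, hv]
    ext i j; fin_cases i <;> fin_cases j <;> simp; abel
  | tmul u v =>
    ext i j; fin_cases i <;> fin_cases j <;>
      simp [upperTri_apply, Matrix.mul_apply, Fin.sum_univ_two]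

variable {S R}

/-- The exchange relation for the matrix-valued generators: the diagonal entries are the relation in
vh_P up to parity, and the corner is the compatibility hypothesis between δ and γ. -/
theorem upperTri_mul_upperTri {δ : H →ₗ[ℂ] VH S R} {γ : InvForms R →ₗ[ℂ] VH S R} {n : ℕ} {φ : H}
    (hφ : φ ∈ 𝓗 n) {θ : InvForms R} (hδγ : γ θ * vhHor S R φ - vhInv S R θ * δ φ =
      (-1 : ℂ) ^ n • S.contr δ (vhInv S R ∘ₗ invAct R θ) φ +
        S.contr (vhHor S R).toLinearMap (γ ∘ₗ invAct R θ) φ) :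
    upperTri (-vhInv S R) γ (vhInv S R) θ * upperTri ((vhHor S R).toLinearMap ∘ₗ
      (horParity 𝓗).toLinearMap) δ (vhHor S R).toLinearMap φ =
    (-1 : ℂ) ^ n • S.contr (upperTri ((vhHor S R).toLinearMap ∘ₗ
      (horParity 𝓗).toLinearMap) δ (vhHor S R).toLinearMap)
        (upperTri (-vhInv S R) γ (vhInv S R) ∘ₗ invAct R θ) φ := by
  have e2 : ∀ k : A →ₗ[ℂ] VH S R,
      S.contr ((vhHor S R).toLinearMap ∘ₗ (horParity 𝓗).toLinearMap) k φ =
        (-1 : ℂ) ^ n • S.contr (vhHor S R).toLinearMap k φ := fun k => by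
    rw [← S.contr_smul]
    exact S.contr_congr hφ fun y hy c => by simp [horParity_of_mem hy]
  rw [upperTri_comp, S.contr_upperTri, e2, e2, LinearMap.neg_comp,
    S.contr_neg (vhHor S R).toLinearMap, upperTri_apply, upperTri_apply, Matrix.mul_fin_two]
  have e3 : (-vhInv S R) θ * ((vhHor S R).toLinearMap ∘ₗ (horParity 𝓗).toLinearMap) φ =
      -S.contr (vhHor S R).toLinearMap (vhInv S R ∘ₗ invAct R θ) φ := by
    simp [horParity_of_mem hφ, vhInv_mul_vhHor S R θ hφ, smul_smul, ← mul_pow]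
  have e4 : (-vhInv S R) θ * δ φ + γ θ * vhHor S R φ =
      (-1 : ℂ) ^ n • ((-1 : ℂ) ^ n • S.contr (vhHor S R).toLinearMap (γ ∘ₗ invAct R θ) φ +
        S.contr δ (vhInv S R ∘ₗ invAct R θ) φ) := by
    rw [smul_add, smul_smul, ← mul_pow, neg_one_mul, neg_neg, one_pow, one_smul, add_comm _ (_ • _),
      ← hδγ, LinearMap.neg_apply, neg_mul]
    abel
  ext i j
  fin_cases i <;> fin_cases j
  · refine Eq.trans (congrArg₂ (· + ·) e3 (mul_zero _)) ?_
    simp [smul_smul, ← mul_pow]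
  · exact e4
  · simp
  · simp [vhInv_mul_vhHor S R θ hφ]

/-- Extension of a graded derivation from the generators of `vh_P`. -/
theorem exists_vhDerivation {δ : H →ₗ[ℂ] VH S R} {γ : InvForms R →ₗ[ℂ] VH S R}
    (hδ : ∀ m, ∀ φ ∈ 𝓗 m, ∀ ψ, δ (φ * ψ) =
      δ φ * vhHor S R ψ + (-1 : ℂ) ^ m • (vhHor S R φ * δ ψ))
    (hγ : ∀ a ∈ R.carrier, conv (γ ∘ₗ proj R) (vhInv S R ∘ₗ proj R) a =
      conv (vhInv S R ∘ₗ proj R) (γ ∘ₗ proj R) a)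
    (hδγ : ∀ n, ∀ φ ∈ 𝓗 n, ∀ θ, γ θ * vhHor S R φ - vhInv S R θ * δ φ =
      (-1 : ℂ) ^ n • S.contr δ (vhInv S R ∘ₗ invAct R θ) φ +
        S.contr (vhHor S R).toLinearMap (γ ∘ₗ invAct R θ) φ) :
    ∃ d : VH S R →ₗ[ℂ] VH S R,
      (∀ n, ∀ x ∈ vhDeg S R n, ∀ y, d (x * y) = d x * y + (-1 : ℂ) ^ n • (x * d y)) ∧
      (∀ φ, d (vhHor S R φ) = δ φ) ∧ ∀ θ, d (vhInv S R θ) = γ θ := by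
  -- Replacing the sign by the parity automorphism makes the Leibniz rule meaningful for
  -- inhomogeneous φ, as an algebra homomorphism requires.
  have hmul : ∀ φ ψ, δ (φ * ψ) = δ φ * vhHor S R ψ + vhHor S R (horParity 𝓗 φ) * δ ψ := by
    intro φ ψ
    have : δ ∘ₗ LinearMap.mulRight ℂ ψ = LinearMap.mulRight ℂ (vhHor S R ψ) ∘ₗ δ +
        LinearMap.mulRight ℂ (δ ψ) ∘ₗ (vhHor S R).toLinearMap ∘ₗ (horParity 𝓗).toLinearMap :=
      HorizontalForms.ext_homogeneous (𝓗 := 𝓗) fun m φ hφ => by simp [hδ m φ hφ, horParity_of_mem hφ]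
    exact LinearMap.congr_fun this φ
  have hone : δ 1 = 0 := by simpa using hmul 1 1
  -- Multiplicativity of x ↦ [[(-1)^{∂x} x, dx], [0, x]] in its corner is exactly the graded Leibniz
  -- rule.
  let f : H →ₐ[ℂ] Matrix (Fin 2) (Fin 2) (VH S R) := AlgHom.ofLinearMap
    (upperTri ((vhHor S R).toLinearMap ∘ₗ (horParity 𝓗).toLinearMap) δ (vhHor S R).toLinearMap)
    (by
      rw [upperTri_apply]
      ext i j; fin_cases i <;> fin_cases j <;> simp [hone])
    (fun φ ψ => by
      rw [upperTri_apply, upperTri_apply, upperTri_apply]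
      ext i j; fin_cases i <;> fin_cases j <;>
        simp [Matrix.mul_apply, Fin.sum_univ_two, hmul, add_comm])
  let g : InvForms R →ₗ[ℂ] Matrix (Fin 2) (Fin 2) (VH S R) := upperTri (-vhInv S R) γ (vhInv S R)
  have hq : ∀ a ∈ R.carrier, conv (vhInv S R ∘ₗ proj R) (vhInv S R ∘ₗ proj R) a = 0 := by
    intro a ha
    have := congrArg (vhEnv S R) (quad_envProj ha)
    rwa [quad_eq_conv, map_conv, map_zero, vhEnv_comp_envProj] at this
  -- On the diagonal these are the relations of vh_P, with cancelling signs; the corner is the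
  -- hypothesis on γ.
  have hg : ∀ a ∈ R.carrier, quad (g.comp (proj R)) a = 0 := by
    intro a ha
    rw [quad_eq_conv, upperTri_comp, conv_upperTri, upperTri_apply, LinearMap.neg_comp,
      conv_neg_left, conv_neg_left, conv_neg_right, neg_neg, hq a ha, LinearMap.add_apply,
      LinearMap.neg_apply, hγ a ha]
    ext i j; fin_cases i <;> fin_cases j <;> simp
  have hfg : ∀ n, ∀ φ ∈ 𝓗 n, ∀ θ, g θ * f φ =
      (-1 : ℂ) ^ n • S.contr f.toLinearMap (g ∘ₗ invAct R θ) φ :=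
    fun n φ hφ θ => upperTri_mul_upperTri hφ (hδγ n φ hφ θ)
  let Φ := vhLift S f g hg hfg
  have hΦh : ∀ φ, Φ (vhHor S R φ) = !![vhHor S R (horParity 𝓗 φ), δ φ; 0, vhHor S R φ] :=
    fun φ => vhLift_hor f g hg hfg φ
  have hΦi : ∀ θ, Φ (vhInv S R θ) = !![-vhInv S R θ, γ θ; 0, vhInv S R θ] :=
    fun θ => vhLift_inv f g hg hfg θ
  have hdiag : ∀ {n : ℕ} {x : VH S R}, x ∈ vhDeg S R n →
      Φ x 0 0 = (-1 : ℂ) ^ n • x ∧ Φ x 1 0 = 0 ∧ Φ x 1 1 = x := by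
    intro n x hx
    refine vhDeg_induction (C := fun n x => Φ x 0 0 = (-1 : ℂ) ^ n • x ∧ Φ x 1 0 = 0 ∧ Φ x 1 1 = x)
      ?_ ?_ ?_ ?_ ?_ hx
    · simp
    · rintro n x y - - ⟨h1, h2, h3⟩ ⟨h4, h5, h6⟩
      simp [h1, h2, h3, h4, h5, h6]
    · intro n φ hφ
      rw [hΦh]
      simp [horParity_of_mem hφ]
    · intro θ
      rw [hΦi]
      simp
    · rintro m n x y - - ⟨h1, h2, h3⟩ ⟨h4, h5, h6⟩
      rw [map_mul, Matrix.mul_apply, Matrix.mul_apply, Matrix.mul_apply, Fin.sum_univ_two,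
        Fin.sum_univ_two, Fin.sum_univ_two, h1, h2, h3, h4, h5, h6, smul_mul_smul_comm, pow_add]
      simp only [mul_zero, zero_mul, add_zero, zero_add, and_self]
  have h11 : ∀ x, Φ x 1 1 = x := by
    intro x
    induction x using vh_homogeneous_induction with
    | zero => simp
    | add x y hx hy => simp [hx, hy]
    | homogeneous n x hx => exact (hdiag hx).2.2
  refine ⟨Matrix.entryLinearMap ℂ (VH S R) 0 1 ∘ₗ Φ.toLinearMap, ?_, ?_, ?_⟩
  · intro n x hx y
    change Φ (x * y) 0 1 = Φ x 0 1 * y + (-1 : ℂ) ^ n • (x * Φ y 0 1)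
    rw [map_mul, Matrix.mul_apply, Fin.sum_univ_two, (hdiag hx).1, h11, smul_mul_assoc, add_comm]
  · intro φ
    simp [hΦh]
  · intro θ
    simp [hΦi]

end DerivationExtension

/-! ### The differential ∂_D. -/

section Differential

variable {A : Type*} [Ring A] [HopfAlgebra ℂ A] [StarRing A] [StarModule ℂ A]
variable {H : Type*} [Ring H] [Algebra ℂ H] [StarAddMonoid H] [StarModule ℂ H]
variable {𝓗 : ℕ → Submodule ℂ H} [GradedAlgebra 𝓗] {S : HorizontalForms A 𝓗}

namespace HorizontalForms

theorem contr_add_left {X : Type*} [Ring X] [Algebra ℂ X] (f f' : H →ₗ[ℂ] X) (g : A →ₗ[ℂ] X)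
    (φ : H) : S.contr (f + f') g φ = S.contr f g φ + S.contr f' g φ := by
  simp only [contr_apply, TensorProduct.map_add_left, LinearMap.add_apply, map_add]

theorem contr_smul_left {X : Type*} [Ring X] [Algebra ℂ X] (r : ℂ) (f : H →ₗ[ℂ] X)
    (g : A →ₗ[ℂ] X) (φ : H) : S.contr (r • f) g φ = r • S.contr f g φ := by
  simp only [contr_apply, TensorProduct.map_smul_left, LinearMap.smul_apply, map_smul]

variable [CompactMatrixQuantumGroup A] (D : S.preconnections)

/-- The values `D(φ) + (-1)^{∂φ} ∑ φ_k π(c_k)` of `∂_D` on the horizontal forms. -/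
def diffHor : H →ₗ[ℂ] S.Vh :=
  (vhHor S S.idealHat).toLinearMap ∘ₗ D.1 + vertical S S.idealHat ∘ₗ (horParity 𝓗).toLinearMap

/-- The values `ϱ_D(ϑ) + d(ϑ)` of `∂_D` on `Ψ_inv`. -/
def diffInv : InvForms S.idealHat →ₗ[ℂ] S.Vh :=
  (vhHor S S.idealHat).toLinearMap ∘ₗ S.curvature D +
    (vhEnv S S.idealHat).toLinearMap ∘ₗ dInv S.idealHat

theorem diffHor_of_mem {n : ℕ} {φ : H} (hφ : φ ∈ 𝓗 n) :
    diffHor D φ = vhHor S S.idealHat (D.1 φ) + (-1 : ℂ) ^ n • vertical S S.idealHat φ := by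
  simp [diffHor, horParity_of_mem hφ]

theorem diffInv_apply (θ : InvForms S.idealHat) :
    diffInv D θ = vhHor S S.idealHat (S.curvature D θ) +
      vhEnv S S.idealHat (dInv S.idealHat θ) := rfl

theorem diffHor_mul (m : ℕ) (φ : H) (hφ : φ ∈ 𝓗 m) (ψ : H) : diffHor D (φ * ψ) =
    diffHor D φ * vhHor S S.idealHat ψ + (-1 : ℂ) ^ m • (vhHor S S.idealHat φ * diffHor D ψ) := by
  have h : diffHor D ∘ₗ LinearMap.mulLeft ℂ φ =
      LinearMap.mulLeft ℂ (diffHor D φ) ∘ₗ (vhHor S S.idealHat).toLinearMap +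
      (-1 : ℂ) ^ m • (LinearMap.mulLeft ℂ (vhHor S S.idealHat φ) ∘ₗ diffHor D) :=
    HorizontalForms.ext_homogeneous (𝓗 := 𝓗) fun n ψ hψ => by
      have hm : φ * ψ ∈ 𝓗 (m + n) := SetLike.GradedMul.mul_mem hφ hψ
      simp only [LinearMap.comp_apply, LinearMap.add_apply, LinearMap.smul_apply,
        LinearMap.mulLeft_apply, AlgHom.toLinearMap_apply]
      rw [diffHor_of_mem D hm, diffHor_of_mem D hφ, diffHor_of_mem D hψ, D.2.1.leibniz m φ hφ,
        vertical_mul S S.idealHat φ hψ, map_add, map_smul, map_mul, map_mul]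
      have h1 : (-1 : ℂ) ^ (m + n) * (-1) ^ n = (-1) ^ m := by
        rw [pow_add, mul_assoc, ← mul_pow]; simp
      rw [smul_add, smul_smul, h1, add_mul, mul_add, smul_mul_assoc, mul_smul_comm, smul_add,
        smul_smul, ← pow_add]
      abel
  exact LinearMap.congr_fun h ψ

theorem diffInv_comp_proj : diffInv D ∘ₗ proj S.idealHat =
    (vhHor S S.idealHat).toLinearMap ∘ₗ S.rhoNat D -
      conv (vhInv S S.idealHat ∘ₗ proj S.idealHat) (vhInv S S.idealHat ∘ₗ proj S.idealHat) := by
  ext a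
  rw [LinearMap.comp_apply, diffInv_apply, vhEnv_dInv_proj, curvature_proj, sub_eq_add_neg]
  rfl

/-- The cubic terms π*π*π cancel, leaving V∘ϱ♮_D. This vanishes on R̂, so ∂_D respects the quadratic
relations; it also gives ∂_D² = 0 on Ψ_inv. -/
theorem conv_diffInv_sub : conv (diffInv D ∘ₗ proj S.idealHat)
      (vhInv S S.idealHat ∘ₗ proj S.idealHat) -
    conv (vhInv S S.idealHat ∘ₗ proj S.idealHat) (diffInv D ∘ₗ proj S.idealHat) =
      vertical S S.idealHat ∘ₗ S.rhoNat D := by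
  rw [← (isRhoNat_rhoNat D.2).conv_proj D.2.1, diffInv_comp_proj, conv_sub_left, conv_sub_right,
    conv_assoc]
  abel

/-- Compatibility of ∂_D with the exchange relation. Curvature terms match by `curvature_mul`; the
failure of d to commute with the action of A, computed in `dInv_invAct`, is compensated by the
vertical part of ∂_D on hor_P. -/
theorem diffInv_mul (n : ℕ) (φ : H) (hφ : φ ∈ 𝓗 n) (θ : InvForms S.idealHat) :
    diffInv D θ * vhHor S S.idealHat φ - vhInv S S.idealHat θ * diffHor D φ =
      (-1 : ℂ) ^ n • S.contr (diffHor D) (vhInv S S.idealHat ∘ₗ invAct S.idealHat θ) φ +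
        S.contr (vhHor S S.idealHat).toLinearMap (diffInv D ∘ₗ invAct S.idealHat θ) φ := by
  set J := vhInv S S.idealHat ∘ₗ invAct S.idealHat θ with hJ
  set P := vhInv S S.idealHat ∘ₗ proj S.idealHat with hP
  have hs : (-1 : ℂ) ^ n * (-1) ^ n = 1 := by rw [← mul_pow]; simp
  have h1 : vhHor S S.idealHat (S.curvature D θ) * vhHor S S.idealHat φ =
      S.contr (vhHor S S.idealHat).toLinearMap
        ((vhHor S S.idealHat).toLinearMap ∘ₗ S.curvature D ∘ₗ invAct S.idealHat θ) φ := by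
    rw [← map_mul, curvature_mul, hor_contr]
  have h2 : vhEnv S S.idealHat (dInv S.idealHat θ) * vhHor S S.idealHat φ =
      S.contr (vhHor S S.idealHat).toLinearMap
        ((vhEnv S S.idealHat).toLinearMap ∘ₗ dInv S.idealHat ∘ₗ invAct S.idealHat θ) φ +
      S.contr (vhHor S S.idealHat).toLinearMap (conv J P) φ +
      S.contr (vhHor S S.idealHat).toLinearMap (conv P J) φ := by
    have e : (vhEnv S S.idealHat).toLinearMap ∘ₗ envAct S.idealHat (dInv S.idealHat θ) =
        (vhEnv S S.idealHat).toLinearMap ∘ₗ dInv S.idealHat ∘ₗ invAct S.idealHat θ +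
          conv J P + conv P J := by
      rw [dInv_invAct]
      ext c
      simp only [LinearMap.comp_apply, LinearMap.add_apply, LinearMap.sub_apply, map_sub,
        AlgHom.toLinearMap_apply, map_conv]
      rw [vhEnv_comp_envProj]
      change _ = _ - conv J P c - conv P J c + conv J P c + conv P J c
      abel
    rw [vhEnv_mul_vhHor S S.idealHat (dInv_mem S.idealHat θ) hφ, e,
      S.contr_add (vhHor S S.idealHat).toLinearMap, S.contr_add (vhHor S S.idealHat).toLinearMap,
      pow_mul]
    simp
  have h3 : vhInv S S.idealHat θ * vhHor S S.idealHat (D.1 φ) =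
      -((-1 : ℂ) ^ n • S.contr ((vhHor S S.idealHat).toLinearMap ∘ₗ D.1) J φ) := by
    rw [vhInv_mul_vhHor S S.idealHat θ (D.2.1.map_mem n φ hφ),
      S.contr_comp_of_covariant D.2.1.covariant, pow_succ, mul_neg_one, neg_smul]
  have h4 : vhInv S S.idealHat θ * vertical S S.idealHat φ =
      (-1 : ℂ) ^ n • S.contr (vhHor S S.idealHat).toLinearMap (conv J P) φ := by
    rw [← S.contr_contr, ← contr_smul_left]
    refine S.map_contr hφ (LinearMap.mulLeft ℂ (vhInv S S.idealHat θ)) fun y hy c => ?_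
    simp only [LinearMap.mulLeft_apply, AlgHom.toLinearMap_apply, LinearMap.smul_apply]
    rw [← mul_assoc, vhInv_mul_vhHor S S.idealHat θ hy]
  have h5 : S.contr (diffHor D) J φ = S.contr ((vhHor S S.idealHat).toLinearMap ∘ₗ D.1) J φ +
      (-1 : ℂ) ^ n • S.contr (vhHor S S.idealHat).toLinearMap (conv P J) φ := by
    rw [← contr_vertical, diffHor, contr_add_left, ← S.contr_smul (vertical S S.idealHat)]
    congr 1
    exact S.contr_congr hφ fun y hy c => by simp [horParity_of_mem hy]
  have h6 : diffInv D ∘ₗ invAct S.idealHat θ =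
      (vhHor S S.idealHat).toLinearMap ∘ₗ S.curvature D ∘ₗ invAct S.idealHat θ +
        (vhEnv S S.idealHat).toLinearMap ∘ₗ dInv S.idealHat ∘ₗ invAct S.idealHat θ := rfl
  rw [diffInv_apply, diffHor_of_mem D hφ, add_mul, mul_add, mul_smul_comm, h1, h2, h3, h4, h5, h6,
    S.contr_add (vhHor S S.idealHat).toLinearMap, smul_add, smul_smul, smul_smul, hs, one_smul,
    one_smul]
  abel

/-- The differential `∂_D` exists. -/
theorem exists_differential : ∃ d : S.Vh →ₗ[ℂ] S.Vh,
    (∀ n, ∀ x ∈ S.deg n, ∀ y, d (x * y) = d x * y + (-1 : ℂ) ^ n • (x * d y)) ∧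
    (∀ φ, d (vhHor S S.idealHat φ) = diffHor D φ) ∧
    ∀ θ, d (vhInv S S.idealHat θ) = diffInv D θ := by
  refine exists_vhDerivation (diffHor_mul D) (fun a ha => ?_) (diffInv_mul D)
  have h : S.rhoNat D a = 0 := by rw [← curvature_proj, proj_eq_zero ha, map_zero]
  rw [← sub_eq_zero, ← LinearMap.sub_apply, conv_diffInv_sub, LinearMap.comp_apply, h, map_zero]

/-- The differential `∂_D` of `vh_P`. -/
def differential : S.Vh →ₗ[ℂ] S.Vh := (exists_differential D).choose

theorem differential_mul {n : ℕ} {x : S.Vh} (hx : x ∈ S.deg n) (y : S.Vh) :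
    differential D (x * y) = differential D x * y + (-1 : ℂ) ^ n • (x * differential D y) :=
  (exists_differential D).choose_spec.1 n x hx y

theorem differential_hor (φ : H) : differential D (vhHor S S.idealHat φ) = diffHor D φ :=
  (exists_differential D).choose_spec.2.1 φ

theorem differential_inv (θ : InvForms S.idealHat) :
    differential D (vhInv S S.idealHat θ) = diffInv D θ :=
  (exists_differential D).choose_spec.2.2 θ

theorem differential_mem {n : ℕ} {x : S.Vh} (hx : x ∈ S.deg n) :
    differential D x ∈ S.deg (n + 1) := by
  refine vhDeg_induction (C := fun n x => differential D x ∈ S.deg (n + 1)) ?_ ?_ ?_ ?_ ?_ hx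
  · intro n
    rw [map_zero]
    exact Submodule.zero_mem _
  · intro n x y _ _ hx hy
    rw [map_add]
    exact Submodule.add_mem _ hx hy
  · intro n φ hφ
    rw [differential_hor, diffHor_of_mem D hφ]
    exact Submodule.add_mem _ (vhHor_mem S _ (D.2.1.map_mem n φ hφ))
      (Submodule.smul_mem _ _ (vertical_mem S _ hφ))
  · intro θ
    rw [differential_inv, diffInv_apply]
    exact Submodule.add_mem _ (vhHor_mem S _ (curvature_mem D θ))
      (vhEnv_mem S _ (dInv_mem _ θ))
  · intro m n x y hx hy hdx hdy
    rw [differential_mul D hx]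
    refine Submodule.add_mem _ ?_ (Submodule.smul_mem _ _ ?_)
    · have := vh_mul_mem S _ hdx hy
      rwa [add_right_comm] at this
    · exact (vh_mul_mem S _ hx hdy : _ ∈ vhDeg S S.idealHat (m + (n + 1)))

/-- The terms in π*π coming from ∂_D(φ_k) and from dπ(c_k) cancel; the curvature contributes D²(φ).
-/
theorem differential_vertical {n : ℕ} {φ : H} (hφ : φ ∈ 𝓗 n) :
    differential D (vertical S S.idealHat φ) = vertical S S.idealHat (D.1 φ) -
      (-1 : ℂ) ^ n • vhHor S S.idealHat (D.1 (D.1 φ)) := by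
  have h1 : differential D (vertical S S.idealHat φ) =
      S.contr (diffHor D) (vhInv S S.idealHat ∘ₗ proj S.idealHat) φ +
      S.contr (vhHor S S.idealHat).toLinearMap
        ((-1 : ℂ) ^ n • (diffInv D ∘ₗ proj S.idealHat)) φ :=
    map_contr_add S hφ (differential D) fun y hy c => by
      simp only [AlgHom.toLinearMap_apply, LinearMap.comp_apply, LinearMap.smul_apply]
      rw [differential_mul D (vhHor_mem S _ hy), differential_hor, differential_inv,
        mul_smul_comm]
  have h2 : S.contr (diffHor D) (vhInv S S.idealHat ∘ₗ proj S.idealHat) φ =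
      vertical S S.idealHat (D.1 φ) + (-1 : ℂ) ^ n • S.contr (vhHor S S.idealHat).toLinearMap
        (conv (vhInv S S.idealHat ∘ₗ proj S.idealHat) (vhInv S S.idealHat ∘ₗ proj S.idealHat))
        φ := by
    rw [← contr_vertical, diffHor, contr_add_left, ← S.contr_smul (vertical S S.idealHat),
      vertical_comp_of_covariant S _ D.2.1.covariant]
    congr 1
    exact S.contr_congr hφ fun y hy c => by simp [horParity_of_mem hy]
  rw [h1, h2, S.contr_smul (vhHor S S.idealHat).toLinearMap, diffInv_comp_proj,
    S.contr_sub (vhHor S S.idealHat).toLinearMap, hor_contr, (isRhoNat_rhoNat D.2).apply, map_neg,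
    smul_sub, smul_neg]
  abel

/-- The horizontal part is Dϱ, zero by the Bianchi identity. The vertical part V(ϱ(a)) of ∂_D(ϱ(a))
cancels ∂_D of (π*π)(a) by `conv_diffInv_sub`. -/
theorem differential_differential_inv (θ : InvForms S.idealHat) :
    differential D (differential D (vhInv S S.idealHat θ)) = 0 := by
  obtain ⟨a, rfl⟩ := proj_surjective S.idealHat θ
  have h1 : ∀ a, differential D (conv (vhInv S S.idealHat ∘ₗ proj S.idealHat)
      (vhInv S S.idealHat ∘ₗ proj S.idealHat) a) =
      conv (diffInv D ∘ₗ proj S.idealHat) (vhInv S S.idealHat ∘ₗ proj S.idealHat) a -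
      conv (vhInv S S.idealHat ∘ₗ proj S.idealHat) (diffInv D ∘ₗ proj S.idealHat) a := by
    intro a
    simp only [conv, LinearMap.comp_apply]
    generalize comul (R := ℂ) a = t
    induction t with
    | zero => simp
    | add u v hu hv => simp only [map_add, hu, hv]; abel
    | tmul u v =>
      simp only [TensorProduct.map_tmul, LinearMap.mul'_apply, LinearMap.comp_apply]
      rw [differential_mul D (vhInv_mem S _ _), differential_inv, differential_inv]
      simp [sub_eq_add_neg]
  rw [differential_inv, diffInv_apply, map_add, differential_hor,
    diffHor_of_mem D (curvature_mem D _), bianchi, vhEnv_dInv_proj, map_neg, h1,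
    ← LinearMap.sub_apply, conv_diffInv_sub, curvature_proj]
  simp

theorem differential_differential (x : S.Vh) : differential D (differential D x) = 0 := by
  induction x using vh_homogeneous_induction with
  | zero => simp
  | add x y hx hy => simp [hx, hy]
  | homogeneous n x hx =>
    refine vhDeg_induction (C := fun _ x => differential D (differential D x) = 0)
      ?_ ?_ ?_ ?_ ?_ hx
    · simp
    · intro n x y _ _ hx hy
      simp [hx, hy]
    · intro n φ hφ
      rw [differential_hor, diffHor_of_mem D hφ, map_add, map_smul, differential_hor,
        differential_vertical D hφ, diffHor_of_mem D (D.2.1.map_mem n φ hφ), smul_sub, smul_smul,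
        ← mul_pow, pow_succ]
      simp only [mul_neg, mul_one, neg_neg, one_pow, one_smul, neg_smul]
      abel
    · exact differential_differential_inv D
    · intro m n x y hx hy hdx hdy
      rw [differential_mul D hx, map_add, map_smul, differential_mul D (differential_mem D hx),
        differential_mul D hx, hdx, hdy, pow_succ]
      simp

theorem differential_conj (x : S.Vh) :
    differential D (S.conj x) = S.conj (differential D x) := by
  induction x using vh_homogeneous_induction with
  | zero => simp
  | add x y hx hy => simp only [map_add, hx, hy]
  | homogeneous n x hx =>
    refine vhDeg_induction (C := fun _ x => differential D (S.conj x) = S.conj (differential D x))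
      ?_ ?_ ?_ ?_ ?_ hx
    · simp
    · intro n x y _ _ hx hy
      simp only [map_add, hx, hy]
    · intro n φ hφ
      rw [vhStar_hor, differential_hor, differential_hor, diffHor_of_mem D hφ,
        diffHor_of_mem D (S.star_mem n φ hφ), D.2.1.map_star, map_add, map_smulₛₗ, vhStar_hor,
        vhStar_vertical S _ hφ]
      simp
    · intro θ
      rw [vhStar_inv, differential_inv, differential_inv, diffInv_apply, diffInv_apply, map_add,
        vhStar_hor, vhStar_env S _ (dInv_mem _ θ), curvature_invStar, envStar_dInv]
    · intro m n x y hx hy hdx hdy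
      rw [vhStar_mul S _ hx hy, map_smul, differential_mul D (vhStar_mem S _ hy), hdx, hdy,
        differential_mul D hx, map_add, map_smulₛₗ, vhStar_mul S _ (differential_mem D hx) hy,
        vhStar_mul S _ hx (differential_mem D hy), smul_add, smul_smul, smul_smul, add_comm]
      have e1 : (-1 : ℂ) ^ (m * n) * (-1) ^ n = (-1) ^ ((m + 1) * n) := by
        rw [← pow_add]; ring_nf
      have e2 : (-1 : ℂ) ^ (m * n) = starRingEnd ℂ ((-1) ^ m) * (-1) ^ (m * (n + 1)) := by
        rw [map_pow, map_neg, map_one, ← pow_add, mul_add, mul_one, add_comm m, add_assoc,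
          pow_add, ← two_mul, pow_mul]
        simp
      rw [e1, e2]

theorem isDifferentialStarAlgebra :
    IsDifferentialStarAlgebra S.deg S.conj (differential D) where
  one_mem := by
    have := vhHor_mem S S.idealHat (one_mem_zero (𝓗 := 𝓗))
    rwa [map_one] at this
  mul_mem _ _ _ hx _ hy := vh_mul_mem S _ hx hy
  star_mem _ _ hx := vhStar_mem S _ hx
  star_star := vhStar_vhStar S _
  star_mul _ _ _ hx _ hy := vhStar_mul S _ hx hy
  d_mem _ _ hx := differential_mem D hx
  d_mul _ _ hx y := differential_mul D hx y
  d_d := differential_differential D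
  d_star := differential_conj D

theorem isVhDifferential_iff (δ : S.Vh →ₗ[ℂ] S.Vh) :
    S.IsVhDifferential D δ ↔ δ = differential D := by
  constructor
  · intro h
    ext x
    induction x using vh_homogeneous_induction with
    | zero => simp
    | add x y hx hy => simp only [map_add, hx, hy]
    | homogeneous n x hx =>
      refine vhDeg_induction (C := fun _ x => δ x = differential D x) ?_ ?_ ?_ ?_ ?_ hx
      · simp
      · intro n x y _ _ hx hy
        simp only [map_add, hx, hy]
      · intro n φ hφ
        rw [differential_hor, diffHor_of_mem D hφ]
        refine (h.apply_hor n φ hφ).trans ?_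
        rw [vhOfTensor_lTensor]
        rfl
      · intro θ
        rw [differential_inv]
        exact h.apply_inv θ
      · intro m n x y hx hy hdx hdy
        rw [h.leibniz m x hx, differential_mul D hx, hdx, hdy]
  · rintro rfl
    refine ⟨fun n x hx y => differential_mul D hx y, fun n φ hφ => ?_, fun θ => ?_⟩
    · refine (differential_hor D φ).trans ?_
      rw [diffHor_of_mem D hφ, vhOfTensor_lTensor]
      rfl
    · exact differential_inv D θ

end HorizontalForms

end Differential

/-! ### The isomorphisms h_E and the glued algebra. -/

section Twist

variable {A : Type*} [Ring A] [HopfAlgebra ℂ A] [StarRing A] [StarModule ℂ A]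
variable {H : Type*} [Ring H] [Algebra ℂ H] [StarAddMonoid H] [StarModule ℂ H]
variable {𝓗 : ℕ → Submodule ℂ H} [GradedAlgebra 𝓗] {S : HorizontalForms A 𝓗}

namespace HorizontalForms

theorem exists_vadd_eq (D D' : S.preconnections) : ∃ E : S.differences, E +ᵥ D = D' := by
  obtain ⟨D, hD, hD0⟩ := D
  obtain ⟨D', hD', hD0'⟩ := D'
  refine ⟨⟨D' - D, ⟨fun n φ hφ => ?_, fun φ => ?_, fun n φ hφ ψ => ?_, fun φ => ?_⟩,
    fun x => ?_⟩, Subtype.ext (add_sub_cancel D D')⟩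
  · exact Submodule.sub_mem _ (hD'.map_mem n φ hφ) (hD.map_mem n φ hφ)
  · simp [hD.covariant, hD'.covariant, LinearMap.rTensor_sub]
  · simp only [LinearMap.sub_apply, hD.leibniz n φ hφ, hD'.leibniz n φ hφ, sub_mul, mul_sub,
      smul_sub]
    abel
  · simp [hD.map_star, hD'.map_star]
  · simp [hD0, hD0']

theorem vadd_left_cancel {E W : S.differences} {D : S.preconnections} (h : E +ᵥ D = W +ᵥ D) :
    E = W :=
  Subtype.ext (add_left_cancel (congrArg Subtype.val h : D.1 + E.1 = D.1 + W.1))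

theorem add_vadd' (E W : S.differences) (D : S.preconnections) :
    (E + W) +ᵥ D = E +ᵥ (W +ᵥ D) :=
  Subtype.ext (show D.1 + (E.1 + W.1) = D.1 + W.1 + E.1 by abel)

section

variable [CompactMatrixQuantumGroup A]

namespace IsTwist

variable {E W : S.differences} {g g' : S.Vh →ₐ[ℂ] S.Vh}

theorem hor (h : S.IsTwist E g) (φ : H) :
    g (vhHor S S.idealHat φ) = vhHor S S.idealHat φ := h.apply_hor φ

theorem inv (h : S.IsTwist E g) (θ : InvForms S.idealHat) :
    g (vhInv S S.idealHat θ) = vhInv S S.idealHat θ - vhHor S S.idealHat (S.chi E θ) :=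
  h.apply_inv θ

theorem unique (h : S.IsTwist E g) (h' : S.IsTwist E g') : g = g' :=
  vh_algHom_ext (fun φ => by rw [h.hor, h'.hor]) (fun θ => by rw [h.inv, h'.inv])

theorem comp (h : S.IsTwist E g) (h' : S.IsTwist W g') : S.IsTwist (E + W) (g.comp g') where
  apply_hor φ := (congrArg g (h'.hor φ)).trans (h.hor φ)
  apply_inv θ := by
    refine (congrArg g (h'.inv θ)).trans ?_
    rw [map_sub, h.inv, h.hor, chi_add, LinearMap.add_apply, sub_sub, ← map_add]
    rfl

theorem id : S.IsTwist 0 (AlgHom.id ℂ S.Vh) where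
  apply_hor _ := rfl
  apply_inv θ := by
    have : S.ofHor 0 = 0 := map_zero (vhHor S S.idealHat)
    simp [chi_zero, this]

theorem mem_deg (h : S.IsTwist E g) {n : ℕ} {x : S.Vh} (hx : x ∈ S.deg n) : g x ∈ S.deg n := by
  refine vhDeg_induction (C := fun n x => g x ∈ S.deg n) ?_ ?_ ?_ ?_ ?_ hx
  · intro n
    rw [map_zero]
    exact Submodule.zero_mem _
  · intro n x y _ _ hx hy
    rw [map_add]
    exact Submodule.add_mem _ hx hy
  · intro n φ hφ
    rw [h.hor]
    exact vhHor_mem S _ hφ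
  · intro θ
    rw [h.inv]
    exact Submodule.sub_mem _ (vhInv_mem S _ θ) (vhHor_mem S _ (chi_mem E θ))
  · intro m n x y _ _ hx hy
    rw [map_mul]
    exact vh_mul_mem S _ hx hy

theorem conj (h : S.IsTwist E g) (x : S.Vh) : g (S.conj x) = S.conj (g x) := by
  induction x using vh_homogeneous_induction with
  | zero => simp
  | add x y hx hy => simp only [map_add, hx, hy]
  | homogeneous n x hx =>
    refine vhDeg_induction (C := fun _ x => g (S.conj x) = S.conj (g x)) ?_ ?_ ?_ ?_ ?_ hx
    · simp
    · intro n x y _ _ hx hy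
      simp only [map_add, hx, hy]
    · intro n φ hφ
      rw [vhStar_hor, h.hor, h.hor, vhStar_hor]
    · intro θ
      rw [vhStar_inv, h.inv, h.inv, map_sub, vhStar_inv, vhStar_hor, chi_invStar]
    · intro m n x y hx hy hgx hgy
      rw [vhStar_mul S _ hx hy, map_smul, map_mul, map_mul, hgx, hgy,
        vhStar_mul S _ (h.mem_deg hx) (h.mem_deg hy)]

theorem comp_inv_proj (h : S.IsTwist E g) :
    g.toLinearMap ∘ₗ vhInv S S.idealHat ∘ₗ proj S.idealHat =
      vhInv S S.idealHat ∘ₗ proj S.idealHat - (vhHor S S.idealHat).toLinearMap ∘ₗ S.chiNat E :=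
  LinearMap.ext fun a => h.inv (proj S.idealHat a)

/-- Substituting π - χ for π subtracts Σ φ_k χ(c_k), which up to sign is E(φ). The factors (-1)^n
are those of ∂_D(φ), so this is the change from D to D + E on hor_P. -/
theorem vertical (h : S.IsTwist E g) {n : ℕ} {φ : H} (hφ : φ ∈ 𝓗 n) :
    (-1 : ℂ) ^ n • g (QuantumBundle.vertical S S.idealHat φ) =
      (-1 : ℂ) ^ n • QuantumBundle.vertical S S.idealHat φ + vhHor S S.idealHat (E.1 φ) := by
  have h1 : g (QuantumBundle.vertical S S.idealHat φ) =
      S.contr (vhHor S S.idealHat).toLinearMap (vhInv S S.idealHat ∘ₗ proj S.idealHat -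
        (vhHor S S.idealHat).toLinearMap ∘ₗ S.chiNat E) φ :=
    S.map_contr hφ g.toLinearMap fun y _ c => by
      rw [← h.comp_inv_proj]
      simp only [AlgHom.toLinearMap_apply, LinearMap.comp_apply, map_mul]
      rw [h.hor]
  rw [h1, S.contr_sub (vhHor S S.idealHat).toLinearMap, hor_contr,
    (isChiNat_chiNat E.2).apply hφ, map_neg, map_smul, smul_sub, sub_eq_add_neg]
  rfl

end IsTwist

/-- The two mixed terms of the square add up to V∘χ. The formula serves both for the relations
respected by h_E and for comparing ∂_D with ∂_{D+E} on Ψ_inv. -/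
theorem conv_sub_chiNat (E : S.differences) :
    conv (vhInv S S.idealHat ∘ₗ proj S.idealHat - (vhHor S S.idealHat).toLinearMap ∘ₗ S.chiNat E)
      (vhInv S S.idealHat ∘ₗ proj S.idealHat - (vhHor S S.idealHat).toLinearMap ∘ₗ S.chiNat E) =
    conv (vhInv S S.idealHat ∘ₗ proj S.idealHat) (vhInv S S.idealHat ∘ₗ proj S.idealHat) -
      vertical S S.idealHat ∘ₗ S.chiNat E +
      (vhHor S S.idealHat).toLinearMap ∘ₗ conv (S.chiNat E) (S.chiNat E) := by
  have h1 : (vhHor S S.idealHat).toLinearMap ∘ₗ conv (S.chiNat E) (S.chiNat E) =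
      conv ((vhHor S S.idealHat).toLinearMap ∘ₗ S.chiNat E)
        ((vhHor S S.idealHat).toLinearMap ∘ₗ S.chiNat E) :=
    LinearMap.ext fun a => map_conv (vhHor S S.idealHat) _ _ a
  rw [h1, ← (isChiNat_chiNat E.2).conv_proj E.2.1]
  simp only [conv_sub_left, conv_sub_right]
  abel

/-- All three terms of `conv_sub_chiNat` vanish on R̂: π*π by the relations, V∘χ by the definition
of R̂, χ*χ by `conv_chiNat_eq_zero`. The exchange relation follows from `chi_mul`. -/
theorem exists_isTwist (hne : S.preconnections.Nonempty) (E : S.differences) :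
    ∃ g, S.IsTwist E g := by
  let k : InvForms S.idealHat →ₗ[ℂ] S.Vh :=
    vhInv S S.idealHat - (vhHor S S.idealHat).toLinearMap ∘ₗ S.chi E
  have hk : ∀ a ∈ S.idealHat.carrier, quad (k.comp (proj S.idealHat)) a = 0 := by
    intro a ha
    have h1 : conv (vhInv S S.idealHat ∘ₗ proj S.idealHat)
        (vhInv S S.idealHat ∘ₗ proj S.idealHat) a = 0 := by
      have := congrArg (vhEnv S S.idealHat) (quad_envProj ha)
      rwa [quad_eq_conv, map_conv, map_zero, vhEnv_comp_envProj] at this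
    have h2 : S.chiNat E a = 0 := by rw [← chi_proj, proj_eq_zero ha, map_zero]
    refine (LinearMap.congr_fun (conv_sub_chiNat E) a).trans ?_
    simp only [LinearMap.add_apply, LinearMap.sub_apply, LinearMap.comp_apply, h1, h2,
      conv_chiNat_eq_zero hne E ha, map_zero, sub_zero, add_zero]
  have hfk : ∀ n, ∀ φ ∈ 𝓗 n, ∀ θ, k θ * vhHor S S.idealHat φ = (-1 : ℂ) ^ n •
      S.contr (vhHor S S.idealHat).toLinearMap (k ∘ₗ invAct S.idealHat θ) φ := by
    intro n φ hφ θ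
    have h1 : k ∘ₗ invAct S.idealHat θ = vhInv S S.idealHat ∘ₗ invAct S.idealHat θ -
        (vhHor S S.idealHat).toLinearMap ∘ₗ S.chi E ∘ₗ invAct S.idealHat θ := rfl
    have h2 : k θ = vhInv S S.idealHat θ - vhHor S S.idealHat (S.chi E θ) := rfl
    rw [h1, h2, S.contr_sub (vhHor S S.idealHat).toLinearMap, hor_contr, sub_mul,
      vhInv_mul_vhHor S _ θ hφ, ← map_mul, chi_mul E θ hφ, map_smul, smul_sub]
  exact ⟨vhLift S (vhHor S S.idealHat) k hk hfk, fun φ => vhLift_hor _ k hk hfk φ,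
    fun θ => vhLift_inv _ k hk hfk θ⟩

/-- Both sides obey the same Leibniz rule, so generators suffice. On Ψ_inv the equality is the
curvature formula for D + E combined with the square of π - χ. -/
theorem IsTwist.differential {E : S.differences} {g : S.Vh →ₐ[ℂ] S.Vh} (h : S.IsTwist E g)
    (D : S.preconnections) (x : S.Vh) :
    g (HorizontalForms.differential D x) = HorizontalForms.differential (E +ᵥ D) (g x) := by
  induction x using vh_homogeneous_induction with
  | zero => simp
  | add x y hx hy => simp only [map_add, hx, hy]
  | homogeneous n x hx =>
    refine vhDeg_induction (C := fun _ x => g (HorizontalForms.differential D x) =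
      HorizontalForms.differential (E +ᵥ D) (g x)) ?_ ?_ ?_ ?_ ?_ hx
    · simp
    · intro n x y _ _ hx hy
      simp only [map_add, hx, hy]
    · intro n φ hφ
      rw [h.hor, differential_hor, differential_hor, diffHor_of_mem D hφ,
        diffHor_of_mem (E +ᵥ D) hφ, map_add, map_smul, h.hor, h.vertical hφ, coe_vadd,
        LinearMap.add_apply, map_add]
      abel
    · intro θ
      obtain ⟨a, rfl⟩ := proj_surjective S.idealHat θ
      rw [h.inv, map_sub, differential_inv, differential_inv, differential_hor, diffInv_apply,
        diffInv_apply, diffHor_of_mem _ (chi_mem E _), map_add, h.hor, vhEnv_dInv_proj, map_neg,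
        map_conv, h.comp_inv_proj, conv_sub_chiNat, curvature_vadd, coe_vadd]
      simp only [LinearMap.add_apply, LinearMap.sub_apply, LinearMap.comp_apply, map_add, map_sub,
        AlgHom.toLinearMap_apply, pow_one, neg_smul, one_smul, chi_proj]
      abel
    · intro m n x y hx hy hgx hgy
      rw [HorizontalForms.differential_mul D hx, map_add, map_smul, map_mul, map_mul, map_mul, hgx,
        hgy, HorizontalForms.differential_mul (E +ᵥ D) (h.mem_deg hx)]

section Gluing

variable {h : S.differences → (S.Vh →ₐ[ℂ] S.Vh)}

theorem twist_comp (hh : ∀ E, S.IsTwist E (h E)) (E W : S.differences) :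
    (h E).comp (h W) = h (E + W) :=
  ((hh E).comp (hh W)).unique (hh (E + W))

theorem twist_bijective (hh : ∀ E, S.IsTwist E (h E)) (E : S.differences) :
    Function.Bijective (h E) := by
  have h0 : h 0 = AlgHom.id ℂ S.Vh := (hh 0).unique IsTwist.id
  have e1 : -E + E = 0 := Subtype.ext (neg_add_cancel E.1)
  have e2 : E + -E = 0 := Subtype.ext (add_neg_cancel E.1)
  refine Function.bijective_iff_has_inverse.2 ⟨h (-E), fun x => ?_, fun x => ?_⟩
  · rw [← AlgHom.comp_apply, twist_comp hh, e1, h0, AlgHom.id_apply]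
  · rw [← AlgHom.comp_apply, twist_comp hh, e2, h0, AlgHom.id_apply]

/-- The differences act simply transitively on the preconnections, so one component determines a
compatible family and may be prescribed at will. -/
theorem glued_bijective (hh : ∀ E, S.IsTwist E (h E)) (D : S.preconnections) :
    Function.Bijective fun x : S.glued h => (x : S.preconnections → S.Vh) D := by
  constructor
  · intro x y hxy
    refine Subtype.ext (funext fun D' => ?_)
    obtain ⟨E, rfl⟩ := exists_vadd_eq D D'
    rw [x.2 E D, y.2 E D]
    exact congrArg (h E) hxy
  · intro v
    choose E hE using exists_vadd_eq D
    refine ⟨⟨fun D' => h (E D') v, fun W D' => ?_⟩, ?_⟩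
    · have h1 : E (W +ᵥ D') = W + E D' :=
        vadd_left_cancel (D := D) (by rw [hE, add_vadd', hE])
      change h (E (W +ᵥ D')) v = h W (h (E D') v)
      rw [h1, ← twist_comp hh, AlgHom.comp_apply]
    · have h1 : E D = 0 := vadd_left_cancel (D := D)
        ((hE D).trans (Subtype.ext (add_zero D.1).symm))
      change h (E D) v = v
      rw [h1, (hh 0).unique IsTwist.id, AlgHom.id_apply]

end Gluing

end

end HorizontalForms

end Twist

end

end QuantumBundle

theorem proposition3p1
    {A : Type*} [Ring A] [HopfAlgebra ℂ A] [StarRing A] [StarModule ℂ A]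
    [QuantumBundle.CompactMatrixQuantumGroup A]
    {H : Type*} [Ring H] [Algebra ℂ H] [StarAddMonoid H] [StarModule ℂ H]
    (𝓗 : ℕ → Submodule ℂ H) [GradedAlgebra 𝓗]
    (S : QuantumBundle.HorizontalForms A 𝓗)
    (hne : S.preconnections.Nonempty) :
    -- the maps `χ♮_E` and `ϱ♮_D` exist and are unique
    (∀ E ∈ S.differences, ∃! χ : A →ₗ[ℂ] H, S.IsChiNat E χ) ∧
    (∀ D ∈ S.preconnections, ∃! ρ : A →ₗ[ℂ] H, S.IsRhoNat D ρ) ∧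
    -- the formulas for `∂_D` determine a unique map, and `(vh_P, ∂_D)` is a differential *-algebra
    ∃ del : S.preconnections → (S.Vh →ₗ[ℂ] S.Vh),
      (∀ D δ, S.IsVhDifferential D δ ↔ δ = del D) ∧
      (∀ D, QuantumBundle.IsDifferentialStarAlgebra S.deg S.conj (del D)) ∧
      -- (i) existence and uniqueness of `h_E`
      ∃ h : S.differences → (S.Vh →ₐ[ℂ] S.Vh),
        (∀ E g, S.IsTwist E g ↔ g = h E) ∧
        -- (ii) `h_E` is hermitian and bijective
        (∀ E x, h E (S.conj x) = S.conj (h E x)) ∧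
        (∀ E, Function.Bijective (h E)) ∧
        -- (iii) `h_E h_W = h_{E+W}`
        (∀ E W, (h E).comp (h W) = h (E + W)) ∧
        -- (iv) `h_E` is grade-preserving and `h_E ∂_D = ∂_{D+E} h_E`
        (∀ E n, ∀ x ∈ S.deg n, h E x ∈ S.deg n) ∧
        (∀ E D x, h E (del D x) = del (E +ᵥ D) (h E x)) ∧
        -- gluing: every copy of `vh_P` is identified with the glued algebra `Ω_P`, and the
        -- differentials, involutions and gradings of the copies define those of `Ω_P`
        (∀ D, Function.Bijective fun x : S.glued h => (x : S.preconnections → S.Vh) D) ∧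
        (∀ x ∈ S.glued h, (fun D => del D (x D)) ∈ S.glued h) ∧
        (∀ x ∈ S.glued h, (fun D => S.conj (x D)) ∈ S.glued h) ∧
        (∀ n, ∀ x ∈ S.glued h, ∀ D D', x D ∈ S.deg n → x D' ∈ S.deg n) := by
  refine ⟨fun E hE => ?_, fun D hD => ?_, fun D => QuantumBundle.HorizontalForms.differential D,
    fun D δ => QuantumBundle.HorizontalForms.isVhDifferential_iff D δ,
    fun D => QuantumBundle.HorizontalForms.isDifferentialStarAlgebra D, ?_⟩
  · exact ⟨_, QuantumBundle.HorizontalForms.isChiNat_chiNat hE,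
      fun _ h => h.unique (QuantumBundle.HorizontalForms.isChiNat_chiNat hE)⟩
  · exact ⟨_, QuantumBundle.HorizontalForms.isRhoNat_rhoNat hD,
      fun _ h => h.unique (QuantumBundle.HorizontalForms.isRhoNat_rhoNat hD)⟩
  choose h hh using QuantumBundle.HorizontalForms.exists_isTwist hne
  refine ⟨h, fun E g => ⟨fun hg => hg.unique (hh E), fun hg => hg ▸ hh E⟩,
    fun E x => (hh E).conj x, QuantumBundle.HorizontalForms.twist_bijective hh,
    QuantumBundle.HorizontalForms.twist_comp hh, fun E n x hx => (hh E).mem_deg hx,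
    fun E D x => (hh E).differential D x, QuantumBundle.HorizontalForms.glued_bijective hh,
    fun x hx E D => ?_, fun x hx E D => ?_, fun n x hx D D' hxD => ?_⟩
  · exact (congrArg _ (hx E D)).trans ((hh E).differential D (x D)).symm
  · exact (congrArg _ (hx E D)).trans ((hh E).conj (x D)).symm
  · obtain ⟨E, rfl⟩ := QuantumBundle.HorizontalForms.exists_vadd_eq D D'
    rw [hx E D]
    exact (hh E).mem_deg hxD
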